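/- There exist an algorithm, an elementary function $g:\mathbb N\to\mathbb N$ and a constant $c$ such that the following holds. Given a graph $G$ with $n\ge 1$ vertices, the algorithm computes, in time at most $g(p)\cdot n^{c}$, a contraction sequence of $G$ of width at most $2\cdot\mathrm{tww}(G)$, where $p$ is the vertex integrity of $G$ (which is not part of the input). Here the vertex integrity of $G$ is the smallest $p$ for which there is a set $S\subseteq V(G)$ with $|S|\le p$ such that $|V(H)\cup S|\le p$ for each connected component $H$ of $G-S$. A trigraph is a graph whose edges are partitioned into black and red edges; a graph is a trigraph with black edges only. Contracting two distinct vertices $u,v$ (adjacent or not) of a trigraph replaces them by a new vertex $w$, which receives a black edge to each remaining vertex joined by black edges to both $u$ and $v$, and a red edge to each remaining vertex that is joined by a red edge to $u$ or $v$ or by a black edge to exactly one of them; all other edges are kept. A contraction sequence of $G$ is a sequence of trigraphs that starts with $G$, ends with a single-vertex trigraph, and in which each trigraph arises from the previous one by one contraction; it is output as the list of contracted pairs, where the new vertex $w$ is again named $u$. Its width is the maximum red degree of a vertex in any of its trigraphs, and the twin-width $\mathrm{tww}(G)$ is the minimum width of a contraction sequence of $G$. The graph is given by its adjacency matrix. Elementary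 means elementary in the sense of Kalmár. Time is the number of steps of a WHILE program over binary trees (finitely many variables; the operations copy, pair, first component, second component and test for the empty tree cost one step each), a model that agrees with Turing machines and random access machines up to a polynomial. -/

import Mathlib

/-! ### Vertex integrity -/

/-- The vertex integrity of `G`: the least `p` such that some vertex set `S` with `|S| ≤ p` satisfies
`|V(H) ∪ S| ≤ p` for every connected component `H` of `G - S`. (The clause `|S| ≤ p` only matters
when `G - S` has no vertices, hence no components; it makes the quantity equal to the usual
`min_S (|S| + max_H |V(H)|)`.) -/
noncomputable def vertexIntegrity {V : Type*} (G : SimpleGraph V) : ℕ :=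
  sInf {p : ℕ | ∃ S : Finset V, S.card ≤ p ∧
    ∀ H : (G.induce ((S : Set V)ᶜ)).ConnectedComponent,
      ((Subtype.val '' H.supp) ∪ (S : Set V)).ncard ≤ p}

/-! ### Trigraphs, contraction sequences and twin-width -/

/-- A trigraph whose vertices are taken from `V`: a finite vertex set, and an edge set partitioned
into black and red edges. -/
structure Trigraph (V : Type*) where
  verts : Finset V
  black : SimpleGraph V
  red : SimpleGraph V
  black_mem : ∀ x y, black.Adj x y → x ∈ verts
  red_mem : ∀ x y, red.Adj x y → x ∈ verts
  black_red : ∀ x y, black.Adj x y → ¬ red.Adj x y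

namespace Trigraph

variable {V : Type*}

/-- A graph is a trigraph without red edges. -/
def ofGraph [Fintype V] (G : SimpleGraph V) : Trigraph V where
  verts := Finset.univ
  black := G
  red := ⊥
  black_mem _ _ _ := Finset.mem_univ _
  red_mem _ _ _ := Finset.mem_univ _
  black_red _ _ _ := id

/-- The contraction of two distinct vertices `u`, `v` of `T`. The new vertex replaces `u` and `v`
and is again called `u` (so that its name is not one of a remaining vertex). It gets a black edge to
each `x` joined by black edges to both `u` and `v`, and a red edge to each `y` that has a red edge
to `u` or to `v`, or a black edge to exactly one of them; edges between other vertices are kept. -/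
def contract [DecidableEq V] (T : Trigraph V) (u v : V) : Trigraph V where
  verts := T.verts.erase v
  black :=
    { Adj x y := x ≠ v ∧ y ≠ v ∧ T.black.Adj x y ∧
        (x = u → T.black.Adj v y) ∧ (y = u → T.black.Adj v x)
      symm := ⟨fun _ _ h => ⟨h.2.1, h.1, h.2.2.1.symm, h.2.2.2.2, h.2.2.2.1⟩⟩
      loopless := ⟨fun _ h => h.2.2.1.ne rfl⟩ }
  red :=
    { Adj x y := x ∈ T.verts.erase v ∧ y ∈ T.verts.erase v ∧ x ≠ y ∧
        (T.red.Adj x y ∨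
          (x = u ∧ (T.red.Adj v y ∨ Xor (T.black.Adj u y) (T.black.Adj v y))) ∨
          (y = u ∧ (T.red.Adj v x ∨ Xor (T.black.Adj u x) (T.black.Adj v x))))
      symm := ⟨fun _ _ h =>
        ⟨h.2.1, h.1, h.2.2.1.symm, h.2.2.2.imp (fun a => a.symm) Or.symm⟩⟩
      loopless := ⟨fun _ h => h.2.2.1 rfl⟩ }
  black_mem x y h := Finset.mem_erase.2 ⟨h.1, T.black_mem x y h.2.2.1⟩
  red_mem _ _ h := h.1
  black_red := by
    rintro x y ⟨-, -, h, hx, hy⟩ ⟨-, -, -, h1 | ⟨rfl, h1 | h1⟩ | ⟨rfl, h1 | h1⟩⟩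
    · exact T.black_red _ _ h h1
    · exact T.black_red _ _ (hx rfl) h1
    · exact h1.elim (fun a => a.2 (hx rfl)) (fun a => a.2 h)
    · exact T.black_red _ _ (hy rfl) h1
    · exact h1.elim (fun a => a.2 (hy rfl)) (fun a => a.2 h.symm)

/-- The number of red edges incident to `u`. -/
noncomputable def redDegree (T : Trigraph V) (u : V) : ℕ := {x | T.red.Adj u x}.ncard

noncomputable def maxRedDegree (T : Trigraph V) : ℕ := T.verts.sup T.redDegree

variable [DecidableEq V]

/-- The trigraphs `G₁ = T, G₂, …` obtained by contracting the listed pairs one after another. -/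
def trigraphs : Trigraph V → List (V × V) → List (Trigraph V)
  | T, [] => [T]
  | T, e :: L => T :: trigraphs (T.contract e.1 e.2) L

/-- The list `L` of pairs describes a contraction sequence of `T`: each pair consists of two distinct
vertices of the current trigraph, and the last trigraph has a single vertex. -/
def IsContractionSeq : Trigraph V → List (V × V) → Prop
  | T, [] => T.verts.card = 1
  | T, e :: L => e.1 ∈ T.verts ∧ e.2 ∈ T.verts ∧ e.1 ≠ e.2 ∧
      IsContractionSeq (T.contract e.1 e.2) L

/-- The width of a contraction sequence: the maximum red degree over all vertices of all its
trigraphs. -/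
noncomputable def width (T : Trigraph V) (L : List (V × V)) : ℕ :=
  ((T.trigraphs L).map maxRedDegree).foldr max 0

end Trigraph

/-- The twin-width of a (nonempty) finite graph: the least width of a contraction sequence. -/
noncomputable def twinWidth {V : Type*} [Fintype V] [DecidableEq V] (G : SimpleGraph V) : ℕ :=
  sInf {w : ℕ | ∃ L : List (V × V),
    (Trigraph.ofGraph G).IsContractionSeq L ∧ (Trigraph.ofGraph G).width L = w}

/-! ### Elementary functions -/

/-- Kalmár's elementary functions: the least class of functions `ℕ^k → ℕ` that contains zero,
successor, projections, addition and truncated subtraction, and is closed under composition, bounded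
sums and bounded products. -/
inductive Elementary : {k : ℕ} → ((Fin k → ℕ) → ℕ) → Prop
  | zero {k : ℕ} : Elementary (fun _ : Fin k → ℕ => 0)
  | succ : Elementary (fun v : Fin 1 → ℕ => v 0 + 1)
  | proj {k : ℕ} (i : Fin k) : Elementary (fun v : Fin k → ℕ => v i)
  | add : Elementary (fun v : Fin 2 → ℕ => v 0 + v 1)
  | sub : Elementary (fun v : Fin 2 → ℕ => v 0 - v 1)
  | comp {k m : ℕ} {f : (Fin m → ℕ) → ℕ} {g : Fin m → (Fin k → ℕ) → ℕ} :
      Elementary f → (∀ i, Elementary (g i)) → Elementary (fun v => f (fun i => g i v))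
  | boundedSum {k : ℕ} {f : (Fin (k + 1) → ℕ) → ℕ} : Elementary f →
      Elementary (fun v : Fin (k + 1) → ℕ =>
        ∑ z ∈ Finset.range (v 0), f (Fin.cons z (Fin.tail v)))
  | boundedProd {k : ℕ} {f : (Fin (k + 1) → ℕ) → ℕ} : Elementary f →
      Elementary (fun v : Fin (k + 1) → ℕ =>
        ∏ z ∈ Finset.range (v 0), f (Fin.cons z (Fin.tail v)))

/-! ### The machine model: WHILE programs over binary trees, with step count

This is the textbook WHILE language (N. Jones): finitely many variables hold binary trees, that is,
pointers to pairs. The only operations are building a pair, taking a component of a pair, testing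
for `nil`, and copying pointers; each of them is charged one step. Every step is thus a bounded
number of operations of a pointer machine or a random access machine, and running times agree
with those of Turing machines up to a polynomial. -/

/-- The data values: binary trees. -/
inductive Data : Type
  | nil : Data
  | cons : Data → Data → Data

namespace Data

/-- First component; `nil` for `nil`. -/
def hd : Data → Data
  | nil => nil
  | cons a _ => a

/-- Second component; `nil` for `nil`. -/
def tl : Data → Data
  | nil => nil
  | cons _ b => b

/-- Lists of data, built from `nil` and `cons`. -/
def ofList : List Data → Data
  | [] => nil
  | a :: l => cons a (ofList l)

/-- Natural numbers in unary. -/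
def ofNat : ℕ → Data
  | 0 => nil
  | k + 1 => cons nil (ofNat k)

/-- A graph on the vertices `0, …, n - 1`, encoded as its adjacency matrix: the list of its `n` rows,
each a list of `n` bits, where the bits 0 and 1 are `nil` and `cons nil nil`. -/
noncomputable def ofGraph {n : ℕ} (G : SimpleGraph (Fin n)) : Data :=
  open Classical in
  ofList (List.ofFn fun i => ofList (List.ofFn fun j => if G.Adj i j then cons nil nil else nil))

/-- A list of pairs of vertices. -/
def ofPairs {n : ℕ} (L : List (Fin n × Fin n)) : Data :=
  ofList (L.map fun e => cons (ofNat e.1) (ofNat e.2))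

end Data

namespace While

/-- Expressions; variables are numbered. -/
inductive Expr : Type
  | var : ℕ → Expr
  | nil : Expr
  | cons : Expr → Expr → Expr
  | hd : Expr → Expr
  | tl : Expr → Expr

/-- The contents of the variables. -/
abbrev Store : Type := ℕ → Data

/-- The value of an expression. -/
def Expr.eval (s : Store) : Expr → Data
  | var i => s i
  | nil => Data.nil
  | cons a b => Data.cons (a.eval s) (b.eval s)
  | hd a => (a.eval s).hd
  | tl a => (a.eval s).tl

/-- The number of steps needed to evaluate an expression: one for each operation in it. -/
def Expr.cost : Expr → ℕ
  | var _ => 1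
  | nil => 1
  | cons a b => a.cost + b.cost + 1
  | hd a => a.cost + 1
  | tl a => a.cost + 1

/-- Programs. In `ite` and `loop` the value `nil` of the expression means false, and every other
value means true. -/
inductive Prog : Type
  | skip : Prog
  | assign : ℕ → Expr → Prog
  | seq : Prog → Prog → Prog
  | ite : Expr → Prog → Prog → Prog
  | loop : Expr → Prog → Prog

/-- `Runs P s s₁ t`: started with store `s`, the program `P` halts with store `s₁` after exactly `t`
steps. Every executed command and every test costs one step plus the cost of its expression. -/
inductive Runs : Prog → Store → Store → ℕ → Prop
  | skip (s : Store) : Runs .skip s s 1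
  | assign (s : Store) (i : ℕ) (e : Expr) :
      Runs (.assign i e) s (Function.update s i (e.eval s)) (e.cost + 1)
  | seq {P Q : Prog} {s s₁ s₂ : Store} {t₁ t₂ : ℕ} :
      Runs P s s₁ t₁ → Runs Q s₁ s₂ t₂ → Runs (.seq P Q) s s₂ (t₁ + t₂ + 1)
  | iteTrue {e : Expr} {P Q : Prog} {s s₁ : Store} {t : ℕ} :
      e.eval s ≠ Data.nil → Runs P s s₁ t → Runs (.ite e P Q) s s₁ (e.cost + t + 1)
  | iteFalse {e : Expr} {P Q : Prog} {s s₁ : Store} {t : ℕ} :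
      e.eval s = Data.nil → Runs Q s s₁ t → Runs (.ite e P Q) s s₁ (e.cost + t + 1)
  | loopTrue {e : Expr} {P : Prog} {s s₁ s₂ : Store} {t₁ t₂ : ℕ} :
      e.eval s ≠ Data.nil → Runs P s s₁ t₁ → Runs (.loop e P) s₁ s₂ t₂ →
      Runs (.loop e P) s s₂ (e.cost + t₁ + t₂ + 1)
  | loopFalse {e : Expr} {P : Prog} {s : Store} :
      e.eval s = Data.nil → Runs (.loop e P) s s (e.cost + 1)

/-- The initial store: the input is in variable `0`, all other variables hold `nil`. -/
def input (d : Data) : Store := Function.update (fun _ => Data.nil) 0 d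

/-- On input `d` the program halts after exactly `t` steps with output `r` in variable `0`. -/
def Prog.Outputs (P : Prog) (d r : Data) (t : ℕ) : Prop :=
  ∃ s : Store, Runs P (input d) s t ∧ s 0 = r

end While

/-!
Let `p` be the vertex integrity of `G`. The set `S` of the vertices of degree at least `p` is
contained in every witnessing set, and the components of `G - S` have size bounded in terms of `p`
(`big_spec`). Two components are *similar* if their vertices, listed in increasing order, are
joined in the same way to each other and to `S`; there are boundedly many classes. The *kernel* `W`
consists of `S` and the first `b` components of each class, so its size is bounded as well, for
bounded `b`.

A contraction sequence of `G` induces one of the kernel of no larger width (`IsSeq.restrict`).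
Conversely, a contraction sequence of the kernel of width `k` extends to one of `G` of width at
most `2 * k`, if `b` is large (`exists_tokens`). Deleted components stay uncontracted until a
similar component of the kernel is *fully mixed*: each of its parts also has vertices elsewhere in
the kernel. Then each deleted copy is absorbed: it repeats the contractions that have been made
inside the kept component, and then its parts are merged with their counterparts. Meanwhile the red
degrees at most double (`redBound_internal`, `redBound_merge`), and afterwards the absorbed
vertices make no difference, because all nonuniform pairs of parts are red already
(`sameAdj_absorb`). Deleted components that are not yet absorbed have no red edges, as long as the
vertices of any part have the same neighbours in them. If a contraction is about to violate this at
a component, then the bounded red degree makes the corresponding vertices of many of its `b` kept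
copies lie in few parts, and by the pigeonhole principle one copy is already fully mixed
(`exists_fullyMixed_of_split`), so the component has been absorbed.

Only the times of absorption have to be found. A *token list* is a contraction sequence of the
kernel in which pairs `(h, h)` stand for the request that the component of `h` absorbs its copies.
Token lists of length at most `2 * |W|` suffice, so all of them can be tried. The least width `w`
of a contraction sequence of the kernel is found among them too, and `w ≤ tww(G)`; hence any
expanded token list that is verified to have width at most `2 * w` is a correct output, whatever
the values of the parameters (`solve_sound`). Since `p` and `b` are unknown, all values below `u`
are tried with at most `u` token lists, for `u = 0, 1, 2, …`; this takes time polynomial in `G` and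
`u` (`PolyTime.solve`, `PolyTime.exists_search`), and succeeds at the latest for an elementary
function `searchBound` of `p` (`solve_searchBound`). The twin-width in the choice of `b` is itself
bounded in terms of `p`, since all deleted components can be absorbed at the very beginning
(`exists_isSeq_kernel`).

Trigraphs are treated as partitions of the vertex set into parts named by vertices: two parts are
joined by a red edge if and only if some but not all pairs of their vertices are adjacent
(`Represents.contract`, `twinWidth_le_iff`). Polynomial time is a property `PolyTime` of functions
on encoded data that is closed under composition and iteration over lists.
-/

open Polynomial

/-! ### Polynomial-time functions -/

namespace Data

/-- The number of nodes of a binary tree. -/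
def size : Data → ℕ
  | nil => 1
  | cons a b => a.size + b.size + 1

theorem size_pos (d : Data) : 1 ≤ d.size := by
  cases d <;> simp [size]

end Data

/-- A representation of the elements of `α` by binary trees. -/
class TreeEncoding (α : Type) where
  /-- The tree that represents an element. -/
  enc : α → Data

open TreeEncoding (enc)

instance : TreeEncoding Unit := ⟨fun _ => .nil⟩
instance : TreeEncoding Bool := ⟨fun b => if b then .cons .nil .nil else .nil⟩
instance : TreeEncoding ℕ := ⟨Data.ofNat⟩
instance {α β : Type} [TreeEncoding α] [TreeEncoding β] : TreeEncoding (α × β) :=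
  ⟨fun p => .cons (enc p.1) (enc p.2)⟩
instance {α : Type} [TreeEncoding α] : TreeEncoding (List α) := ⟨fun l => Data.ofList (l.map enc)⟩
instance {α : Type} [TreeEncoding α] : TreeEncoding (Option α) :=
  ⟨fun o => Data.ofList (o.toList.map enc)⟩

/-- The size of the tree that represents `a`. -/
def treeSize {α : Type} [TreeEncoding α] (a : α) : ℕ := (enc a).size

section sizes

variable {α β : Type} [TreeEncoding α] [TreeEncoding β]

theorem treeSize_pos (a : α) : 1 ≤ treeSize a := Data.size_pos _

@[simp] theorem treeSize_prod (a : α) (b : β) :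
    treeSize (a, b) = treeSize a + treeSize b + 1 := rfl

@[simp] theorem treeSize_nil : treeSize ([] : List α) = 1 := rfl

@[simp] theorem treeSize_cons (a : α) (l : List α) :
    treeSize (a :: l) = treeSize a + treeSize l + 1 := rfl

@[simp] theorem treeSize_none : treeSize (none : Option α) = 1 := rfl

@[simp] theorem treeSize_some (a : α) : treeSize (some a) = treeSize a + 2 := rfl

@[simp] theorem treeSize_nat (n : ℕ) : treeSize n = 2 * n + 1 := by
  induction n with
  | zero => rfl
  | succ n ih =>
    change Data.size Data.nil + treeSize n + 1 = _
    rw [ih, Data.size]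
    omega

theorem treeSize_bool (b : Bool) : treeSize b ≤ 3 := by
  cases b <;> decide

theorem treeSize_le_of_mem {a : α} {l : List α} (h : a ∈ l) : treeSize a ≤ treeSize l := by
  induction l with
  | nil => simp at h
  | cons x l ih =>
    rcases List.mem_cons.1 h with rfl | h
    · simp only [treeSize_cons]; omega
    · have := ih h
      simp only [treeSize_cons]; omega

theorem length_le_treeSize (l : List α) : l.length ≤ treeSize l := by
  induction l with
  | nil => simp
  | cons x l ih => simp only [treeSize_cons, List.length_cons]; omega

theorem treeSize_append (l m : List α) : treeSize (l ++ m) + 1 = treeSize l + treeSize m := by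
  induction l with
  | nil => simp; omega
  | cons x l ih => simp only [treeSize_cons, List.cons_append]; omega

theorem treeSize_reverse (l : List α) : treeSize l.reverse = treeSize l := by
  induction l with
  | nil => rfl
  | cons x l ih =>
    have := treeSize_append l.reverse [x]
    simp only [treeSize_cons, List.reverse_cons, treeSize_nil] at *
    omega

theorem treeSize_sublist {l m : List α} (h : l.Sublist m) : treeSize l ≤ treeSize m := by
  induction h with
  | slnil => simp
  | cons a _ ih => simp only [treeSize_cons]; omega
  | cons_cons a _ ih => simp only [treeSize_cons]; omega

theorem treeSize_list_le {l : List α} {N B : ℕ} (hl : l.length ≤ N)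
    (h : ∀ a ∈ l, treeSize a ≤ B) : treeSize l ≤ N * (B + 1) + 1 := by
  have : treeSize l ≤ l.length * (B + 1) + 1 := by
    clear hl
    induction l with
    | nil => simp
    | cons x l ih =>
      have h1 := ih fun a ha => h a (List.mem_cons_of_mem _ ha)
      have h2 := h x List.mem_cons_self
      simp only [treeSize_cons, List.length_cons, Nat.add_mul]
      omega
  exact this.trans (by gcongr)

end sizes

theorem Polynomial.eval_mono_nat (p : ℕ[X]) : Monotone fun x => p.eval x := by
  intro x y h
  simp only [Polynomial.eval_eq_sum_range]
  gcongr

/-- A natural number depending on `a` that is bounded by a polynomial in the size of `a`. -/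
def PolyBounded {α : Type} [TreeEncoding α] (f : α → ℕ) : Prop :=
  ∃ p : ℕ[X], ∀ a, f a ≤ p.eval (treeSize a)

section polyBounded

variable {α : Type} [TreeEncoding α] {f g : α → ℕ}

theorem PolyBounded.mono (hg : PolyBounded g) (h : ∀ a, f a ≤ g a) : PolyBounded f :=
  hg.imp fun _ hp a => (h a).trans (hp a)

theorem PolyBounded.const (n : ℕ) : PolyBounded fun _ : α => n := ⟨C n, by simp⟩

theorem PolyBounded.add (hf : PolyBounded f) (hg : PolyBounded g) :
    PolyBounded fun a => f a + g a := by
  obtain ⟨p, hp⟩ := hf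
  obtain ⟨q, hq⟩ := hg
  refine ⟨p + q, fun a => ?_⟩
  rw [eval_add]
  exact add_le_add (hp a) (hq a)

theorem PolyBounded.mul (hf : PolyBounded f) (hg : PolyBounded g) :
    PolyBounded fun a => f a * g a := by
  obtain ⟨p, hp⟩ := hf
  obtain ⟨q, hq⟩ := hg
  refine ⟨p * q, fun a => ?_⟩
  rw [eval_mul]
  exact Nat.mul_le_mul (hp a) (hq a)

theorem PolyBounded.comp (p : ℕ[X]) (hf : PolyBounded f) : PolyBounded fun a => p.eval (f a) := by
  obtain ⟨q, hq⟩ := hf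
  refine ⟨p.comp q, fun a => ?_⟩
  rw [eval_comp]
  exact p.eval_mono_nat (hq a)

theorem polyBounded_treeSize : PolyBounded fun a : α => treeSize a := ⟨X, by simp⟩

end polyBounded

open While in
/-- `f` is computed in polynomial time, with values of polynomial size. For every `k` there is such
a program that finds its argument in variable `k`, leaves the value there, and does not change the
variables below `k`; the variables above `k` may hold anything before and after. This makes it
possible to compose programs without renaming variables. -/
@[fun_prop]
def PolyTime {α β : Type} [TreeEncoding α] [TreeEncoding β] (f : α → β) : Prop :=
  (PolyBounded fun a => treeSize (f a)) ∧ ∃ T : α → ℕ, PolyBounded T ∧ ∀ k : ℕ, ∃ P : Prog,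
    ∀ (s : Store) (a : α), s k = enc a → ∃ (s' : Store) (t : ℕ), Runs P s s' t ∧ t ≤ T a ∧
      s' k = enc (f a) ∧ ∀ j < k, s' j = s j

namespace PolyTime

open While

variable {α β γ δ : Type} [TreeEncoding α] [TreeEncoding β] [TreeEncoding γ] [TreeEncoding δ]

/-- A single assignment that computes `f`. -/
theorem of_expr {f : α → β} (hs : PolyBounded fun a => treeSize (f a)) (e : ℕ → Expr) (c : ℕ)
    (hc : ∀ k, (e k).cost ≤ c)
    (he : ∀ (k : ℕ) (s : Store) (a : α), s k = enc a → (e k).eval s = enc (f a)) : PolyTime f := by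
  refine ⟨hs, fun _ => c + 1, .const _, fun k => ⟨.assign k (e k), fun s a h =>
    ⟨_, _, .assign s k (e k), Nat.succ_le_succ (hc k), ?_, fun j hj => ?_⟩⟩⟩
  · rw [Function.update_self, he k s a h]
  · rw [Function.update_of_ne hj.ne]

/-- An expression without variables for a given tree. -/
def dataExpr : Data → Expr
  | .nil => .nil
  | .cons a b => .cons (dataExpr a) (dataExpr b)

theorem dataExpr_eval (s : Store) (d : Data) : (dataExpr d).eval s = d := by
  induction d with
  | nil => rfl
  | cons a b iha ihb => rw [dataExpr, Expr.eval, iha, ihb]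

@[fun_prop]
theorem const (b : β) : PolyTime fun _ : α => b :=
  of_expr (.const _) (fun _ => dataExpr (enc b)) _ (fun _ => le_rfl)
    fun _ s _ _ => dataExpr_eval s _

@[fun_prop]
theorem comp {f : β → γ} {g : α → β} (hf : PolyTime f) (hg : PolyTime g) :
    PolyTime fun a => f (g a) := by
  obtain ⟨⟨pf, hpf⟩, Tf, ⟨p, hp⟩, hf⟩ := hf
  obtain ⟨hpg, Tg, hTg, hg⟩ := hg
  refine ⟨(hpg.comp pf).mono fun a => hpf _, fun a => Tg a + p.eval (treeSize (g a)) + 1,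
    (hTg.add (hpg.comp p)).add (.const 1), fun k => ?_⟩
  obtain ⟨P, hP⟩ := hf k
  obtain ⟨Q, hQ⟩ := hg k
  refine ⟨.seq Q P, fun s a h => ?_⟩
  obtain ⟨s₁, t₁, hr₁, ht₁, hk₁, hj₁⟩ := hQ s a h
  obtain ⟨s₂, t₂, hr₂, ht₂, hk₂, hj₂⟩ := hP s₁ _ hk₁
  exact ⟨s₂, _, .seq hr₁ hr₂, by have := hp (g a); dsimp only; omega, hk₂,
    fun j hj => (hj₂ j hj).trans (hj₁ j hj)⟩

@[fun_prop]
theorem prodMk {f : α → β} {g : α → γ} (hf : PolyTime f) (hg : PolyTime g) :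
    PolyTime fun a => (f a, g a) := by
  obtain ⟨hpf, Tf, hTf, hf⟩ := hf
  obtain ⟨hpg, Tg, hTg, hg⟩ := hg
  refine ⟨(hpf.add hpg).add (.const 1), fun a => Tf a + Tg a + 12,
    (hTf.add hTg).add (.const _), fun k => ?_⟩
  obtain ⟨P, hP⟩ := hf (k + 1)
  obtain ⟨Q, hQ⟩ := hg (k + 2)
  refine ⟨.seq (.assign (k + 1) (.var k)) (.seq P (.seq (.assign (k + 2) (.var k)) (.seq Q
    (.assign k (.cons (.var (k + 1)) (.var (k + 2))))))), fun s a h => ?_⟩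
  obtain ⟨s₁, t₁, hr₁, ht₁, hk₁, hj₁⟩ :=
    hP (Function.update s (k + 1) ((Expr.var k).eval s)) a (by simp [Expr.eval, h])
  obtain ⟨s₂, t₂, hr₂, ht₂, hk₂, hj₂⟩ :=
    hQ (Function.update s₁ (k + 2) ((Expr.var k).eval s₁)) a (by
      simp [Expr.eval, hj₁ k (by omega), h])
  refine ⟨_, _, .seq (.assign ..) (.seq hr₁ (.seq (.assign ..) (.seq hr₂ (.assign ..)))), ?_, ?_,
    ?_⟩
  · simp only [Expr.cost]; omega
  · simp only [Function.update_self, Expr.eval, hk₂, hj₂ (k + 1) (by omega)]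
    rw [Function.update_of_ne (by omega), hk₁]
    rfl
  · intro j hj
    rw [Function.update_of_ne hj.ne, hj₂ j (by omega), Function.update_of_ne (by omega),
      hj₁ j (by omega), Function.update_of_ne (by omega)]

@[fun_prop]
theorem fst : PolyTime (Prod.fst : α × β → α) :=
  of_expr (polyBounded_treeSize.mono fun ⟨a, b⟩ => by simp only [treeSize_prod]; omega)
    (fun k => .hd (.var k)) 2 (fun _ => le_rfl) fun k s a h => by
      simp only [Expr.eval, h]; rfl

@[fun_prop]
theorem snd : PolyTime (Prod.snd : α × β → β) :=
  of_expr (polyBounded_treeSize.mono fun ⟨a, b⟩ => by simp only [treeSize_prod]; omega)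
    (fun k => .tl (.var k)) 2 (fun _ => le_rfl) fun k s a h => by
      simp only [Expr.eval, h]; rfl

@[fun_prop]
theorem cond {c : α → Bool} {f g : α → β} (hc : PolyTime c) (hf : PolyTime f) (hg : PolyTime g) :
    PolyTime fun a => bif c a then f a else g a := by
  obtain ⟨-, Tc, hTc, hc⟩ := hc
  obtain ⟨hpf, Tf, hTf, hf⟩ := hf
  obtain ⟨hpg, Tg, hTg, hg⟩ := hg
  refine ⟨(hpf.add hpg).mono fun a => by dsimp only; cases c a <;> simp,
    fun a => Tc a + (Tf a + Tg a) + 8,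
    (hTc.add (hTf.add hTg)).add (.const _), fun k => ?_⟩
  obtain ⟨R, hR⟩ := hc (k + 1)
  obtain ⟨P, hP⟩ := hf k
  obtain ⟨Q, hQ⟩ := hg k
  refine ⟨.seq (.assign (k + 1) (.var k)) (.seq R (.ite (.var (k + 1)) P Q)), fun s a h => ?_⟩
  obtain ⟨s₁, t₁, hr₁, ht₁, hk₁, hj₁⟩ :=
    hR (Function.update s (k + 1) ((Expr.var k).eval s)) a (by simp [Expr.eval, h])
  have hk : s₁ k = enc a := by
    rw [hj₁ k (by omega), Function.update_of_ne (by omega), h]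
  have hlt : ∀ j < k, s₁ j = s j := fun j hj => by
    rw [hj₁ j (by omega), Function.update_of_ne (by omega)]
  cases hca : c a with
  | true =>
    obtain ⟨s₂, t₂, hr₂, ht₂, hk₂, hj₂⟩ := hP s₁ a hk
    refine ⟨s₂, _, .seq (.assign ..) (.seq hr₁ (.iteTrue ?_ hr₂)), ?_, by simp [hca, hk₂],
      fun j hj => (hj₂ j hj).trans (hlt j hj)⟩
    · rw [Expr.eval, hk₁, hca]
      exact fun h => Data.noConfusion h
    · simp only [Expr.cost]; omega
  | false =>
    obtain ⟨s₂, t₂, hr₂, ht₂, hk₂, hj₂⟩ := hQ s₁ a hk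
    refine ⟨s₂, _, .seq (.assign ..) (.seq hr₁ (.iteFalse ?_ hr₂)), ?_, by simp [hca, hk₂],
      fun j hj => (hj₂ j hj).trans (hlt j hj)⟩
    · rw [Expr.eval, hk₁, hca]
      rfl
    · simp only [Expr.cost]; omega

/-- Iteration over a list. The values of the accumulator have to be of polynomial size. -/
theorem foldl {l : α → List γ} {i : α → β} {f : α → β → γ → β} {B : α → ℕ} (hB : PolyBounded B)
    (hs : ∀ a, ∀ m, m <+: l a → treeSize (m.foldl (f a) (i a)) ≤ B a)
    (hl : PolyTime l) (hi : PolyTime i) (hf : PolyTime fun p : α × β × γ => f p.1 p.2.1 p.2.2) :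
    PolyTime fun a => (l a).foldl (f a) (i a) := by
  obtain ⟨hpl, Tl, hTl, hl⟩ := hl
  obtain ⟨hpi, Ti, hTi, hi⟩ := hi
  obtain ⟨-, Tf, ⟨p, hp⟩, hf⟩ := hf
  refine ⟨hB.mono fun a => hs a _ (List.prefix_refl _), fun a => Tl a + Ti a + treeSize (l a) *
    (p.eval (treeSize a + (B a + treeSize (l a) + 1) + 1) + 30) + 30,
    ((hTl.add hTi).add (hpl.mul (((((polyBounded_treeSize.add ((hB.add hpl).add
      (.const _))).add (.const _)).comp p)).add (.const _)))).add (.const _), fun k => ?_⟩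
  obtain ⟨P, hP⟩ := hl (k + 1)
  obtain ⟨Q, hQ⟩ := hi (k + 2)
  obtain ⟨R, hR⟩ := hf (k + 3)
  -- variable `k` keeps the argument, `k + 1` the rest of the list, `k + 2` the accumulator
  set body : Prog := .seq (.assign (k + 3) (.cons (.var k) (.cons (.var (k + 2))
    (.hd (.var (k + 1)))))) (.seq R (.seq (.assign (k + 2) (.var (k + 3)))
      (.assign (k + 1) (.tl (.var (k + 1)))))) with hbody
  have loop : ∀ (a : α) (m₂ m₁ : List γ), m₁ ++ m₂ = l a → ∀ s : Store, s k = enc a →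
      s (k + 1) = enc m₂ → s (k + 2) = enc (m₁.foldl (f a) (i a)) →
      ∃ (s' : Store) (t : ℕ), Runs (.loop (.var (k + 1)) body) s s' t ∧
        t ≤ m₂.length * (p.eval (treeSize a + (B a + treeSize (l a) + 1) + 1) + 30) + 2 ∧
        s' (k + 2) = enc ((l a).foldl (f a) (i a)) ∧ ∀ j < k, s' j = s j := by
    intro a m₂
    induction m₂ with
    | nil =>
      intro m₁ hm s _ h1 h2
      rw [List.append_nil] at hm
      exact ⟨s, _, .loopFalse (by rw [Expr.eval, h1]; rfl), by simp [Expr.cost], by rw [h2, hm],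
        fun _ _ => rfl⟩
    | cons x m₂ ih =>
      intro m₁ hm s h0 h1 h2
      have hpre : m₁ <+: l a := ⟨_, hm⟩
      obtain ⟨s₁, t₁, hr₁, ht₁, hk₁, hj₁⟩ := hR (Function.update s (k + 3)
        ((Expr.cons (.var k) (.cons (.var (k + 2)) (.hd (.var (k + 1))))).eval s))
        (a, m₁.foldl (f a) (i a), x) (by
          simp only [Function.update_self, Expr.eval, h0, h1, h2]; rfl)
      obtain ⟨s', t, hr, ht, hk, hj⟩ := ih (m₁ ++ [x]) (by simpa using hm)
        (Function.update (Function.update s₁ (k + 2) ((Expr.var (k + 3)).eval s₁)) (k + 1)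
          ((Expr.tl (.var (k + 1))).eval
            (Function.update s₁ (k + 2) ((Expr.var (k + 3)).eval s₁))))
        (by
          rw [Function.update_of_ne (by omega), Function.update_of_ne (by omega),
            hj₁ _ (by omega), Function.update_of_ne (by omega), h0])
        (by
          simp only [Function.update_self, Expr.eval]
          rw [Function.update_of_ne (by omega), hj₁ _ (by omega),
            Function.update_of_ne (by omega), h1]
          rfl)
        (by
          rw [Function.update_of_ne (by omega), Function.update_self, Expr.eval, hk₁,
            List.foldl_append]
          rfl)
      refine ⟨s', _, .loopTrue ?_ (.seq (.assign ..) (.seq hr₁ (.seq (.assign ..) (.assign ..))))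
        hr, ?_, hk, ?_⟩
      · rw [Expr.eval, h1]
        exact fun h => Data.noConfusion h
      · have h3 : t₁ ≤ p.eval (treeSize a + (B a + treeSize (l a) + 1) + 1) := by
          refine ht₁.trans ((hp _).trans (p.eval_mono_nat ?_))
          have h4 := hs a m₁ hpre
          have h5 : treeSize x ≤ treeSize (l a) := treeSize_le_of_mem (by rw [← hm]; simp)
          simp only [treeSize_prod]
          omega
        simp only [Expr.cost, List.length_cons, Nat.add_mul]
        omega
      · intro j hj'
        rw [hj j hj', Function.update_of_ne (by omega), Function.update_of_ne (by omega),
          hj₁ j (by omega), Function.update_of_ne (by omega)]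
  refine ⟨.seq (.assign (k + 1) (.var k)) (.seq P (.seq (.assign (k + 2) (.var k)) (.seq Q
    (.seq (.loop (.var (k + 1)) body) (.assign k (.var (k + 2))))))), fun s a h => ?_⟩
  obtain ⟨s₁, t₁, hr₁, ht₁, hk₁, hj₁⟩ :=
    hP (Function.update s (k + 1) ((Expr.var k).eval s)) a (by simp [Expr.eval, h])
  have e₁ : s₁ k = enc a := by
    rw [hj₁ k (by omega), Function.update_of_ne (by omega), h]
  obtain ⟨s₂, t₂, hr₂, ht₂, hk₂, hj₂⟩ :=
    hQ (Function.update s₁ (k + 2) ((Expr.var k).eval s₁)) a (by simp [Expr.eval, e₁])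
  obtain ⟨s₃, t₃, hr₃, ht₃, hk₃, hj₃⟩ := loop a (l a) [] rfl s₂
    (by rw [hj₂ k (by omega), Function.update_of_ne (by omega), e₁])
    (by rw [hj₂ _ (by omega), Function.update_of_ne (by omega), hk₁]) hk₂
  refine ⟨_, _, .seq (.assign ..) (.seq hr₁ (.seq (.assign ..) (.seq hr₂ (.seq hr₃
    (.assign ..))))), ?_, ?_, ?_⟩
  · have h5 : (l a).length * (p.eval (treeSize a + (B a + treeSize (l a) + 1) + 1) + 30) ≤
        treeSize (l a) * (p.eval (treeSize a + (B a + treeSize (l a) + 1) + 1) + 30) :=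
      Nat.mul_le_mul_right _ (length_le_treeSize _)
    simp only [Expr.cost]
    omega
  · rw [Function.update_self, Expr.eval, hk₃]
  · intro j hj
    rw [Function.update_of_ne (by omega), hj₃ j hj, hj₂ j (by omega),
      Function.update_of_ne (by omega), hj₁ j (by omega), Function.update_of_ne (by omega)]

end PolyTime

/-! ### A library of polynomial-time functions on numbers and lists -/

namespace PolyTime

open While

variable {α β γ δ : Type} [TreeEncoding α] [TreeEncoding β] [TreeEncoding γ] [TreeEncoding δ]

/-- A function that only changes the type of its argument, not the tree. -/
theorem of_enc_eq {f : α → β} (h : ∀ a, enc (f a) = enc a) : PolyTime f :=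
  of_expr (polyBounded_treeSize.mono fun a => by rw [treeSize, h, treeSize]) .var 1
    (fun _ => le_rfl) fun _ _ a hs => by rw [h]; exact hs

/-- The test whether a tree is not empty. -/
theorem of_test {f : α → Bool} (h : ∀ a, f a = false ↔ enc a = .nil) : PolyTime f := by
  refine ⟨(PolyBounded.const 3).mono fun a => treeSize_bool _, fun _ => 20, .const _, fun k =>
    ⟨.ite (.var k) (.assign k (.cons .nil .nil)) (.assign k .nil), fun s a hs => ?_⟩⟩
  cases hf : f a with
  | true =>
    refine ⟨_, _, .iteTrue ?_ (.assign ..), by simp [Expr.cost], ?_, fun j hj => ?_⟩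
    · rw [Expr.eval, hs, ne_eq, ← h a, hf]
      simp
    · rw [Function.update_self]; rfl
    · rw [Function.update_of_ne hj.ne]
  | false =>
    refine ⟨_, _, .iteFalse ?_ (.assign ..), by simp [Expr.cost], ?_, fun j hj => ?_⟩
    · rw [Expr.eval, hs, ← h a, hf]
    · rw [Function.update_self]; rfl
    · rw [Function.update_of_ne hj.ne]

@[fun_prop]
theorem listCons {f : α → β} {l : α → List β} (hf : PolyTime f) (hl : PolyTime l) :
    PolyTime fun a => f a :: l a :=
  (of_enc_eq (f := fun p : β × List β => p.1 :: p.2) fun _ => rfl).comp (hf.prodMk hl)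

@[fun_prop]
theorem some {f : α → β} (hf : PolyTime f) : PolyTime fun a => some (f a) :=
  (of_expr (f := fun b : β => Option.some b)
    ((polyBounded_treeSize.add (.const 2)).mono fun a => by simp) (fun k => .cons (.var k) .nil) 3
    (fun _ => le_rfl) fun k s a hs => by simp only [Expr.eval, hs]; rfl).comp hf

@[fun_prop]
theorem optionToList {f : α → Option β} (hf : PolyTime f) : PolyTime fun a => (f a).toList :=
  (of_enc_eq (f := fun o : Option β => o.toList) fun _ => rfl).comp hf

@[fun_prop]
theorem isEmpty {f : α → List β} (hf : PolyTime f) : PolyTime fun a => (f a).isEmpty := by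
  have h : PolyTime fun l : List β => !l.isEmpty := of_test fun l => by
    cases l
    · exact ⟨fun _ => rfl, fun _ => rfl⟩
    · exact ⟨fun h => by simp at h, fun h => Data.noConfusion h⟩
  have h2 := (cond h (const false) (const true)).comp hf
  convert h2 using 2 with a
  cases f a <;> rfl

@[fun_prop]
theorem not {f : α → Bool} (hf : PolyTime f) : PolyTime fun a => !f a := by
  convert cond hf (const false) (const true) using 2 with a
  cases f a <;> rfl

@[fun_prop]
theorem and {f g : α → Bool} (hf : PolyTime f) (hg : PolyTime g) :
    PolyTime fun a => f a && g a := by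
  convert cond hf hg (const false) using 2 with a
  cases f a <;> rfl

@[fun_prop]
theorem or {f g : α → Bool} (hf : PolyTime f) (hg : PolyTime g) : PolyTime fun a => f a || g a := by
  convert cond hf (const true) hg using 2 with a
  cases f a <;> rfl

@[fun_prop]
theorem beqBool {f g : α → Bool} (hf : PolyTime f) (hg : PolyTime g) :
    PolyTime fun a => f a == g a := by
  convert cond hf hg (not hg) using 2 with a
  cases f a <;> cases g a <;> rfl

@[fun_prop]
theorem tail {l : α → List β} (hl : PolyTime l) : PolyTime fun a => (l a).tail :=
  (of_expr (f := fun l : List β => l.tail) (polyBounded_treeSize.mono fun a =>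
    treeSize_sublist (List.tail_sublist a)) (fun k => .tl (.var k)) 2 (fun _ => le_rfl)
    fun k s a hs => by simp only [Expr.eval, hs]; cases a <;> rfl).comp hl

theorem getD_eq_foldl {β : Type} (o : Option β) (d : β) :
    o.getD d = o.toList.foldl (fun _ x => x) d := by
  cases o <;> rfl

@[fun_prop]
theorem optionGetD {o : α → Option β} {d : α → β} (ho : PolyTime o) (hd : PolyTime d) :
    PolyTime fun a => (o a).getD (d a) := by
  simp only [getD_eq_foldl]
  refine foldl (ho.1.add hd.1) (fun a m hm => ?_) (by fun_prop) hd (by fun_prop)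
  cases h : o a with
  | none =>
    rw [h] at hm
    rw [List.prefix_nil.1 hm]
    simp
  | some b =>
    rw [h, Option.toList_some, List.prefix_cons_iff] at hm
    obtain rfl | ⟨t, rfl, ht⟩ := hm
    · simp
    · rw [List.prefix_nil.1 ht]
      simp; omega

@[fun_prop]
theorem reverse {l : α → List β} (hl : PolyTime l) : PolyTime fun a => (l a).reverse := by
  have h (l : List β) : l.reverse = l.foldl (fun acc x => x :: acc) [] := by simp
  simp only [h]
  refine foldl hl.1 (fun a m hm => ?_) hl (by fun_prop) (by fun_prop)
  rw [← h, treeSize_reverse]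
  exact treeSize_sublist hm.sublist

@[fun_prop]
theorem append {l m : α → List β} (hl : PolyTime l) (hm : PolyTime m) :
    PolyTime fun a => l a ++ m a := by
  have h (l m : List β) : l ++ m = l.reverse.foldl (fun acc x => x :: acc) m := by simp
  simp only [h]
  refine foldl (hl.1.add hm.1) (fun a r hr => ?_) (by fun_prop) hm (by fun_prop)
  have h1 := treeSize_append r.reverse (m a)
  have h2 := treeSize_sublist hr.sublist
  rw [treeSize_reverse] at h1 h2
  rw [List.foldl_flip_cons_eq_append']
  omega

@[fun_prop]
theorem flatMap {l : α → List β} {f : α → β → List γ} (hl : PolyTime l)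
    (hf : PolyTime fun p : α × β => f p.1 p.2) : PolyTime fun a => (l a).flatMap (f a) := by
  have h (a : α) (l : List β) (m : List γ) :
      l.foldl (fun acc x => acc ++ f a x) m = m ++ l.flatMap (f a) := by
    induction l generalizing m with
    | nil => simp
    | cons x l ih => simp [ih]
  have h' (a : α) (l : List β) : l.flatMap (f a) = l.foldl (fun acc x => acc ++ f a x) [] := by
    rw [h, List.nil_append]
  simp only [h']
  obtain ⟨p, hp⟩ := hf.1
  refine foldl ((hl.1.mul ((((polyBounded_treeSize.add hl.1).add (.const 1)).comp p).add
    (.const 1))).add (.const 1)) (fun a m hm => ?_) hl (by fun_prop) (by fun_prop)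
  rw [h, List.nil_append]
  have h1 : ∀ b ∈ m, treeSize (f a b) ≤ p.eval (treeSize a + treeSize (l a) + 1) := fun b hb => by
    refine (hp (a, b)).trans (p.eval_mono_nat ?_)
    have := treeSize_le_of_mem (hm.subset hb)
    simp only [treeSize_prod]
    omega
  have h2 : m.length ≤ treeSize (l a) := hm.length_le.trans (length_le_treeSize _)
  refine le_trans ?_ (Nat.add_le_add_right (Nat.mul_le_mul_right _ h2) 1)
  clear h2 hm
  induction m with
  | nil => simp
  | cons x m ih =>
    have h3 := ih fun b hb => h1 b (List.mem_cons_of_mem _ hb)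
    have h4 := h1 x List.mem_cons_self
    have h5 := treeSize_append (f a x) (m.flatMap (f a))
    simp only [List.flatMap_cons, List.length_cons, Nat.add_mul] at *
    omega

@[fun_prop]
theorem map {l : α → List β} {f : α → β → γ} (hl : PolyTime l)
    (hf : PolyTime fun p : α × β => f p.1 p.2) : PolyTime fun a => (l a).map (f a) := by
  have h (a : α) : (l a).map (f a) = (l a).flatMap fun x => [f a x] := by
    rw [List.map_eq_flatMap]
  simp only [h]
  fun_prop

@[fun_prop]
theorem filter {l : α → List β} {f : α → β → Bool} (hl : PolyTime l)
    (hf : PolyTime fun p : α × β => f p.1 p.2) : PolyTime fun a => (l a).filter (f a) := by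
  have h (a : α) : (l a).filter (f a) = (l a).flatMap fun x => bif f a x then [x] else [] := by
    induction l a with
    | nil => rfl
    | cons x l ih => cases h : f a x <;> simp_all
  simp only [h]
  fun_prop

@[fun_prop]
theorem any {l : α → List β} {f : α → β → Bool} (hl : PolyTime l)
    (hf : PolyTime fun p : α × β => f p.1 p.2) : PolyTime fun a => (l a).any (f a) := by
  have h (a : α) : (l a).any (f a) = !((l a).filter (f a)).isEmpty := by
    induction l a with
    | nil => rfl
    | cons x l ih => cases h : f a x <;> simp_all
  simp only [h]
  fun_prop

@[fun_prop]
theorem all {l : α → List β} {f : α → β → Bool} (hl : PolyTime l)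
    (hf : PolyTime fun p : α × β => f p.1 p.2) : PolyTime fun a => (l a).all (f a) := by
  have h (a : α) : (l a).all (f a) = !((l a).any fun x => !f a x) := by
    induction l a with
    | nil => rfl
    | cons x l ih => cases h : f a x <;> simp_all
  simp only [h]
  fun_prop

@[fun_prop]
theorem head? {l : α → List β} (hl : PolyTime l) : PolyTime fun a => (l a).head? := by
  have h (l : List β) : l.head? =
      l.reverse.foldl (fun _ x => Option.some x) none := by
    cases l with
    | nil => rfl
    | cons x l => simp [List.foldl_append]
  simp only [h]
  refine foldl (hl.1.add (.const 2)) (fun a m hm => ?_) (by fun_prop) (by fun_prop) (by fun_prop)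
  rcases List.eq_nil_or_concat m with rfl | ⟨m, x, rfl⟩
  · simp
  · have := treeSize_le_of_mem (l := l a) (List.mem_reverse.1 (hm.subset (a := x) (by simp)))
    simp only [List.concat_eq_append, List.foldl_append, List.foldl_cons, List.foldl_nil,
      treeSize_some]
    omega

@[fun_prop]
theorem find? {l : α → List β} {f : α → β → Bool} (hl : PolyTime l)
    (hf : PolyTime fun p : α × β => f p.1 p.2) : PolyTime fun a => (l a).find? (f a) := by
  simp only [← List.head?_filter]
  fun_prop

@[fun_prop]
theorem findSome? {l : α → List β} {f : α → β → Option γ} (hl : PolyTime l)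
    (hf : PolyTime fun p : α × β => f p.1 p.2) : PolyTime fun a => (l a).findSome? (f a) := by
  have h (a : α) : (l a).findSome? (f a) = ((l a).flatMap fun x => (f a x).toList).head? := by
    induction l a with
    | nil => rfl
    | cons x l ih => cases h : f a x <;> simp_all
  simp only [h]
  fun_prop

@[fun_prop]
theorem succ {f : α → ℕ} (hf : PolyTime f) : PolyTime fun a => f a + 1 :=
  (of_expr (f := fun n : ℕ => n + 1) ((polyBounded_treeSize.add (.const 2)).mono fun a => by
    simp only [treeSize_nat]; omega) (fun k => .cons .nil (.var k)) 3 (fun _ => le_rfl)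
    fun k s a hs => by simp only [Expr.eval, hs]; rfl).comp hf

@[fun_prop]
theorem pred {f : α → ℕ} (hf : PolyTime f) : PolyTime fun a => f a - 1 :=
  (of_expr (f := fun n : ℕ => n - 1) (polyBounded_treeSize.mono fun a => by
    simp only [treeSize_nat]; omega) (fun k => .tl (.var k)) 2 (fun _ => le_rfl)
    fun k s a hs => by simp only [Expr.eval, hs]; cases a <;> rfl).comp hf

@[fun_prop]
theorem length {l : α → List β} (hl : PolyTime l) : PolyTime fun a => (l a).length := by
  have h (l : List β) (n : ℕ) : l.foldl (fun n _ => n + 1) n = n + l.length := by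
    induction l generalizing n with
    | nil => rfl
    | cons x l ih => rw [List.foldl_cons, ih, List.length_cons]; omega
  have h' (l : List β) : l.length = l.foldl (fun n _ => n + 1) 0 := by rw [h, Nat.zero_add]
  simp only [h']
  refine foldl (((PolyBounded.const 2).mul hl.1).add (.const 1)) (fun a m hm => ?_) hl
    (by fun_prop) (by fun_prop)
  have := hm.length_le.trans (length_le_treeSize _)
  rw [h, treeSize_nat]
  omega

@[fun_prop]
theorem replicate {n : α → ℕ} (hn : PolyTime n) : PolyTime fun a => List.replicate (n a) () :=
  (of_enc_eq (f := fun n : ℕ => List.replicate n ()) fun n => by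
    induction n with
    | zero => rfl
    | succ n ih =>
      change Data.cons _ (enc (List.replicate n ())) = Data.cons _ (enc n)
      rw [ih]; rfl).comp hn

@[fun_prop]
theorem natAdd {f g : α → ℕ} (hf : PolyTime f) (hg : PolyTime g) : PolyTime fun a => f a + g a := by
  have h (a : α) : f a + g a = (List.replicate (f a) () ++ List.replicate (g a) ()).length := by
    simp
  simp only [h]
  fun_prop

/-- Iteration of a function. -/
theorem iterate {n : α → ℕ} {i : α → β} {f : α → β → β} {B : α → ℕ} (hB : PolyBounded B)
    (hs : ∀ a, ∀ m ≤ n a, treeSize ((f a)^[m] (i a)) ≤ B a) (hn : PolyTime n) (hi : PolyTime i)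
    (hf : PolyTime fun p : α × β => f p.1 p.2) : PolyTime fun a => (f a)^[n a] (i a) := by
  have h (a : α) (m : ℕ) : ∀ b, (List.replicate m ()).foldl (fun b _ => f a b) b = (f a)^[m] b := by
    induction m with
    | zero => intro b; rfl
    | succ m ih => intro b; rw [List.replicate_succ, List.foldl_cons, ih]; rfl
  simp only [← h]
  refine foldl hB (fun a m hm => ?_) (by fun_prop) hi ?_
  · obtain ⟨h1, h2⟩ := List.prefix_replicate_iff.1 hm
    rw [h2, h]
    exact hs a _ h1
  · exact hf.comp (g := fun p : α × β × Unit => (p.1, p.2.1)) (by fun_prop)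

@[fun_prop]
theorem natSub {f g : α → ℕ} (hf : PolyTime f) (hg : PolyTime g) : PolyTime fun a => f a - g a := by
  have h (n m : ℕ) : (fun k => k - 1)^[m] n = n - m := by
    induction m with
    | zero => rfl
    | succ m ih => rw [Function.iterate_succ_apply', ih]; omega
  rw [show (fun a => f a - g a) = fun a => (fun k => k - 1)^[g a] (f a) from
    funext fun a => (h _ _).symm]
  refine iterate hf.1 (fun a m hm => ?_) hg hf (by fun_prop)
  rw [h]
  simp only [treeSize_nat]
  omega

theorem isPos {f : α → ℕ} (hf : PolyTime f) : PolyTime fun a => decide (0 < f a) :=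
  (of_test (f := fun n : ℕ => decide (0 < n)) fun n => by
    cases n
    · exact ⟨fun _ => rfl, fun _ => rfl⟩
    · exact ⟨fun h => by simp at h, fun h => Data.noConfusion h⟩).comp hf

@[fun_prop]
theorem natLt {f g : α → ℕ} (hf : PolyTime f) (hg : PolyTime g) :
    PolyTime fun a => decide (f a < g a) := by
  rw [show (fun a => decide (f a < g a)) = fun a => decide (0 < g a - f a) from
    funext fun a => decide_eq_decide.2 Nat.sub_pos_iff_lt.symm]
  exact isPos (by fun_prop)

@[fun_prop]
theorem natLe {f g : α → ℕ} (hf : PolyTime f) (hg : PolyTime g) :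
    PolyTime fun a => decide (f a ≤ g a) := by
  simp only [← Nat.lt_add_one_iff]
  fun_prop

@[fun_prop]
theorem beqNat {f g : α → ℕ} (hf : PolyTime f) (hg : PolyTime g) :
    PolyTime fun a => f a == g a := by
  have h (a : α) : (f a == g a) = (decide (f a ≤ g a) && decide (g a ≤ f a)) := by
    rw [Bool.eq_iff_iff]
    simp only [beq_iff_eq, Bool.and_eq_true, decide_eq_true_eq]
    omega
  simp only [h]
  fun_prop

@[fun_prop]
theorem range {n : α → ℕ} (hn : PolyTime n) : PolyTime fun a => List.range (n a) := by
  have h (n : ℕ) : (fun l : List ℕ => l ++ [l.length])^[n] [] = List.range n := by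
    induction n with
    | zero => rfl
    | succ n ih => rw [Function.iterate_succ_apply', ih, List.range_succ, List.length_range]
  simp only [← h]
  refine iterate ((hn.1.mul (hn.1.add (.const 1))).add (.const 1)) (fun a m hm => ?_) hn
    (by fun_prop) (by fun_prop)
  rw [h]
  refine treeSize_list_le (by simp; omega) fun x hx => ?_
  rw [List.mem_range] at hx
  simp only [treeSize_nat]
  omega

@[fun_prop]
theorem drop {n : α → ℕ} {l : α → List β} (hn : PolyTime n) (hl : PolyTime l) :
    PolyTime fun a => (l a).drop (n a) := by
  have h (n : ℕ) (l : List β) : List.tail^[n] l = l.drop n := by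
    induction n with
    | zero => rfl
    | succ n ih => rw [Function.iterate_succ_apply', ih, List.tail_drop]
  simp only [← h]
  refine iterate hl.1 (fun a m hm => ?_) hn hl (by fun_prop)
  rw [h]
  exact treeSize_sublist (List.drop_sublist _ _)

@[fun_prop]
theorem take {n : α → ℕ} {l : α → List β} (hn : PolyTime n) (hl : PolyTime l) :
    PolyTime fun a => (l a).take (n a) := by
  have h (n : ℕ) (l : List β) : l.take n = (l.reverse.drop (l.length - n)).reverse := by
    rw [List.drop_reverse, List.reverse_reverse]
    rcases le_total n l.length with h | h
    · congr 1; omega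
    · rw [List.take_of_length_le h, List.take_of_length_le (by omega)]
  simp only [h]
  fun_prop

@[fun_prop]
theorem getD {n : α → ℕ} {l : α → List β} {d : α → β} (hn : PolyTime n) (hl : PolyTime l)
    (hd : PolyTime d) : PolyTime fun a => (l a).getD (n a) (d a) := by
  have h (n : ℕ) (l : List β) (d : β) : l.getD n d = (l.drop n).head?.getD d := by
    rw [List.head?_drop, List.getD_eq_getElem?_getD]
  simp only [h]
  fun_prop

@[fun_prop]
theorem contains {n : α → ℕ} {l : α → List ℕ} (hl : PolyTime l) (hn : PolyTime n) :
    PolyTime fun a => (l a).contains (n a) := by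
  have h (a : α) : (l a).contains (n a) = (l a).any fun x => n a == x := List.contains_eq_any_beq
  simp only [h]
  fun_prop

end PolyTime

/-! ### Unbounded search -/

open While in
/-- If a polynomial-time function `f` of `a` and a number `u` eventually returns a value, then a
program finds the least such `u` and outputs the value; its running time is polynomial in the size
of `a` and in any number `N` for which a value is returned. -/
theorem PolyTime.exists_search {α β : Type} [TreeEncoding α] [TreeEncoding β]
    {f : α × ℕ → Option β} (hf : PolyTime f) :
    ∃ (P : Prog) (q : ℕ[X]), ∀ (a : α) (N : ℕ), (f (a, N)).isSome = true →
      ∃ (u : ℕ) (b : β) (t : ℕ), f (a, u) = Option.some b ∧ P.Outputs (enc a) (enc b) t ∧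
        t ≤ q.eval (treeSize a + N) := by
  obtain ⟨-, T, ⟨p, hp⟩, hf⟩ := hf
  obtain ⟨Q, hQ⟩ := hf 3
  -- variable `0` keeps `a`, variable `1` the number `u`, and variable `2` says whether to continue
  set body : Prog := .seq (.assign 3 (.cons (.var 0) (.var 1))) (.seq Q
    (.ite (.var 3) (.assign 2 .nil) (.assign 1 (.cons .nil (.var 1))))) with hbody
  set r : ℕ → α → ℕ := fun N a => p.eval (treeSize a + (2 * N + 1) + 1) + 30 with hr
  have loop (a : α) (N : ℕ) (hN : (f (a, N)).isSome = true) : ∀ m u : ℕ, u + m = N →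
      ∀ s : Store, s 0 = enc a → s 1 = enc u → s 2 ≠ .nil →
      ∃ (u' : ℕ) (b : β) (s' : Store) (t : ℕ), Runs (.loop (.var 2) body) s s' t ∧
        f (a, u') = Option.some b ∧ s' 3 = enc (Option.some b) ∧ t ≤ (m + 1) * r N a + 30 := by
    intro m
    induction m with
    | zero =>
      intro u hu s h0 h1 h2
      obtain rfl : u = N := by omega
      obtain ⟨b, hb⟩ := Option.isSome_iff_exists.1 hN
      obtain ⟨s₁, t₁, hr₁, ht₁, hk₁, hj₁⟩ := hQ (Function.update s 3
        ((Expr.cons (.var 0) (.var 1)).eval s)) (a, u) (by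
          simp only [Function.update_self, Expr.eval, h0, h1]; rfl)
      refine ⟨u, b, _, _, .loopTrue h2 (.seq (.assign ..) (.seq hr₁ (.iteTrue ?_ (.assign ..))))
        (.loopFalse ?_), hb, ?_, ?_⟩
      · rw [Expr.eval, hk₁, hb]
        exact fun h => Data.noConfusion h
      · simp [Expr.eval]
      · rw [Function.update_of_ne (by omega), hk₁, hb]
      · have := ht₁.trans (hp _)
        simp only [treeSize_prod, treeSize_nat] at this
        simp only [Expr.cost, hr]
        omega
    | succ m ih =>
      intro u hu s h0 h1 h2
      obtain ⟨s₁, t₁, hr₁, ht₁, hk₁, hj₁⟩ := hQ (Function.update s 3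
        ((Expr.cons (.var 0) (.var 1)).eval s)) (a, u) (by
          simp only [Function.update_self, Expr.eval, h0, h1]; rfl)
      have ht : t₁ ≤ p.eval (treeSize a + (2 * N + 1) + 1) := by
        refine (ht₁.trans (hp _)).trans (p.eval_mono_nat ?_)
        simp only [treeSize_prod, treeSize_nat]
        omega
      cases hb : f (a, u) with
      | some b =>
        refine ⟨u, b, _, _, .loopTrue h2 (.seq (.assign ..) (.seq hr₁ (.iteTrue ?_ (.assign ..))))
          (.loopFalse ?_), hb, ?_, ?_⟩
        · rw [Expr.eval, hk₁, hb]
          exact fun h => Data.noConfusion h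
        · simp [Expr.eval]
        · rw [Function.update_of_ne (by omega), hk₁, hb]
        · simp only [Expr.cost, hr, Nat.add_mul] at *
          omega
      | none =>
        have hlt : ∀ j < 3, s₁ j = s j := fun j hj => by
          rw [hj₁ j hj, Function.update_of_ne (by omega)]
        obtain ⟨u', b, s', t, hr', hb', hs', ht'⟩ := ih (u + 1) (by omega)
          (Function.update s₁ 1 ((Expr.cons .nil (.var 1)).eval s₁))
          (by rw [Function.update_of_ne (by omega), hlt 0 (by omega), h0])
          (by rw [Function.update_self, Expr.eval, Expr.eval, Expr.eval, hlt 1 (by omega), h1]; rfl)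
          (by rw [Function.update_of_ne (by omega), hlt 2 (by omega)]; exact h2)
        refine ⟨u', b, s', _, .loopTrue h2 (.seq (.assign ..) (.seq hr₁
          (.iteFalse ?_ (.assign ..)))) hr', hb', hs', ?_⟩
        · rw [Expr.eval, hk₁, hb]
          rfl
        · simp only [Expr.cost, hr, Nat.add_mul] at *
          omega
  refine ⟨.seq (.assign 1 .nil) (.seq (.assign 2 (.cons .nil .nil)) (.seq (.loop (.var 2) body)
    (.assign 0 (.hd (.var 3))))), (X + 1) * (p.comp (2 * X + 2) + 30) + 60, fun a N hN => ?_⟩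
  obtain ⟨u, b, s, t, h1, h2, h3, h4⟩ := loop a N hN N 0 (by omega)
    (Function.update (Function.update (input (enc a)) 1 .nil) 2 (.cons .nil .nil))
    (by simp [input]) (by simp; rfl) (by simp)
  refine ⟨u, b, _, h2, ⟨_, .seq (.assign ..) (.seq (.assign ..) (.seq h1 (.assign ..))), ?_⟩, ?_⟩
  · rw [Function.update_self, Expr.eval, Expr.eval, h3]
    rfl
  · have h5 : (N + 1) * r N a ≤
        (treeSize a + N + 1) * (p.eval (2 * (treeSize a + N) + 2) + 30) := by
      refine Nat.mul_le_mul (by omega) (Nat.add_le_add_right (p.eval_mono_nat ?_) _)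
      have := treeSize_pos a
      omega
    simp only [Expr.cost, eval_add, eval_mul, eval_comp, eval_X, eval_one, eval_ofNat]
    omega

/-! ### Contraction sequences as relabellings -/

section relabel

variable {V : Type*} [DecidableEq V]

/-- The effect of contracting the pair `e` on the name of a part. -/
def relabel (e : V × V) (x : V) : V := if x = e.2 then e.1 else x

/-- The name of the part of `x` after the contractions `L`. -/
def label (L : List (V × V)) (x : V) : V := L.foldl (fun y e => relabel e y) x

/-- The first element of `C` in the same part as `c`. -/
def rep (C : List V) (φ : V → V) (c : V) : V := (C.find? fun d => φ d == φ c).getD c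

/-- The contraction induced on `C` by the contraction `e` of two parts, where a part of `C` is named
after its first element: there is none if one of the two parts avoids `C`. -/
def restrictStep (C : List V) (φ : V → V) (e : V × V) : List (V × V) :=
  (C.find? fun c => φ c == e.1 || φ c == e.2).toList.flatMap fun m =>
    (C.find? fun c => (φ c == e.1 || φ c == e.2) && !(φ c == φ m)).toList.map fun o => (m, o)

/-- The contractions that the sequence `L` induces on `C`. -/
def restrictSeq (C : List V) (L : List (V × V)) : List (V × V) :=
  (List.range L.length).flatMap fun i =>
    (L[i]?).toList.flatMap fun e => restrictStep C (label (L.take i)) e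

/-- The element of `D` at the position of `c` in `C`. -/
def transport (C D : List V) (c : V) : V :=
  D.getD (((List.range C.length).find? fun i => C.getD i c == c).getD 0) c

/-- Contractions that make the parts of `D` absorbed by those of its copy `C`, where the parts of
`C` are those after the contractions `L`. The contractions of `L` inside `C` are repeated in `D`;
then each part of `D` is contracted with the part of its counterpart. -/
def absorb (C D : List V) (L : List (V × V)) : List (V × V) :=
  ((restrictSeq C L).map fun e => (transport C D e.1, transport C D e.2)) ++
    (C.filter fun c => rep C (label L) c == c).map fun c => (label L c, transport C D c)

end relabel

/-! ### The algorithm -/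

namespace Algorithm

/-- The entry of an adjacency matrix. -/
def adj (g : List (List Bool)) (i j : ℕ) : Bool := (g.getD i []).getD j false

/-- The list of all vertices. -/
def verts (g : List (List Bool)) : List ℕ := List.range g.length

/-- The vertices of degree at least `d`. -/
def big (g : List (List Bool)) (d : ℕ) : List ℕ :=
  (verts g).filter fun i => decide (d ≤ ((verts g).filter fun j => adj g i j).length)

/-- Adds to `R` the neighbours of `R` outside `S`. -/
def grow (g : List (List Bool)) (S R : List ℕ) : List ℕ :=
  (verts g).filter fun x => R.contains x || (!S.contains x && R.any fun y => adj g y x)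

/-- The vertex list of the component of `v` after deletion of `S`. -/
def component (g : List (List Bool)) (S : List ℕ) (v : ℕ) : List ℕ := (grow g S)^[g.length] [v]

/-- Whether two components are joined in the same way inside and to `S`, with respect to the
order of their vertex lists. -/
def similar (g : List (List Bool)) (S C D : List ℕ) : Bool :=
  C.length == D.length && (List.range C.length).all fun i =>
    ((List.range C.length).all fun j =>
      adj g (C.getD i 0) (C.getD j 0) == adj g (D.getD i 0) (D.getD j 0)) &&
    S.all fun s => adj g (C.getD i 0) s == adj g (D.getD i 0) s

/-- Whether `r` is the least vertex of its component. -/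
def isRoot (g : List (List Bool)) (S : List ℕ) (r : ℕ) : Bool :=
  !S.contains r && (component g S r).all fun x => decide (r ≤ x)

/-- The number of components similar to `C` that come before `C`. -/
def rank (g : List (List Bool)) (S C : List ℕ) : ℕ :=
  ((verts g).filter fun r => isRoot g S r && similar g S C (component g S r) &&
    C.all fun x => decide (r < x)).length

/-- The vertices that remain if of any components that are similar only the first `b` are kept. -/
def kernel (g : List (List Bool)) (S : List ℕ) (b : ℕ) : List ℕ :=
  (verts g).filter fun v => S.contains v || decide (rank g S (component g S v) < b)

/-- The least vertices of the deleted components that are similar to that of `h`. -/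
def extras (g : List (List Bool)) (S W : List ℕ) (h : ℕ) : List ℕ :=
  (verts g).filter fun r => !W.contains r && isRoot g S r &&
    similar g S (component g S h) (component g S r)

/-- The contractions in a list of tokens: a pair `(h, h)` is not a contraction but
the request to absorb the extra components similar to that of `h`. -/
def plain (E : List (ℕ × ℕ)) : List (ℕ × ℕ) := E.filter fun e => !(e.1 == e.2)

/-- The contractions for one token, after the contractions `L`. -/
def expandToken (g : List (List Bool)) (S W : List ℕ) (L : List (ℕ × ℕ)) (e : ℕ × ℕ) :
    List (ℕ × ℕ) :=
  bif e.1 == e.2 then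
    (extras g S W e.1).flatMap fun r => absorb (component g S e.1) (component g S r) L
  else [e]

/-- The contractions for a list of tokens. -/
def expand (g : List (List Bool)) (S W : List ℕ) (E : List (ℕ × ℕ)) : List (ℕ × ℕ) :=
  (List.range E.length).flatMap fun i =>
    (E[i]?).toList.flatMap fun e => expandToken g S W (plain (E.take i)) e

/-- Whether there is a red edge between the parts `x` and `y` after the contractions `L` of the
subgraph induced by `U`. -/
def red (g : List (List Bool)) (U : List ℕ) (L : List (ℕ × ℕ)) (x y : ℕ) : Bool :=
  !(x == y) && ((U.any fun a => U.any fun b => label L a == x && label L b == y && adj g a b) &&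
    U.any fun a => U.any fun b => label L a == x && label L b == y && !adj g a b)

/-- Removes duplicates, as is needed to count the parts among the names of the vertices. -/
def dedup (l : List ℕ) : List ℕ :=
  l.foldl (fun acc x => bif acc.contains x then acc else x :: acc) []

/-- Whether all red degrees after the contractions `L` are at most `w`. -/
def bounded (g : List (List Bool)) (U : List ℕ) (w : ℕ) (L : List (ℕ × ℕ)) : Bool :=
  U.all fun a => decide (((dedup (U.map fun b => label L b)).filter fun y =>
    red g U L (label L a) y).length ≤ w)

/-- Whether `L` is a contraction sequence of width at most `w` of the subgraph induced by `U`. -/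
def check (g : List (List Bool)) (U : List ℕ) (w : ℕ) (L : List (ℕ × ℕ)) : Bool :=
  ((List.range (L.length + 1)).all fun i => bounded g U w (L.take i) &&
    (L[i]?).toList.all fun e => (U.any fun a => label (L.take i) a == e.1) &&
      ((U.any fun a => label (L.take i) a == e.2) && !(e.1 == e.2))) &&
  U.any fun a => U.all fun b => label L b == label L a

/-- The empty list and the lists obtained by putting an element of `A` before one in `c`. -/
def extendLists (A : List (ℕ × ℕ)) (c : List (List (ℕ × ℕ))) : List (List (ℕ × ℕ)) :=
  [] :: c.flatMap fun s => A.map fun a => a :: s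

/-- As `extendLists`, but without result if there would be more than `u` lists. -/
def extendCapped (u : ℕ) (A : List (ℕ × ℕ)) (c : List (List (ℕ × ℕ))) : List (List (ℕ × ℕ)) :=
  bif c.isEmpty || decide (u < (extendLists A c).length) then [] else extendLists A c

/-- The lists of length at most `k` over `A`; there is no result if these are more than `u`. -/
def candidates (u : ℕ) (A : List (ℕ × ℕ)) (k : ℕ) : List (List (ℕ × ℕ)) :=
  (extendCapped u A)^[k] [[]]

/-- The least width of a contraction sequence of the subgraph induced by `W` among the given ones.
-/
def minWidth (g : List (List Bool)) (W : List ℕ) (c : List (List (ℕ × ℕ))) : Option ℕ :=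
  (List.range (g.length + 1)).find? fun w => c.any fun E => check g W w (plain E)

/-- The first of the given token lists that expands to a contraction sequence of the graph of at
most twice the least width of a contraction sequence of the subgraph induced by `W`. -/
def bestExpansion (g : List (List Bool)) (S W : List ℕ) (c : List (List (ℕ × ℕ))) :
    Option (List (ℕ × ℕ)) :=
  (minWidth g W c).toList.findSome? fun w =>
    (c.map fun E => expand g S W E).find? fun L => check g (verts g) (w + w) L

/-- All token lists over `W` that have to be considered: a contraction sequence has fewer than `|W|`
contractions, and there is at most one request to absorb for each vertex of `W`. -/
def tokenLists (u : ℕ) (W : List ℕ) : List (List (ℕ × ℕ)) :=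
  candidates u (W.flatMap fun a => W.map fun b => (a, b)) (W.length + W.length)

/-- The attempt that deletes `S` and keeps at most `b` components of each class. -/
def attempt (g : List (List Bool)) (u b : ℕ) (S : List ℕ) : Option (List (ℕ × ℕ)) :=
  bestExpansion g S (kernel g S b) (tokenLists u (kernel g S b))

/-- The first successful attempt with parameters less than `u`. -/
def solve (p : List (List Bool) × ℕ) : Option (List (ℕ × ℕ)) :=
  (List.range p.2).findSome? fun d => (List.range p.2).findSome? fun b =>
    attempt p.1 p.2 b (big p.1 d)

end Algorithm

/-! ### The algorithm runs in polynomial time -/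

namespace PolyTime

open Algorithm

variable {α β : Type} [TreeEncoding α] [TreeEncoding β]

@[fun_prop]
theorem getElem? {n : α → ℕ} {l : α → List β} (hn : PolyTime n) (hl : PolyTime l) :
    PolyTime fun a => (l a)[n a]? := by
  have h (n : ℕ) (l : List β) : l[n]? = (l.drop n).head? := List.head?_drop.symm
  simp only [h]
  fun_prop

theorem label_eq_or (L : List (ℕ × ℕ)) (x : ℕ) : label L x = x ∨ ∃ e ∈ L, label L x = e.1 := by
  induction L generalizing x with
  | nil => exact .inl rfl
  | cons e L ih =>
    change label L (relabel e x) = x ∨ ∃ e' ∈ e :: L, label L (relabel e x) = e'.1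
    rcases ih (relabel e x) with h | ⟨e', he', h⟩
    · rw [h, relabel]
      split_ifs
      · exact .inr ⟨e, by simp, rfl⟩
      · exact .inl rfl
    · exact .inr ⟨e', by simp [he'], h⟩

variable {g : α → List (List Bool)} {U S W C D R : α → List ℕ} {L E : α → List (ℕ × ℕ)}
  {n w x y b u k : α → ℕ} {e : α → ℕ × ℕ} {A : α → List (ℕ × ℕ)} {c : α → List (List (ℕ × ℕ))}

@[fun_prop]
theorem relabel (he : PolyTime e) (hx : PolyTime x) : PolyTime fun a => relabel (e a) (x a) := by
  have h (a : α) : _root_.relabel (e a) (x a) = bif x a == (e a).2 then (e a).1 else x a := by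
    rw [_root_.relabel, Bool.cond_eq_ite]
    simp only [beq_iff_eq]
  simp only [h]
  fun_prop

@[fun_prop]
theorem label (hL : PolyTime L) (hx : PolyTime x) : PolyTime fun a => label (L a) (x a) := by
  unfold _root_.label
  refine foldl (hx.1.add hL.1) (fun a m hm => ?_) hL hx (by fun_prop)
  change treeSize (_root_.label m (x a)) ≤ _
  rcases label_eq_or m (x a) with h | ⟨e, he, h⟩
  · rw [h]; exact Nat.le_add_right _ _
  · have h1 : treeSize (e.1, e.2) ≤ treeSize (L a) := treeSize_le_of_mem (hm.subset he)
    rw [treeSize_prod] at h1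
    rw [h]
    omega

@[fun_prop]
theorem rep (hC : PolyTime C) (hL : PolyTime L) (hx : PolyTime x) :
    PolyTime fun a => rep (C a) (_root_.label (L a)) (x a) := by
  unfold _root_.rep
  fun_prop

@[fun_prop]
theorem restrictStep (hC : PolyTime C) (hL : PolyTime L) (he : PolyTime e) :
    PolyTime fun a => restrictStep (C a) (_root_.label (L a)) (e a) := by
  unfold _root_.restrictStep
  fun_prop

@[fun_prop]
theorem restrictSeq (hC : PolyTime C) (hL : PolyTime L) :
    PolyTime fun a => restrictSeq (C a) (L a) := by
  unfold _root_.restrictSeq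
  fun_prop

@[fun_prop]
theorem transport (hC : PolyTime C) (hD : PolyTime D) (hx : PolyTime x) :
    PolyTime fun a => transport (C a) (D a) (x a) := by
  unfold _root_.transport
  fun_prop

@[fun_prop]
theorem absorb (hC : PolyTime C) (hD : PolyTime D) (hL : PolyTime L) :
    PolyTime fun a => absorb (C a) (D a) (L a) := by
  unfold _root_.absorb
  fun_prop

@[fun_prop]
theorem adj (hg : PolyTime g) (hx : PolyTime x) (hy : PolyTime y) :
    PolyTime fun a => adj (g a) (x a) (y a) := by
  unfold Algorithm.adj
  fun_prop

@[fun_prop]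
theorem verts (hg : PolyTime g) : PolyTime fun a => verts (g a) := by
  unfold Algorithm.verts
  fun_prop

@[fun_prop]
theorem big (hg : PolyTime g) (hn : PolyTime n) : PolyTime fun a => big (g a) (n a) := by
  unfold Algorithm.big
  fun_prop

@[fun_prop]
theorem grow (hg : PolyTime g) (hS : PolyTime S) (hR : PolyTime R) :
    PolyTime fun a => grow (g a) (S a) (R a) := by
  unfold Algorithm.grow
  fun_prop

@[fun_prop]
theorem component (hg : PolyTime g) (hS : PolyTime S) (hx : PolyTime x) :
    PolyTime fun a => component (g a) (S a) (x a) := by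
  have h1 : PolyTime fun a => (Algorithm.verts (g a), [x a]) := by fun_prop
  refine iterate h1.1 (fun a m _ => ?_) (by fun_prop) (by fun_prop) (by fun_prop)
  cases m with
  | zero =>
    simp only [Function.iterate_zero, id_eq, treeSize_prod]
    omega
  | succ m =>
    rw [Function.iterate_succ_apply', Algorithm.grow]
    have := treeSize_sublist (List.filter_sublist (l := Algorithm.verts (g a))
      (p := fun y => List.contains ((Algorithm.grow (g a) (S a))^[m] [x a]) y ||
        (!(S a).contains y && List.any ((Algorithm.grow (g a) (S a))^[m] [x a]) fun z =>
          Algorithm.adj (g a) z y)))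
    rw [treeSize_prod]
    omega

@[fun_prop]
theorem similar (hg : PolyTime g) (hS : PolyTime S) (hC : PolyTime C) (hD : PolyTime D) :
    PolyTime fun a => similar (g a) (S a) (C a) (D a) := by
  unfold Algorithm.similar
  fun_prop

@[fun_prop]
theorem isRoot (hg : PolyTime g) (hS : PolyTime S) (hx : PolyTime x) :
    PolyTime fun a => isRoot (g a) (S a) (x a) := by
  unfold Algorithm.isRoot
  fun_prop

@[fun_prop]
theorem rank (hg : PolyTime g) (hS : PolyTime S) (hC : PolyTime C) :
    PolyTime fun a => rank (g a) (S a) (C a) := by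
  unfold Algorithm.rank
  fun_prop

@[fun_prop]
theorem kernel (hg : PolyTime g) (hS : PolyTime S) (hb : PolyTime b) :
    PolyTime fun a => kernel (g a) (S a) (b a) := by
  unfold Algorithm.kernel
  fun_prop

@[fun_prop]
theorem extras (hg : PolyTime g) (hS : PolyTime S) (hW : PolyTime W) (hx : PolyTime x) :
    PolyTime fun a => extras (g a) (S a) (W a) (x a) := by
  unfold Algorithm.extras
  fun_prop

@[fun_prop]
theorem plain (hE : PolyTime E) : PolyTime fun a => plain (E a) := by
  unfold Algorithm.plain
  fun_prop

@[fun_prop]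
theorem expandToken (hg : PolyTime g) (hS : PolyTime S) (hW : PolyTime W) (hL : PolyTime L)
    (he : PolyTime e) : PolyTime fun a => expandToken (g a) (S a) (W a) (L a) (e a) := by
  unfold Algorithm.expandToken
  fun_prop

@[fun_prop]
theorem expand (hg : PolyTime g) (hS : PolyTime S) (hW : PolyTime W) (hE : PolyTime E) :
    PolyTime fun a => expand (g a) (S a) (W a) (E a) := by
  unfold Algorithm.expand
  fun_prop

@[fun_prop]
theorem red (hg : PolyTime g) (hU : PolyTime U) (hL : PolyTime L) (hx : PolyTime x)
    (hy : PolyTime y) : PolyTime fun a => red (g a) (U a) (L a) (x a) (y a) := by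
  unfold Algorithm.red
  fun_prop

@[fun_prop]
theorem dedup (hU : PolyTime U) : PolyTime fun a => dedup (U a) := by
  unfold Algorithm.dedup
  refine foldl ((hU.1.mul (hU.1.add (.const 1))).add (.const 1)) (fun a m hm => ?_) hU
    (by fun_prop) (by fun_prop)
  have h (l acc : List ℕ) : (l.foldl (fun acc x => bif acc.contains x then acc else x :: acc)
      acc).length ≤ l.length + acc.length ∧ ∀ z ∈ l.foldl (fun acc x =>
        bif acc.contains x then acc else x :: acc) acc, z ∈ l ∨ z ∈ acc := by
    induction l generalizing acc with
    | nil => simp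
    | cons x l ih =>
      obtain ⟨h1, h2⟩ := ih (bif acc.contains x then acc else x :: acc)
      rw [List.foldl_cons]
      cases hx : acc.contains x <;> simp only [hx, cond_true, cond_false] at h1 h2 ⊢ <;>
        refine ⟨by simp at h1 ⊢; omega, fun z hz => ?_⟩ <;>
        have := h2 z hz <;> simp at this ⊢ <;> tauto
  obtain ⟨h1, h2⟩ := h m []
  refine treeSize_list_le ?_ fun z hz => ?_
  · exact (h1.trans hm.length_le).trans (length_le_treeSize _)
  · exact treeSize_le_of_mem (hm.subset ((h2 z hz).resolve_right (by simp)))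

@[fun_prop]
theorem bounded (hg : PolyTime g) (hU : PolyTime U) (hw : PolyTime w) (hL : PolyTime L) :
    PolyTime fun a => bounded (g a) (U a) (w a) (L a) := by
  unfold Algorithm.bounded
  fun_prop

@[fun_prop]
theorem check (hg : PolyTime g) (hU : PolyTime U) (hw : PolyTime w) (hL : PolyTime L) :
    PolyTime fun a => check (g a) (U a) (w a) (L a) := by
  unfold Algorithm.check
  fun_prop

@[fun_prop]
theorem extendLists (hA : PolyTime A) (hc : PolyTime c) :
    PolyTime fun a => extendLists (A a) (c a) := by
  unfold Algorithm.extendLists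
  fun_prop

@[fun_prop]
theorem extendCapped (hu : PolyTime u) (hA : PolyTime A) (hc : PolyTime c) :
    PolyTime fun a => extendCapped (u a) (A a) (c a) := by
  unfold Algorithm.extendCapped
  fun_prop

@[fun_prop]
theorem candidates (hu : PolyTime u) (hA : PolyTime A) (hk : PolyTime k) :
    PolyTime fun a => candidates (u a) (A a) (k a) := by
  refine iterate (B := fun a => (treeSize (u a) + 1) *
    (treeSize (k a) * (treeSize (A a) + 1) + 1 + 1) + 1) (((hu.1.add (.const 1)).mul
    (((hk.1.mul (hA.1.add (.const 1))).add (.const 1)).add (.const 1))).add (.const 1))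
    (fun a m hm => ?_) hk (by fun_prop) (by fun_prop)
  have h : ((Algorithm.extendCapped (u a) (A a))^[m] [[]]).length ≤ u a + 1 ∧
      ∀ s ∈ (Algorithm.extendCapped (u a) (A a))^[m] [[]], s.length ≤ m ∧ ∀ e ∈ s, e ∈ A a := by
    clear hm
    induction m with
    | zero => simp
    | succ m ih =>
      rw [Function.iterate_succ_apply', Algorithm.extendCapped]
      generalize (Algorithm.extendCapped (u a) (A a))^[m] [[]] = l at ih
      cases h : (l.isEmpty || decide (u a < (Algorithm.extendLists (A a) l).length))
      · rw [cond_false]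
        simp only [Bool.or_eq_false_iff, decide_eq_false_iff_not, not_lt] at h
        refine ⟨h.2.trans (by omega), fun s hs => ?_⟩
        simp only [Algorithm.extendLists, List.mem_cons, List.mem_flatMap, List.mem_map] at hs
        obtain rfl | ⟨s, hs, e, he, rfl⟩ := hs
        · simp
        · have := ih.2 s hs
          simp only [List.length_cons, List.mem_cons, forall_eq_or_imp]
          exact ⟨by omega, he, this.2⟩
      · simp
  refine treeSize_list_le (h.1.trans ?_) fun s hs => ?_
  · rw [treeSize_nat]; omega
  · refine treeSize_list_le ((h.2 s hs).1.trans ?_) fun e he =>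
      treeSize_le_of_mem ((h.2 s hs).2 e he)
    rw [treeSize_nat]; omega

@[fun_prop]
theorem minWidth (hg : PolyTime g) (hW : PolyTime W) (hc : PolyTime c) :
    PolyTime fun a => minWidth (g a) (W a) (c a) := by
  unfold Algorithm.minWidth
  fun_prop

@[fun_prop]
theorem bestExpansion (hg : PolyTime g) (hS : PolyTime S) (hW : PolyTime W) (hc : PolyTime c) :
    PolyTime fun a => bestExpansion (g a) (S a) (W a) (c a) := by
  unfold Algorithm.bestExpansion
  fun_prop

@[fun_prop]
theorem tokenLists (hu : PolyTime u) (hW : PolyTime W) :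
    PolyTime fun a => tokenLists (u a) (W a) := by
  unfold Algorithm.tokenLists
  fun_prop

@[fun_prop]
theorem attempt (hg : PolyTime g) (hu : PolyTime u) (hb : PolyTime b) (hS : PolyTime S) :
    PolyTime fun a => attempt (g a) (u a) (b a) (S a) := by
  unfold Algorithm.attempt
  fun_prop

theorem solve : PolyTime Algorithm.solve := by
  unfold Algorithm.solve
  fun_prop

end PolyTime

/-! ### Partitions and red edges -/

section partitions

variable {V : Type*}

/-- Whether some elements of the parts `x` and `y` of the partition `φ` of `U` are related. -/
def HasPair (R : V → V → Prop) (U : Finset V) (φ : V → V) (x y : V) : Prop :=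
  ∃ a ∈ U, ∃ b ∈ U, φ a = x ∧ φ b = y ∧ R a b

/-- The red edges of the trigraph that arises from the subgraph induced by `U` by contracting each
part of the partition `φ`: they join the parts between which there are both edges and nonedges. -/
def RedAdj (G : SimpleGraph V) (U : Finset V) (φ : V → V) (x y : V) : Prop :=
  x ≠ y ∧ HasPair G.Adj U φ x y ∧ HasPair Gᶜ.Adj U φ x y

/-- All red degrees of the partition `φ` of `U` are at most `w`. -/
def RedBound (G : SimpleGraph V) (U : Finset V) (w : ℕ) (φ : V → V) : Prop :=
  ∀ x, {y | RedAdj G U φ x y}.ncard ≤ w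

theorem HasPair.congr {R : V → V → Prop} {U : Finset V} {φ ψ : V → V} (h : ∀ a ∈ U, φ a = ψ a)
    {x y : V} : HasPair R U φ x y ↔ HasPair R U ψ x y := by
  constructor
  · rintro ⟨a, ha, b, hb, rfl, rfl, hR⟩
    exact ⟨a, ha, b, hb, (h a ha).symm, (h b hb).symm, hR⟩
  · rintro ⟨a, ha, b, hb, rfl, rfl, hR⟩
    exact ⟨a, ha, b, hb, h a ha, h b hb, hR⟩

theorem HasPair.mono {R : V → V → Prop} {U U' : Finset V} (hU : U ⊆ U') {φ : V → V} {x y : V}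
    (h : HasPair R U φ x y) : HasPair R U' φ x y := by
  obtain ⟨a, ha, b, hb, h⟩ := h
  exact ⟨a, hU ha, b, hU hb, h⟩

theorem HasPair.symm {R : V → V → Prop} (hR : ∀ a b, R a b → R b a) {U : Finset V} {φ : V → V}
    {x y : V} (h : HasPair R U φ x y) : HasPair R U φ y x := by
  obtain ⟨a, ha, b, hb, h1, h2, h3⟩ := h
  exact ⟨b, hb, a, ha, h2, h1, hR _ _ h3⟩

theorem hasPair_comp {R : V → V → Prop} {U : Finset V} {φ f : V → V} {x y : V} :
    HasPair R U (fun a => f (φ a)) x y ↔ ∃ x' y', f x' = x ∧ f y' = y ∧ HasPair R U φ x' y' := by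
  constructor
  · rintro ⟨a, ha, b, hb, rfl, rfl, hR⟩
    exact ⟨φ a, φ b, rfl, rfl, a, ha, b, hb, rfl, rfl, hR⟩
  · rintro ⟨x', y', rfl, rfl, a, ha, b, hb, rfl, rfl, hR⟩
    exact ⟨a, ha, b, hb, rfl, rfl, hR⟩

theorem RedAdj.symm {G : SimpleGraph V} {U : Finset V} {φ : V → V} {x y : V}
    (h : RedAdj G U φ x y) : RedAdj G U φ y x :=
  ⟨h.1.symm, h.2.1.symm fun _ _ => G.symm.symm _ _, h.2.2.symm fun _ _ => Gᶜ.symm.symm _ _⟩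

theorem redAdj_congr {G : SimpleGraph V} {U : Finset V} {φ ψ : V → V} (h : ∀ a ∈ U, φ a = ψ a)
    {x y : V} : RedAdj G U φ x y ↔ RedAdj G U ψ x y := by
  rw [RedAdj, RedAdj, HasPair.congr h, HasPair.congr h]

theorem RedBound.congr {G : SimpleGraph V} {U : Finset V} {φ ψ : V → V} {w : ℕ}
    (h : ∀ a ∈ U, φ a = ψ a) (hb : RedBound G U w φ) : RedBound G U w ψ := by
  intro x
  simp only [← redAdj_congr h]
  exact hb x

theorem RedBound.mono {G : SimpleGraph V} {U : Finset V} {φ : V → V} {w w' : ℕ} (h : w ≤ w')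
    (hb : RedBound G U w φ) : RedBound G U w' φ := fun x => (hb x).trans h

variable [DecidableEq V]

theorem RedAdj.mem_right {G : SimpleGraph V} {U : Finset V} {φ : V → V} {x y : V}
    (h : RedAdj G U φ x y) : y ∈ U.image φ := by
  obtain ⟨-, ⟨a, ha, b, hb, h1, h2, -⟩, -⟩ := h
  exact Finset.mem_image.2 ⟨b, hb, h2⟩

theorem finite_redAdj {G : SimpleGraph V} {U : Finset V} {φ : V → V} {x : V} :
    {y | RedAdj G U φ x y}.Finite :=
  (U.image φ).finite_toSet.subset fun _ h => h.mem_right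

theorem redBound_card {G : SimpleGraph V} {U : Finset V} {φ : V → V} {w : ℕ}
    (h : (U.image φ).card ≤ w) : RedBound G U w φ := fun x => by
  rw [← Set.ncard_coe_finset] at h
  exact (Set.ncard_le_ncard (fun _ h => h.mem_right) (U.image φ).finite_toSet).trans h

/-- Starting with the partition `φ` of `U`, each pair in the list consists of different parts at its
time, and all partitions satisfy `B`. -/
def Steps (U : Finset V) (B : (V → V) → Prop) : (V → V) → List (V × V) → Prop
  | φ, [] => B φ
  | φ, e :: L => B φ ∧ e.1 ∈ U.image φ ∧ e.2 ∈ U.image φ ∧ e.1 ≠ e.2 ∧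
      Steps U B (fun x => relabel e (φ x)) L

@[simp] theorem label_nil (x : V) : label [] x = x := rfl

theorem label_cons (e : V × V) (L : List (V × V)) (x : V) :
    label (e :: L) x = label L (relabel e x) := rfl

theorem label_append (L M : List (V × V)) (x : V) : label (L ++ M) x = label M (label L x) := by
  simp [label, List.foldl_append]

theorem label_singleton (e : V × V) (x : V) : label [e] x = relabel e x := rfl

theorem Steps.start {U : Finset V} {B : (V → V) → Prop} {φ : V → V} {L : List (V × V)}
    (h : Steps U B φ L) : B φ := by
  cases L with
  | nil => exact h
  | cons e L => exact h.1

theorem steps_append {U : Finset V} {B : (V → V) → Prop} {φ : V → V} {L M : List (V × V)} :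
    Steps U B φ (L ++ M) ↔ Steps U B φ L ∧ Steps U B (fun x => label L (φ x)) M := by
  induction L generalizing φ with
  | nil => exact ⟨fun h => ⟨h.start, h⟩, fun h => h.2⟩
  | cons e L ih => simp only [List.cons_append, Steps, ih, label_cons, and_assoc]

theorem Steps.last {U : Finset V} {B : (V → V) → Prop} {φ : V → V} {L : List (V × V)}
    (h : Steps U B φ L) : B fun x => label L (φ x) :=
  (steps_append.1 (by rwa [List.append_nil] : Steps U B φ (L ++ []))).2

theorem Steps.mono {U : Finset V} {B B' : (V → V) → Prop} (hB : ∀ φ, B φ → B' φ) {φ : V → V}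
    {L : List (V × V)} (hs : Steps U B φ L) : Steps U B' φ L := by
  induction L generalizing φ with
  | nil => exact hB _ hs
  | cons e L ih => exact ⟨hB _ hs.1, hs.2.1, hs.2.2.1, hs.2.2.2.1, ih hs.2.2.2.2⟩

theorem image_relabel {A : Finset V} {e : V × V} (h1 : e.1 ∈ A) (hne : e.1 ≠ e.2) :
    A.image (relabel e) = A.erase e.2 := by
  ext x
  simp only [Finset.mem_image, Finset.mem_erase, relabel]
  constructor
  · rintro ⟨y, hy, rfl⟩
    split_ifs with h
    · exact ⟨hne, h1⟩
    · exact ⟨h, hy⟩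
  · rintro ⟨hx, hxA⟩
    exact ⟨x, hxA, if_neg hx⟩

theorem image_relabel_comp {U : Finset V} {φ : V → V} {e : V × V} (h1 : e.1 ∈ U.image φ)
    (hne : e.1 ≠ e.2) : (U.image fun x => relabel e (φ x)) = (U.image φ).erase e.2 := by
  rw [← image_relabel h1 hne, Finset.image_image]
  rfl

/-- Each contraction removes one part. -/
theorem Steps.card_image {U : Finset V} {B : (V → V) → Prop} {φ : V → V} {L : List (V × V)}
    (hs : Steps U B φ L) : (U.image fun x => label L (φ x)).card + L.length = (U.image φ).card := by
  induction L generalizing φ with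
  | nil => simp
  | cons e L ih =>
    obtain ⟨-, h1, h2, h3, h4⟩ := hs
    have h5 := ih h4
    rw [image_relabel_comp h1 h3, Finset.card_erase_of_mem h2] at h5
    have := Finset.card_pos.2 ⟨_, h1⟩
    simp only [label_cons, List.length_cons]
    omega

/-- A contraction sequence of the subgraph induced by `U`, of width at most `w`. -/
def IsSeq (G : SimpleGraph V) (U : Finset V) (w : ℕ) (L : List (V × V)) : Prop :=
  Steps U (RedBound G U w) id L ∧ (U.image (label L)).card = 1

/-- If there are at most `w` parts, then they can be contracted to a single one in any order. -/
theorem exists_steps_card {G : SimpleGraph V} {U : Finset V} (hU : U.Nonempty) {w : ℕ}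
    {φ : V → V} (hw : (U.image φ).card ≤ w) :
    ∃ L, Steps U (RedBound G U w) φ L ∧ (U.image fun x => label L (φ x)).card = 1 := by
  induction hm : (U.image φ).card using Nat.strong_induction_on generalizing φ with
  | _ m ih =>
    by_cases h1 : (U.image φ).card = 1
    · exact ⟨[], redBound_card hw, h1⟩
    · have h0 := Finset.card_pos.2 (hU.image φ)
      obtain ⟨x, hx, y, hy, hxy⟩ := Finset.one_lt_card.1 (by omega : 1 < (U.image φ).card)
      have h2 := image_relabel_comp (e := (x, y)) hx hxy
      have h3 : (U.image fun a => relabel (x, y) (φ a)).card + 1 = (U.image φ).card := by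
        rw [h2]; exact Finset.card_erase_add_one hy
      obtain ⟨L, hL, hL'⟩ := ih _ (by omega) (φ := fun a => relabel (x, y) (φ a))
        (by omega) rfl
      exact ⟨(x, y) :: L, ⟨redBound_card hw, hx, hy, hxy, hL⟩, hL'⟩

end partitions

/-! ### Trigraphs and partitions -/

section bridge

/-- Relatedness after the contraction of the parts `e.1` and `e.2` to `e.1`. -/
theorem hasPair_relabel {V : Type*} [DecidableEq V] {R : V → V → Prop} {U : Finset V} {φ : V → V}
    {e : V × V} {x y : V} (hx : x ≠ e.2) (hy : y ≠ e.2) (hxy : x ≠ y) :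
    HasPair R U (fun a => relabel e (φ a)) x y ↔ HasPair R U φ x y ∨
      (x = e.1 ∧ HasPair R U φ e.2 y) ∨ (y = e.1 ∧ HasPair R U φ x e.2) := by
  rw [hasPair_comp]
  have key (x' z : V) (hz : z ≠ e.2) : relabel e x' = z ↔ x' = z ∨ (z = e.1 ∧ x' = e.2) := by
    rw [relabel]
    split_ifs with h
    · subst h
      constructor
      · rintro rfl
        exact .inr ⟨rfl, rfl⟩
      · rintro (h | h)
        · exact absurd h.symm hz
        · exact h.1.symm
    · tauto
  simp only [key _ x hx, key _ y hy]
  constructor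
  · rintro ⟨x', y', rfl | ⟨rfl, rfl⟩, rfl | ⟨h, rfl⟩, h1⟩
    · exact .inl h1
    · exact .inr (.inr ⟨h, h1⟩)
    · exact .inr (.inl ⟨rfl, h1⟩)
    · exact absurd h.symm hxy
  · rintro (h | ⟨rfl, h⟩ | ⟨rfl, h⟩)
    · exact ⟨x, y, .inl rfl, .inl rfl, h⟩
    · exact ⟨_, y, .inr ⟨rfl, rfl⟩, .inl rfl, h⟩
    · exact ⟨x, _, .inl rfl, .inr ⟨rfl, rfl⟩, h⟩

theorem hasPair_or {V : Type*} [DecidableEq V] {G : SimpleGraph V} {U : Finset V} {φ : V → V}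
    {x y : V} (hx : x ∈ U.image φ) (hy : y ∈ U.image φ) (hxy : x ≠ y) :
    HasPair G.Adj U φ x y ∨ HasPair Gᶜ.Adj U φ x y := by
  obtain ⟨a, ha, rfl⟩ := Finset.mem_image.1 hx
  obtain ⟨b, hb, rfl⟩ := Finset.mem_image.1 hy
  by_cases h : G.Adj a b
  · exact .inl ⟨a, ha, b, hb, rfl, rfl, h⟩
  · refine .inr ⟨a, ha, b, hb, rfl, rfl, ?_, h⟩
    rintro rfl
    exact hxy rfl

variable {n : ℕ}

/-- The graph on the natural numbers that has the edges of `H`. -/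
abbrev natGraph (H : SimpleGraph (Fin n)) : SimpleGraph ℕ := H.map Fin.val

/-- The trigraph `T` arises from `H` by contracting the parts of the partition `φ`. -/
structure Represents (H : SimpleGraph (Fin n)) (φ : ℕ → ℕ) (T : Trigraph (Fin n)) : Prop where
  verts (x : Fin n) : x ∈ T.verts ↔ x.val ∈ (Finset.range n).image φ
  black (x y : Fin n) : T.black.Adj x y ↔ x ≠ y ∧ HasPair (natGraph H).Adj (Finset.range n) φ x y ∧
    ¬ HasPair (natGraph H)ᶜ.Adj (Finset.range n) φ x y
  red (x y : Fin n) : T.red.Adj x y ↔ RedAdj (natGraph H) (Finset.range n) φ x y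
  range (i : ℕ) : i < n → φ i < n

theorem natGraph_adj {H : SimpleGraph (Fin n)} {x y : Fin n} :
    (natGraph H).Adj x y ↔ H.Adj x y := by
  rw [SimpleGraph.map_adj']
  constructor
  · rintro ⟨-, u, v, h1, h2, h3⟩
    rwa [← Fin.ext h2, ← Fin.ext h3]
  · exact fun h => ⟨fun h1 => h.ne (Fin.ext h1), x, y, h, rfl, rfl⟩

theorem represents_ofGraph (H : SimpleGraph (Fin n)) : Represents H id (Trigraph.ofGraph H) where
  verts x := by simp [Trigraph.ofGraph]
  black x y := by
    have h1 (R : ℕ → ℕ → Prop) : HasPair R (Finset.range n) id x y ↔ R x y := by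
      constructor
      · rintro ⟨a, -, b, -, rfl, rfl, h⟩
        exact h
      · exact fun h => ⟨x, by simp, y, by simp, rfl, rfl, h⟩
    rw [h1, h1, SimpleGraph.compl_adj, natGraph_adj]
    change H.Adj x y ↔ _
    constructor
    · exact fun h => ⟨h.ne, h, fun h' => h'.2 h⟩
    · exact fun h => h.2.1
  red x y := by
    change False ↔ _
    simp only [false_iff]
    rintro ⟨-, ⟨a, -, b, -, h1, h2, h3⟩, ⟨a', -, b', -, h4, h5, h6⟩⟩
    simp only [id] at *
    subst h4 h5 h1 h2
    exact h6.2 h3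
  range i h := h

theorem red_or_xor_iff {p q p' q' : Prop} (h : p ∨ q) (h' : p' ∨ q') :
    (p ∧ q ∨ p' ∧ q' ∨ Xor (p ∧ ¬ q) (p' ∧ ¬ q')) ↔ (p ∨ p') ∧ (q ∨ q') := by
  unfold Xor
  tauto

/-- The trigraph contraction of `u` and `v` is the contraction of the parts named `u` and `v`: a
pair of parts is joined by a red edge precisely if some but not all of their vertices are
adjacent. -/
theorem Represents.contract {H : SimpleGraph (Fin n)} {φ : ℕ → ℕ} {T : Trigraph (Fin n)}
    (h : Represents H φ T) {u v : Fin n} (hu : u ∈ T.verts) (hv : v ∈ T.verts) (huv : u ≠ v) :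
    Represents H (fun i => relabel (u.val, v.val) (φ i)) (T.contract u v) := by
  have huv' : u.val ≠ v.val := fun h => huv (Fin.ext h)
  have hv' := (h.verts v).1 hv
  have hu' := (h.verts u).1 hu
  have hverts (x : Fin n) : x ∈ T.verts.erase v ↔
      x.val ∈ (Finset.range n).image fun i => relabel (u.val, v.val) (φ i) := by
    rw [image_relabel_comp ((h.verts u).1 hu) huv', Finset.mem_erase, Finset.mem_erase, h.verts x,
      ne_eq, ne_eq, Fin.ext_iff]
  have hmem {R : ℕ → ℕ → Prop} {x y : ℕ} {ψ : ℕ → ℕ} (hp : HasPair R (Finset.range n) ψ x y) :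
      x ∈ (Finset.range n).image ψ ∧ y ∈ (Finset.range n).image ψ := by
    obtain ⟨a, ha, b, hb, h1, h2, -⟩ := hp
    exact ⟨Finset.mem_image.2 ⟨a, ha, h1⟩, Finset.mem_image.2 ⟨b, hb, h2⟩⟩
  have hne {x : Fin n} (hx : x ∈ T.verts.erase v) : x.val ≠ v.val :=
    fun h' => (Finset.mem_erase.1 hx).1 (Fin.ext h')
  have hor {x y : Fin n} (hx : x ∈ T.verts) (hy : y ∈ T.verts) (hxy : x ≠ y) :=
    hasPair_or (G := natGraph H) ((h.verts x).1 hx) ((h.verts y).1 hy)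
      (fun h' => hxy (Fin.ext h'))
  have hE {x y : ℕ} : HasPair (natGraph H).Adj (Finset.range n) φ x y ↔
      HasPair (natGraph H).Adj (Finset.range n) φ y x :=
    ⟨.symm fun _ _ => (natGraph H).symm.symm _ _, .symm fun _ _ => (natGraph H).symm.symm _ _⟩
  have hN {x y : ℕ} : HasPair (natGraph H)ᶜ.Adj (Finset.range n) φ x y ↔
      HasPair (natGraph H)ᶜ.Adj (Finset.range n) φ y x :=
    ⟨.symm fun _ _ => (natGraph H)ᶜ.symm.symm _ _, .symm fun _ _ => (natGraph H)ᶜ.symm.symm _ _⟩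
  refine ⟨hverts, fun x y => ?_, fun x y => ?_, fun i hi => ?_⟩
  · change (x ≠ v ∧ y ≠ v ∧ T.black.Adj x y ∧ (x = u → T.black.Adj v y) ∧
      (y = u → T.black.Adj v x)) ↔ _
    constructor
    · rintro ⟨hx, hy, h1, h2, h3⟩
      have hx' : x.val ≠ v.val := fun h => hx (Fin.ext h)
      have hy' : y.val ≠ v.val := fun h => hy (Fin.ext h)
      rw [hasPair_relabel hx' hy' fun h => h1.ne (Fin.ext h),
        hasPair_relabel hx' hy' fun h => h1.ne (Fin.ext h)]
      obtain ⟨h4, h5, h6⟩ := (h.black x y).1 h1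
      refine ⟨h4, .inl h5, ?_⟩
      rintro (h7 | ⟨h7, h8⟩ | ⟨h7, h8⟩)
      · exact h6 h7
      · exact ((h.black v y).1 (h2 (Fin.ext h7))).2.2 h8
      · exact ((h.black v x).1 (h3 (Fin.ext h7))).2.2 (hN.1 h8)
    · rintro ⟨hxy, h1, h2⟩
      obtain ⟨hx, hy⟩ := hmem h1
      rw [← hverts] at hx hy
      rw [hasPair_relabel (hne hx) (hne hy) fun h => hxy (Fin.ext h)] at h2
      push Not at h2
      obtain ⟨hxv, hxT⟩ := Finset.mem_erase.1 hx
      obtain ⟨hyv, hyT⟩ := Finset.mem_erase.1 hy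
      refine ⟨hxv, hyv, (h.black x y).2 ⟨hxy, (hor hxT hyT hxy).resolve_right h2.1, h2.1⟩,
        fun hxu => ?_, fun hyu => ?_⟩
      · have h3 := h2.2.1 (congrArg Fin.val hxu)
        exact (h.black v y).2 ⟨hyv.symm, (hor hv hyT hyv.symm).resolve_right h3, h3⟩
      · have h3 := fun h' => h2.2.2 (congrArg Fin.val hyu) (hN.1 h')
        exact (h.black v x).2 ⟨hxv.symm, (hor hv hxT hxv.symm).resolve_right h3, h3⟩
  · change (x ∈ T.verts.erase v ∧ y ∈ T.verts.erase v ∧ x ≠ y ∧ (T.red.Adj x y ∨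
      (x = u ∧ (T.red.Adj v y ∨ Xor (T.black.Adj u y) (T.black.Adj v y))) ∨
      (y = u ∧ (T.red.Adj v x ∨ Xor (T.black.Adj u x) (T.black.Adj v x))))) ↔ _
    have main (hx : x ∈ T.verts.erase v) (hy : y ∈ T.verts.erase v) (hxy : x ≠ y) :
        (T.red.Adj x y ∨
        (x = u ∧ (T.red.Adj v y ∨ Xor (T.black.Adj u y) (T.black.Adj v y))) ∨
        (y = u ∧ (T.red.Adj v x ∨ Xor (T.black.Adj u x) (T.black.Adj v x)))) ↔
        RedAdj (natGraph H) (Finset.range n) (fun i => relabel (u.val, v.val) (φ i)) x y := by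
      have hxy' : x.val ≠ y.val := fun h => hxy (Fin.ext h)
      rw [RedAdj, hasPair_relabel (hne hx) (hne hy) hxy', hasPair_relabel (hne hx) (hne hy) hxy']
      simp only [h.red, h.black, RedAdj, ← Fin.ext_iff, ne_eq]
      obtain ⟨hxv, hxT⟩ := Finset.mem_erase.1 hx
      obtain ⟨hyv, hyT⟩ := Finset.mem_erase.1 hy
      have h1 := hor hxT hyT hxy
      have h2 := hor hv hyT hyv.symm
      have h3 := hor hv hxT hxv.symm
      have h4 : ¬ v = x := fun h => hxv h.symm
      have h5 : ¬ v = y := fun h => hyv h.symm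
      rw [hE (x := x.val) (y := v.val), hN (x := x.val) (y := v.val)]
      by_cases hxu : x = u
      · have hyu : ¬ y = u := fun h => hxy (hxu.trans h.symm)
        subst hxu
        simp only [hxy, hyu, h5, not_false_eq_true, true_and, false_and, or_false]
        exact red_or_xor_iff h1 h2
      · by_cases hyu : y = u
        · subst hyu
          simp only [hxu, Ne.symm hxy, h4, not_false_eq_true, true_and, false_and, false_or]
          rw [hE (x := y.val) (y := x.val), hN (x := y.val) (y := x.val)]
          exact red_or_xor_iff h1 h3
        · simp only [hxu, hyu, hxy, not_false_eq_true, true_and, false_and, or_false]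
    constructor
    · rintro ⟨hx, hy, hxy, h1⟩
      exact (main hx hy hxy).1 h1
    · intro h1
      have hxy : x ≠ y := fun h => h1.1 (congrArg Fin.val h)
      obtain ⟨hx, hy⟩ := hmem h1.2.1
      rw [← hverts] at hx hy
      exact ⟨hx, hy, hxy, (main hx hy hxy).2 h1⟩
  · rw [relabel]
    split_ifs
    · exact u.2
    · exact h.range i hi

theorem Represents.redDegree {H : SimpleGraph (Fin n)} {φ : ℕ → ℕ} {T : Trigraph (Fin n)}
    (h : Represents H φ T) (x : Fin n) :
    T.redDegree x = {y | RedAdj (natGraph H) (Finset.range n) φ x y}.ncard := by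
  rw [Trigraph.redDegree, ← Set.ncard_image_of_injective _ Fin.val_injective]
  congr 1
  ext y
  simp only [Set.mem_image, Set.mem_ofPred_eq]
  constructor
  · rintro ⟨y, hy, rfl⟩
    exact (h.red x y).1 hy
  · intro hy
    obtain ⟨b, hb, rfl⟩ := Finset.mem_image.1 hy.mem_right
    exact ⟨⟨φ b, h.range b (Finset.mem_range.1 hb)⟩, (h.red _ _).2 hy, rfl⟩

theorem Represents.redBound_iff {H : SimpleGraph (Fin n)} {φ : ℕ → ℕ} {T : Trigraph (Fin n)}
    (h : Represents H φ T) {w : ℕ} :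
    RedBound (natGraph H) (Finset.range n) w φ ↔ T.maxRedDegree ≤ w := by
  rw [Trigraph.maxRedDegree, Finset.sup_le_iff]
  constructor
  · intro hb x _
    rw [h.redDegree]
    exact hb x
  · intro hb x
    rcases Set.eq_empty_or_nonempty {y | RedAdj (natGraph H) (Finset.range n) φ x y}
      with he | ⟨y, hy⟩
    · rw [he]; simp
    · have hx := RedAdj.mem_right (RedAdj.symm hy)
      obtain ⟨b, hb', rfl⟩ := Finset.mem_image.1 hx
      have := hb ⟨φ b, h.range b (Finset.mem_range.1 hb')⟩ ((h.verts _).2 hx)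
      rwa [h.redDegree] at this

theorem Represents.card {H : SimpleGraph (Fin n)} {φ : ℕ → ℕ} {T : Trigraph (Fin n)}
    (h : Represents H φ T) : T.verts.card = ((Finset.range n).image φ).card := by
  rw [← Finset.card_map Fin.valEmbedding]
  congr 1
  ext y
  simp only [Finset.mem_map, Fin.valEmbedding_apply]
  constructor
  · rintro ⟨y, hy, rfl⟩
    exact (h.verts y).1 hy
  · intro hy
    obtain ⟨b, hb, rfl⟩ := Finset.mem_image.1 hy
    exact ⟨⟨φ b, h.range b (Finset.mem_range.1 hb)⟩, (h.verts _).2 hy, rfl⟩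

/-- Contraction sequences from a trigraph correspond to those from the partition it represents. -/
theorem Represents.steps_iff {H : SimpleGraph (Fin n)} {φ : ℕ → ℕ} {T : Trigraph (Fin n)}
    (h : Represents H φ T) {w : ℕ} {L : List (Fin n × Fin n)} :
    (Steps (Finset.range n) (RedBound (natGraph H) (Finset.range n) w) φ
      (L.map fun e => (e.1.val, e.2.val)) ∧
      ((Finset.range n).image fun x => label (L.map fun e => (e.1.val, e.2.val)) (φ x)).card = 1) ↔
      T.IsContractionSeq L ∧ T.width L ≤ w := by
  induction L generalizing φ T with
  | nil =>
    simp only [List.map_nil, Steps, label_nil, Trigraph.IsContractionSeq, Trigraph.width,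
      Trigraph.trigraphs, List.map_cons, List.foldr_cons, List.foldr_nil, h.redBound_iff, h.card]
    rw [Nat.max_zero]
    exact and_comm
  | cons e L ih =>
    have hw : T.width (e :: L) = max T.maxRedDegree ((T.contract e.1 e.2).width L) := rfl
    rw [hw, max_le_iff]
    simp only [List.map_cons, Steps, label_cons, Trigraph.IsContractionSeq, h.redBound_iff,
      ← h.verts]
    constructor
    · rintro ⟨⟨h1, h2, h3, h4, h5⟩, h6⟩
      have h4' : e.1 ≠ e.2 := fun h => h4 (congrArg Fin.val h)
      obtain ⟨h7, h8⟩ := (ih (h.contract h2 h3 h4')).1 ⟨h5, h6⟩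
      exact ⟨⟨h2, h3, h4', h7⟩, h1, h8⟩
    · rintro ⟨⟨h2, h3, h4', h7⟩, h1, h8⟩
      obtain ⟨h5, h6⟩ := (ih (h.contract h2 h3 h4')).2 ⟨h7, h8⟩
      exact ⟨⟨h1, h2, h3, fun h => h4' (Fin.ext h), h5⟩, h6⟩

theorem isSeq_map_iff {H : SimpleGraph (Fin n)} {w : ℕ} {L : List (Fin n × Fin n)} :
    IsSeq (natGraph H) (Finset.range n) w (L.map fun e => (e.1.val, e.2.val)) ↔
      (Trigraph.ofGraph H).IsContractionSeq L ∧ (Trigraph.ofGraph H).width L ≤ w :=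
  (represents_ofGraph H).steps_iff

/-- The names in a contraction sequence are vertices. -/
theorem Steps.mem {V : Type*} [DecidableEq V] {U : Finset V} {B : (V → V) → Prop} {φ : V → V}
    {L : List (V × V)} (hs : Steps U B φ L) : ∀ e ∈ L, e.1 ∈ U.image φ ∧ e.2 ∈ U.image φ := by
  induction L generalizing φ with
  | nil => simp
  | cons e L ih =>
    obtain ⟨-, h1, h2, h3, h4⟩ := hs
    intro e' he'
    rcases List.mem_cons.1 he' with rfl | he'
    · exact ⟨h1, h2⟩
    · have := ih h4 e' he'
      rw [image_relabel_comp h1 h3, Finset.mem_erase, Finset.mem_erase] at this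
      exact ⟨this.1.2, this.2.2⟩

theorem IsSeq.exists_fin {H : SimpleGraph (Fin n)} {w : ℕ} {L : List (ℕ × ℕ)}
    (h : IsSeq (natGraph H) (Finset.range n) w L) :
    ∃ M : List (Fin n × Fin n), M.map (fun e => (e.1.val, e.2.val)) = L := by
  have h1 := h.1.mem
  simp only [Finset.image_id, Finset.mem_range] at h1
  clear h
  induction L with
  | nil => exact ⟨[], rfl⟩
  | cons e L ih =>
    obtain ⟨M, hM⟩ := ih fun e he => h1 e (List.mem_cons_of_mem _ he)
    exact ⟨(⟨e.1, (h1 e List.mem_cons_self).1⟩, ⟨e.2, (h1 e List.mem_cons_self).2⟩) :: M,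
      by simp [hM]⟩

theorem isSeq_id {V : Type*} [DecidableEq V] {G : SimpleGraph V} {U : Finset V} (hU : U.Nonempty) :
    ∃ L, IsSeq G U U.card L := by
  obtain ⟨L, h1, h2⟩ := exists_steps_card (G := G) hU (w := U.card) (φ := id) (by simp)
  exact ⟨L, h1, h2⟩

/-- The twin-width in terms of partitions. -/
theorem twinWidth_le_iff {H : SimpleGraph (Fin n)} (hn : 0 < n) {w : ℕ} :
    twinWidth H ≤ w ↔ ∃ L, IsSeq (natGraph H) (Finset.range n) w L := by
  constructor
  · intro h
    have hne : {w : ℕ | ∃ L : List (Fin n × Fin n), (Trigraph.ofGraph H).IsContractionSeq L ∧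
        (Trigraph.ofGraph H).width L = w}.Nonempty := by
      obtain ⟨L, hL⟩ := isSeq_id (G := natGraph H) (U := Finset.range n) (by simpa using hn.ne')
      obtain ⟨M, rfl⟩ := hL.exists_fin
      exact ⟨_, M, (isSeq_map_iff.1 hL).1, rfl⟩
    obtain ⟨L, h1, h2⟩ := Nat.sInf_mem hne
    exact ⟨L.map fun e => (e.1.val, e.2.val), isSeq_map_iff.2 ⟨h1, h2.trans_le h⟩⟩
  · rintro ⟨L, hL⟩
    obtain ⟨M, rfl⟩ := hL.exists_fin
    obtain ⟨h1, h2⟩ := isSeq_map_iff.1 hL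
    refine le_trans (Nat.sInf_le ?_) h2
    exact ⟨M, h1, rfl⟩

end bridge

/-! ### Restricting contraction sequences to subgraphs -/

section restrict

variable {V : Type*} [DecidableEq V]

theorem rep_spec {C : List V} {φ : V → V} {c : V} (hc : c ∈ C) :
    rep C φ c ∈ C ∧ φ (rep C φ c) = φ c := by
  rw [rep]
  cases h : C.find? fun d => φ d == φ c with
  | none => exact absurd (List.find?_eq_none.1 h c hc) (by simp)
  | some m =>
    have := List.find?_some h
    exact ⟨List.mem_of_find?_eq_some h, by simpa using this⟩

theorem rep_congr {C : List V} {φ ψ : V → V} {c d : V} (hc : c ∈ C)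
    (h : ∀ x ∈ C, φ x = φ c ↔ ψ x = ψ d) : rep C φ c = rep C ψ d := by
  have h1 : (C.find? fun x => φ x == φ c) = C.find? fun x => ψ x == ψ d :=
    List.find?_congr fun x hx => by rw [Bool.eq_iff_iff]; simpa using h x hx
  rw [rep, rep, ← h1]
  cases h2 : C.find? fun x => φ x == φ c with
  | none => exact absurd (List.find?_eq_none.1 h2 c hc) (by simp)
  | some m => rfl

theorem rep_eq_rep {C : List V} {φ : V → V} {c d : V} (hc : c ∈ C) (h : φ c = φ d) :
    rep C φ c = rep C φ d :=
  rep_congr hc fun x _ => by rw [h]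

theorem rep_eq_rep_iff {C : List V} {φ : V → V} {c d : V} (hc : c ∈ C) (hd : d ∈ C) :
    rep C φ c = rep C φ d ↔ φ c = φ d :=
  ⟨fun h => by rw [← (rep_spec (φ := φ) hc).2, h, (rep_spec (φ := φ) hd).2], rep_eq_rep hc⟩

theorem rep_rep {C : List V} {φ : V → V} {c : V} (hc : c ∈ C) :
    rep C φ (rep C φ c) = rep C φ c :=
  rep_eq_rep (rep_spec hc).1 (rep_spec hc).2

theorem rep_id {C : List V} {φ : V → V} (hφ : ∀ x ∈ C, ∀ y ∈ C, φ x = φ y → x = y) {c : V}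
    (hc : c ∈ C) : rep C φ c = c :=
  hφ _ (rep_spec hc).1 _ hc (rep_spec hc).2

/-- If `m` is the first element of `C` with the property `p`, and all elements in the part of `m`
have `p`, then `m` represents its part. -/
theorem rep_of_find? {C : List V} {φ : V → V} {p : V → Bool} {m : V} (h : C.find? p = some m)
    (hp : ∀ x ∈ C, φ x = φ m → p x = true) : rep C φ m = m := by
  obtain ⟨h1, as, bs, rfl, h2⟩ := List.find?_eq_some_iff_append.1 h
  have : ((as ++ m :: bs).find? fun d => φ d == φ m) = some m := by
    refine List.find?_eq_some_iff_append.2 ⟨by simp, as, bs, rfl, fun a ha => ?_⟩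
    simp only [Bool.not_eq_true', beq_eq_false_iff_ne, ne_eq]
    intro h'
    have h3 := hp a (by simp [ha]) h'
    have h4 := h2 a ha
    rw [h3] at h4
    simp at h4
  rw [rep, this]
  rfl

/-- The step induced by one contraction is a contraction of two different parts or nothing, and
leads from the induced partition to the next one. -/
theorem restrictStep_spec (C : List V) (φ : V → V) {e : V × V} (he : e.1 ≠ e.2) :
    (restrictStep C φ e = [] ∨ ∃ m o, restrictStep C φ e = [(m, o)] ∧ m ∈ C ∧ o ∈ C ∧ m ≠ o ∧
      rep C φ m = m ∧ rep C φ o = o) ∧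
    ∀ c ∈ C, rep C (fun x => relabel e (φ x)) c = label (restrictStep C φ e) (rep C φ c) := by
  have hrel (x : V) : relabel e x = e.1 ↔ x = e.1 ∨ x = e.2 := by
    rw [relabel]
    split_ifs with h <;> simp [h]
  have hrel' {x : V} (hx : x ≠ e.2) : relabel e x = x := if_neg hx
  rw [restrictStep]
  cases h : C.find? fun c => φ c == e.1 || φ c == e.2 with
  | none =>
    refine ⟨.inl rfl, fun c hc => ?_⟩
    have h1 (x) (hx : x ∈ C) : φ x ≠ e.2 := fun h' =>
      List.find?_eq_none.1 h x hx (by simp [h'])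
    refine (rep_congr hc fun x hx => ?_ : _ = rep C φ c)
    rw [hrel' (h1 x hx), hrel' (h1 c hc)]
  | some m =>
    have hm := List.mem_of_find?_eq_some h
    have hPm : φ m = e.1 ∨ φ m = e.2 := by simpa using List.find?_some h
    simp only [Option.toList_some, List.flatMap_cons, List.flatMap_nil, List.append_nil]
    cases h' : C.find? fun c => (φ c == e.1 || φ c == e.2) && !(φ c == φ m) with
    | none =>
      refine ⟨.inl rfl, fun c hc => ?_⟩
      have h1 (x) (hx : x ∈ C) (hP : φ x = e.1 ∨ φ x = e.2) : φ x = φ m := by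
        by_contra h2
        exact List.find?_eq_none.1 h' x hx (by simpa [h2] using hP)
      refine (rep_congr hc fun x hx => ?_ : _ = rep C φ c)
      constructor
      · intro h2
        by_cases hP : φ c = e.1 ∨ φ c = e.2
        · rw [(hrel _).2 hP, hrel] at h2
          rw [h1 x hx h2, h1 c hc hP]
        · by_cases hP' : φ x = e.1 ∨ φ x = e.2
          · rw [(hrel _).2 hP', eq_comm, hrel] at h2
            exact absurd h2 hP
          · push Not at hP hP'
            rwa [hrel' hP.2, hrel' hP'.2] at h2
      · intro h2
        rw [h2]
    | some o =>
      have ho := List.mem_of_find?_eq_some h'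
      have hPo : (φ o = e.1 ∨ φ o = e.2) ∧ φ o ≠ φ m := by simpa using List.find?_some h'
      have hmo : m ≠ o := fun h => hPo.2 (by rw [h])
      have hrm : rep C φ m = m := rep_of_find? h fun x _ hx => by simpa [hx] using hPm
      have hro : rep C φ o = o := rep_of_find? h' fun x _ hx => by
        rw [hx]; simpa using hPo
      refine ⟨.inr ⟨m, o, rfl, hm, ho, hmo, hrm, hro⟩, fun c hc => ?_⟩
      rw [Option.toList_some, List.map_cons, List.map_nil, label_singleton]
      by_cases hP : φ c = e.1 ∨ φ c = e.2
      · have h1 : rep C (fun x => relabel e (φ x)) c = m := by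
          have : (C.find? fun x => relabel e (φ x) == relabel e (φ c)) = some m := by
            rw [← h]
            refine List.find?_congr fun x _ => ?_
            rw [Bool.eq_iff_iff, beq_iff_eq, (hrel _).2 hP, hrel]
            simp
          rw [rep, this]
          rfl
        rw [h1]
        by_cases h2 : φ c = φ m
        · rw [rep_eq_rep hc h2, hrm, relabel, if_neg hmo]
        · have h3 : φ c = φ o := by
            rcases hP with h4 | h4 <;> rcases hPm with h5 | h5 <;> rcases hPo.1 with h6 | h6 <;>
              simp_all
          rw [rep_eq_rep hc h3, hro, relabel, if_pos rfl]
      · have h1 : rep C φ c ≠ o := fun h2 => hP (by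
          rw [← (rep_spec (φ := φ) hc).2, h2]; exact hPo.1)
        rw [relabel, if_neg h1]
        refine rep_congr hc fun x hx => ?_
        by_cases hP' : φ x = e.1 ∨ φ x = e.2
        · rw [(hrel _).2 hP', eq_comm, hrel]
          exact ⟨fun h => absurd h hP, fun h => absurd (h ▸ hP') hP⟩
        · push Not at hP hP'
          rw [hrel' hP.2, hrel' hP'.2]

theorem restrictSeq_append (C : List V) (L : List (V × V)) (e : V × V) :
    restrictSeq C (L ++ [e]) = restrictSeq C L ++ restrictStep C (label L) e := by
  rw [restrictSeq, restrictSeq, List.length_append, List.length_singleton, List.range_succ,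
    List.flatMap_append]
  congr 1
  · rw [List.flatMap_def, List.flatMap_def]
    congr 1
    refine List.map_congr_left fun i hi => ?_
    rw [List.mem_range] at hi
    rw [List.getElem?_append_left hi, List.take_append_of_le_length hi.le]
  · simp

@[simp] theorem restrictSeq_nil (C : List V) : restrictSeq C [] = [] := rfl

theorem label_restrictSeq (C : List V) {L : List (V × V)} (hL : ∀ e ∈ L, e.1 ≠ e.2) {c : V}
    (hc : c ∈ C) : label (restrictSeq C L) c = rep C (label L) c := by
  induction L using List.reverseRecOn with
  | nil =>
    rw [restrictSeq_nil, label_nil]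
    exact (rep_id (fun x _ y _ h => h) hc).symm
  | append_singleton L e ih =>
    have h1 := (restrictStep_spec C (label L) (hL e (by simp))).2 c hc
    rw [restrictSeq_append, label_append, ih fun e he => hL e (by simp [he]), ← h1]
    refine rep_congr hc fun x _ => ?_
    rw [label_append, label_append]
    rfl

theorem ncard_le_of_rel {α β : Type*} {A : Set α} {B : Set β} (hB : B.Finite) (r : α → β → Prop)
    (h1 : ∀ y ∈ A, ∃ z ∈ B, r y z)
    (h2 : ∀ y ∈ A, ∀ y' ∈ A, ∀ z, r y z → r y' z → y = y') : A.ncard ≤ B.ncard := by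
  choose f hf hr using fun y : A => h1 y y.2
  have := hB.to_subtype
  refine Nat.card_le_card_of_injective (fun y : A => (⟨f y, hf y⟩ : B)) fun y y' h => ?_
  have h3 : f y = f y' := congrArg Subtype.val h
  exact Subtype.ext (h2 y y.2 y' y'.2 (f y) (hr y) (h3 ▸ hr y'))

/-- A partition induced on a smaller vertex set has no larger red degrees, as each of its parts is
contained in a part of the original partition and different parts are in different ones. -/
theorem RedBound.restrict {G : SimpleGraph V} {U W : Finset V} (hWU : W ⊆ U) {φ ψ : V → V} {w : ℕ}
    (h : ∀ a ∈ W, ∀ b ∈ W, ψ a = ψ b ↔ φ a = φ b) (hb : RedBound G U w φ) : RedBound G W w ψ := by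
  intro x
  rcases Set.eq_empty_or_nonempty {y | RedAdj G W ψ x y} with he | ⟨y, hy⟩
  · rw [he]; simp
  · obtain ⟨a, ha, rfl⟩ := Finset.mem_image.1 hy.symm.mem_right
    refine le_trans (ncard_le_of_rel finite_redAdj (fun y z => ∃ b ∈ W, ψ b = y ∧ φ b = z)
      ?_ ?_) (hb (φ a))
    · intro y hy
      obtain ⟨b, hb, rfl⟩ := Finset.mem_image.1 hy.mem_right
      refine ⟨φ b, ⟨?_, ?_, ?_⟩, b, hb, rfl, rfl⟩
      · exact fun h' => hy.1 ((h a ha b hb).2 h')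
      · obtain ⟨-, ⟨a', ha', b', hb', h1, h2, h3⟩, -⟩ := hy
        exact ⟨a', hWU ha', b', hWU hb', (h a' ha' a ha).1 h1, (h b' hb' b hb).1 h2, h3⟩
      · obtain ⟨-, -, a', ha', b', hb', h1, h2, h3⟩ := hy
        exact ⟨a', hWU ha', b', hWU hb', (h a' ha' a ha).1 h1, (h b' hb' b hb).1 h2, h3⟩
    · rintro y - y' - z ⟨b, hb, rfl, rfl⟩ ⟨b', hb', rfl, h2⟩
      exact (h b hb b' hb').2 h2.symm

theorem Steps.ne {U : Finset V} {B : (V → V) → Prop} {φ : V → V}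
    {L : List (V × V)} (hs : Steps U B φ L) : ∀ e ∈ L, e.1 ≠ e.2 := by
  induction L generalizing φ with
  | nil => simp
  | cons e L ih =>
    intro e' he'
    rcases List.mem_cons.1 he' with rfl | he'
    · exact hs.2.2.2.1
    · exact ih hs.2.2.2.2 e' he'

theorem Steps.restrict {G : SimpleGraph V} {U : Finset V} {w : ℕ} {L : List (V × V)}
    (hs : Steps U (RedBound G U w) id L) {C : List V} (hC : C.toFinset ⊆ U) :
    Steps C.toFinset (RedBound G C.toFinset w) id (restrictSeq C L) := by
  induction L using List.reverseRecOn with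
  | nil => exact RedBound.restrict hC (fun a _ b _ => Iff.rfl) hs
  | append_singleton L e ih =>
    have hne := hs.ne
    have hlast := hs.last
    rw [steps_append] at hs
    have h1 := ih hs.1
    have h2 (c : V) (hc : c ∈ C) := label_restrictSeq C (fun e he => hne e (by simp [he])) hc
      (L := L)
    have hval : RedBound G C.toFinset w fun x => label (restrictSeq C (L ++ [e])) (id x) := by
      refine RedBound.restrict hC (fun a ha b hb => ?_) hlast
      rw [List.mem_toFinset] at ha hb
      rw [id, id, label_restrictSeq C hne ha, label_restrictSeq C hne hb, rep_eq_rep_iff ha hb]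
    rw [restrictSeq_append, steps_append]
    refine ⟨h1, ?_⟩
    obtain ⟨h3 | ⟨m, o, h3, hm, ho, hmo, hrm, hro⟩, -⟩ :=
      restrictStep_spec C (label L) (hne e (by simp))
    · rw [h3]
      exact h1.last
    · rw [h3]
      rw [restrictSeq_append, h3] at hval
      refine ⟨h1.last, Finset.mem_image.2 ⟨m, by simpa using hm, ?_⟩,
        Finset.mem_image.2 ⟨o, by simpa using ho, ?_⟩, hmo, ?_⟩
      · rw [id, h2 m hm, hrm]
      · rw [id, h2 o ho, hro]
      · simp only [label_append] at hval
        exact hval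

/-- A contraction sequence induces one of no larger width on any smaller vertex set. -/
theorem IsSeq.restrict {G : SimpleGraph V} {U : Finset V} {w : ℕ} {L : List (V × V)}
    (h : IsSeq G U w L) {C : List V} (hC : C.toFinset ⊆ U) (hne : C ≠ []) :
    IsSeq G C.toFinset w (restrictSeq C L) := by
  refine ⟨h.1.restrict hC, ?_⟩
  obtain ⟨x, hx⟩ := Finset.card_eq_one.1 h.2
  obtain ⟨c, hc⟩ := List.exists_mem_of_ne_nil C hne
  have h1 (c : V) (hc : c ∈ C) : label L c = x := by
    have := Finset.mem_image_of_mem (label L) (hC (List.mem_toFinset.2 hc))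
    rwa [hx, Finset.mem_singleton] at this
  refine Finset.card_eq_one.2 ⟨rep C (label L) c, ?_⟩
  ext y
  simp only [Finset.mem_image, List.mem_toFinset, Finset.mem_singleton]
  constructor
  · rintro ⟨d, hd, rfl⟩
    rw [label_restrictSeq C h.1.ne hd]
    exact rep_eq_rep hd ((h1 d hd).trans (h1 c hc).symm)
  · rintro rfl
    exact ⟨c, hc, label_restrictSeq C h.1.ne hc⟩

end restrict

/-! ### Partitions while a component is absorbed -/

section absorbing

variable {V : Type*} [DecidableEq V]

/-- `ι` maps the component `C` to the component `D` and preserves the adjacencies inside the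
component and to `S`. -/
structure IsCopy (G : SimpleGraph V) (S : Finset V) (C D : List V) (ι : V → V) : Prop where
  maps : ∀ c ∈ C, ι c ∈ D
  inj : ∀ c ∈ C, ∀ d ∈ C, ι c = ι d → c = d
  surj : ∀ x ∈ D, ∃ c ∈ C, ι c = x
  adj : ∀ c ∈ C, ∀ d ∈ C, G.Adj (ι c) (ι d) ↔ G.Adj c d
  adjS : ∀ c ∈ C, ∀ s ∈ S, G.Adj (ι c) s ↔ G.Adj c s

/-- No edges leave the vertex set `A` except to `S`. -/
def IsSeparated (G : SimpleGraph V) (U S : Finset V) (A : V → Prop) : Prop :=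
  ∀ a, A a → ∀ y ∈ U, G.Adj a y → A y ∨ y ∈ S

/-- The set `W` of kept vertices contains `S` and is otherwise separated from the rest of `U`. -/
structure IsKernel (G : SimpleGraph V) (U S W : Finset V) : Prop where
  subS : S ⊆ W
  sub : W ⊆ U
  sep : ∀ w ∈ W, w ∉ S → ∀ y ∈ U, G.Adj w y → y ∈ W

/-- The partition `Φ` of `U` agrees with the partition `φ` on the kernel `W`; the vertices in `A`
have been absorbed by parts that contain a vertex of `W` outside `S`, and the vertices outside `W`
and `A` have not yet been contracted. -/
structure AbsorbState (G : SimpleGraph V) (U S W A : Finset V) (φ Φ : V → V) : Prop where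
  onW : ∀ v ∈ W, Φ v = φ v
  nameW : ∀ v ∈ W, φ v ∈ W
  sub : ∀ a ∈ A, a ∈ U ∧ a ∉ W
  host : ∀ a ∈ A, ∃ w ∈ W, w ∉ S ∧ Φ a = φ w
  rest : ∀ v ∈ U, v ∉ W → v ∉ A → Φ v = v
  sep : IsSeparated G U S (· ∈ A)

/-- The absorbed vertices do not matter for the adjacencies between different parts. -/
def SameAdj (G : SimpleGraph V) (W X : Finset V) (φ Φ : V → V) : Prop :=
  ∀ x y, x ≠ y → (HasPair G.Adj X Φ x y ↔ HasPair G.Adj W φ x y) ∧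
    (HasPair Gᶜ.Adj X Φ x y ↔ HasPair Gᶜ.Adj W φ x y)

/-- The vertices in the same part of the partition `φ` of `W` are adjacent to the same vertices
in `D`. -/
def Unsplit (G : SimpleGraph V) (W : Finset V) (φ : V → V) (D : V → Prop) : Prop :=
  ∀ d, D d → ∀ w ∈ W, ∀ w' ∈ W, φ w = φ w' → (G.Adj w d ↔ G.Adj w' d)

variable {G : SimpleGraph V} {U S W : Finset V} {φ : V → V}

/-- Vertices that are not yet contracted and do not distinguish vertices in the same part have no
red edges. -/
theorem redAdj_of_unsplit (hK : IsKernel G U S W) (hname : ∀ v ∈ W, φ v ∈ W) {Q : Finset V}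
    (hQ : ∀ q ∈ Q, q ∈ U ∧ q ∉ W) (hQs : IsSeparated G U S (· ∈ Q)) {Ψ : V → V}
    (hW : ∀ v ∈ W, Ψ v = φ v)
    (hΨ : ∀ q ∈ Q, Ψ q ∈ Q ∨ ∃ w ∈ W, w ∉ S ∧ Ψ q = φ w)
    (hrest : ∀ v ∈ U, v ∉ W → v ∉ Q → Ψ v = v)
    (hu : Unsplit G W φ fun z => z ∈ U ∧ z ∉ W ∧ z ∉ Q) {x y : V} (h : RedAdj G U Ψ x y) :
    RedAdj G (W ∪ Q) Ψ x y := by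
  -- the part named by an uncontracted vertex `z` is a singleton
  have single : ∀ v ∈ U, Ψ v ∈ U → Ψ v ∉ W → Ψ v ∉ Q → v = Ψ v := by
    intro v hv h1 h2 h3
    by_cases hvW : v ∈ W
    · rw [hW v hvW] at h2
      exact absurd (hname v hvW) h2
    by_cases hvQ : v ∈ Q
    · rcases hΨ v hvQ with h4 | ⟨w, hw, -, h4⟩
      · exact absurd h4 h3
      · exact absurd (h4 ▸ hname w hw) h2
    · exact (hrest v hv hvW hvQ).symm
  have key : ∀ x z, RedAdj G U Ψ x z → z ∈ U → z ∉ W → z ∉ Q → False := by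
    rintro x z ⟨hxz, ⟨a, ha, b, hb, rfl, hbz, hab⟩, ⟨a', ha', b', hb', haa', hbz', hab'⟩⟩
      hzU hzW hzQ
    have h1 : b = z := (single b hb (by rwa [hbz]) (by rwa [hbz]) (by rwa [hbz])).trans hbz
    have h2 : b' = z := (single b' hb' (by rwa [hbz']) (by rwa [hbz']) (by rwa [hbz'])).trans hbz'
    subst h1
    subst h2
    have hnW : ∀ w ∈ W, w ∉ S → ¬ G.Adj w b' := fun w hw hwS h' => hzW (hK.sep w hw hwS _ hzU h')
    have hguard := hu b' ⟨hzU, hzW, hzQ⟩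
    by_cases haW : a ∈ W
    · by_cases ha'W : a' ∈ W
      · exact hab'.2 ((hguard a haW a' ha'W (by rw [← hW a haW, ← hW a' ha'W, haa'])).1 hab)
      by_cases ha'Q : a' ∈ Q
      · rcases hΨ a' ha'Q with h3 | ⟨w, hw, hwS, h3⟩
        · rw [haa', hW a haW] at h3
          exact (hQ _ h3).2 (hname a haW)
        · exact hnW w hw hwS ((hguard a haW w hw (by rw [← hW a haW, ← h3, haa'])).1 hab)
      · have h3 := hrest a' ha' ha'W ha'Q
        rw [haa', hW a haW] at h3
        exact ha'W (h3 ▸ hname a haW)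
    by_cases haQ : a ∈ Q
    · rcases hQs a haQ _ hzU hab with h3 | h3
      · exact hzQ h3
      · exact hzW (hK.subS h3)
    · have h3 := hrest a ha haW haQ
      have h4 := single a' ha' (by rwa [haa', h3]) (by rwa [haa', h3]) (by rwa [haa', h3])
      rw [haa', h3] at h4
      rw [h4] at hab'
      exact hab'.2 hab
  have hmem : ∀ x y, RedAdj G U Ψ x y → ∀ v ∈ U, Ψ v = y → v ∈ W ∪ Q := by
    intro x y hxy v hv hvy
    by_contra hn
    rw [Finset.mem_union, not_or] at hn
    have h1 := hrest v hv hn.1 hn.2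
    rw [hvy] at h1
    subst h1
    exact key _ _ hxy hv hn.1 hn.2
  obtain ⟨hxy, ⟨a, ha, b, hb, h1, h2, h3⟩, ⟨a', ha', b', hb', h1', h2', h3'⟩⟩ := id h
  exact ⟨hxy, ⟨a, hmem _ _ h.symm a ha h1, b, hmem _ _ h b hb h2, h1, h2, h3⟩,
    ⟨a', hmem _ _ h.symm a' ha' h1', b', hmem _ _ h b' hb' h2', h1', h2', h3'⟩⟩

theorem redBound_of_subset {X : Finset V} {Ψ Ψ' : V → V} {w : ℕ}
    (h : ∀ x y, RedAdj G U Ψ x y → RedAdj G X Ψ' x y) (hb : RedBound G X w Ψ') :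
    RedBound G U w Ψ :=
  fun x => (Set.ncard_le_ncard (fun y hy => h x y hy) finite_redAdj).trans (hb x)

omit [DecidableEq V] in
theorem SameAdj.redAdj {X : Finset V} {Φ : V → V} (h : SameAdj G W X φ Φ) {x y : V}
    (hr : RedAdj G X Φ x y) : RedAdj G W φ x y :=
  ⟨hr.1, (h x y hr.1).1.1 hr.2.1, (h x y hr.1).2.1 hr.2.2⟩

theorem AbsorbState.redBound (hK : IsKernel G U S W) {A : Finset V} {Φ : V → V}
    (st : AbsorbState G U S W A φ Φ) (hs : SameAdj G W (W ∪ A) φ Φ)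
    (hu : Unsplit G W φ fun z => z ∈ U ∧ z ∉ W ∧ z ∉ A) {k : ℕ} (hb : RedBound G W k φ) :
    RedBound G U k Φ :=
  redBound_of_subset (fun _ _ h => hs.redAdj (redAdj_of_unsplit hK st.nameW st.sub st.sep st.onW
    (fun a ha => .inr (st.host a ha)) st.rest hu h)) hb

omit [DecidableEq V] in
theorem SameAdj.comp {X : Finset V} {Φ : V → V} (h : SameAdj G W X φ Φ) (f : V → V) :
    SameAdj G W X (fun x => f (φ x)) fun x => f (Φ x) := by
  intro x y hxy
  simp only [hasPair_comp]
  constructor <;>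
  · refine exists_congr fun x' => exists_congr fun y' => and_congr_right fun hx =>
      and_congr_right fun hy => ?_
    have hxy' : x' ≠ y' := by
      rintro rfl
      exact hxy (hx.symm.trans hy)
    first
      | exact (h x' y' hxy').1
      | exact (h x' y' hxy').2

/-- The component `D` outside the kernel is a copy of the component `C` in the kernel. -/
structure AbsorbSetting (G : SimpleGraph V) (U S W : Finset V) (C D : List V) (ι : V → V) : Prop
    extends IsCopy G S C D ι, IsKernel G U S W where
  host : ∀ c ∈ C, c ∈ W ∧ c ∉ S
  hostSep : IsSeparated G U S (· ∈ C)
  extra : ∀ d ∈ D, d ∈ U ∧ d ∉ W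
  extraSep : IsSeparated G U S (· ∈ D)

namespace AbsorbSetting

variable {C D : List V} {ι : V → V} {A : Finset V} {Φ : V → V}

omit [DecidableEq V] in
theorem mem_S (h : AbsorbSetting G U S W C D ι) {d v : V} (hd : d ∈ D) (hv : v ∈ W)
    (hvd : G.Adj v d) : v ∈ S := by
  rcases h.extraSep d hd v (h.sub hv) hvd.symm with h1 | h1
  · exact absurd hv (h.extra v h1).2
  · exact h1

/-- A part of `W ∪ A` that is adjacent to `D` has no absorbed vertices. -/
theorem adj_of_mem (h : AbsorbSetting G U S W C D ι) (st : AbsorbState G U S W A φ Φ)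
    (hg : Unsplit G W φ (· ∈ D)) {d a a' : V} (hd : d ∈ D) (ha : a ∈ W ∪ A) (had : G.Adj a d)
    (hdA : d ∉ A) (ha' : a' ∈ W ∪ A) (haa' : Φ a = Φ a') {d' : V} (hd' : d' ∈ D) :
    a ∈ S ∧ a' ∈ W ∧ φ a = φ a' ∧ (G.Adj a d' ↔ G.Adj a' d') := by
  have haW : a ∈ W := by
    rcases Finset.mem_union.1 ha with h1 | h1
    · exact h1
    · rcases st.sep a h1 d (h.extra d hd).1 had with h2 | h2
      · exact absurd h2 hdA
      · exact absurd (h.subS h2) (h.extra d hd).2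
  have haS := h.mem_S hd haW had
  have ha'W : a' ∈ W := by
    rcases Finset.mem_union.1 ha' with h1 | h1
    · exact h1
    · obtain ⟨w, hw, hwS, h2⟩ := st.host a' h1
      have h3 := (hg d hd a haW w hw (by rw [← st.onW a haW, haa', h2])).1 had
      exact absurd (h.mem_S hd hw h3) hwS
  have h4 : φ a = φ a' := by rw [← st.onW a haW, ← st.onW a' ha'W, haa']
  exact ⟨haS, ha'W, h4, hg d' hd' a haW a' ha'W h4⟩

theorem name_mem (st : AbsorbState G U S W A φ Φ) {v : V} (hv : v ∈ W ∪ A) : Φ v ∈ W := by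
  rcases Finset.mem_union.1 hv with h1 | h1
  · rw [st.onW v h1]
    exact st.nameW v h1
  · obtain ⟨w, hw, -, h2⟩ := st.host v h1
    rw [h2]
    exact st.nameW w hw

theorem ncard_split {α : Type*} {s : Set α} (p : α → Prop) {k l : ℕ} (hs : s.Finite)
    (h1 : {y ∈ s | ¬ p y}.ncard ≤ k) (h2 : {y ∈ s | p y}.ncard ≤ l) : s.ncard ≤ k + l := by
  have : s ⊆ {y ∈ s | ¬ p y} ∪ {y ∈ s | p y} := fun y hy => by
    by_cases h : p y
    · exact .inr ⟨hy, h⟩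
    · exact .inl ⟨hy, h⟩
  refine (Set.ncard_le_ncard this ((hs.subset (Set.sep_subset _ _)).union
    (hs.subset (Set.sep_subset _ _)))).trans ((Set.ncard_union_le _ _).trans ?_)
  omega

/-- The red degrees while `D` repeats the contractions inside `C`: a part of `D` has at most as
many red edges as its counterpart had at an earlier time, and so has a part of `W` to the parts of
`D`. -/
theorem redBound_internal (h : AbsorbSetting G U S W C D ι) (st : AbsorbState G U S W A φ Φ)
    (hs : SameAdj G W (W ∪ A) φ Φ) (hdA : ∀ d ∈ D, d ∉ A) (hg : Unsplit G W φ (· ∈ D))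
    {φt : V → V} (hfin : ∀ w ∈ W, ∀ w' ∈ W, φt w = φt w' → φ w = φ w') {k : ℕ}
    (hb : RedBound G W k φ) (hbt : RedBound G W k φt) {Ψ : V → V} (hΨ : ∀ v ∈ W ∪ A, Ψ v = Φ v)
    (hΨD : ∀ c ∈ C, Ψ (ι c) = ι (rep C φt c)) :
    RedBound G (W ∪ A ∪ D.toFinset) (k + k) Ψ := by
  have hnW : ∀ v ∈ W ∪ A, Ψ v ∉ D := fun v hv h1 => by
    rw [hΨ v hv] at h1
    exact (h.extra _ h1).2 (name_mem st hv)
  have hnD : ∀ v ∈ D, Ψ v ∈ D := fun v hv => by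
    obtain ⟨c, hc, rfl⟩ := h.surj v hv
    rw [hΨD c hc]
    exact h.maps _ (rep_spec hc).1
  have hmD : ∀ v ∈ W ∪ A ∪ D.toFinset, Ψ v ∈ D → ∃ c ∈ C, ι c = v := fun v hv h1 => by
    rcases Finset.mem_union.1 hv with h2 | h2
    · exact absurd h1 (hnW v h2)
    · exact h.surj v (List.mem_toFinset.1 h2)
  have hmW : ∀ v ∈ W ∪ A ∪ D.toFinset, Ψ v ∉ D → v ∈ W ∪ A := fun v hv h1 => by
    rcases Finset.mem_union.1 hv with h2 | h2
    · exact h2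
    · exact absurd (hnD v (List.mem_toFinset.1 h2)) h1
  have hrep : ∀ c ∈ C, ∀ c' ∈ C, Ψ (ι c) = Ψ (ι c') ↔ φt c = φt c' := fun c hc c' hc' => by
    rw [hΨD c hc, hΨD c' hc', ← rep_eq_rep_iff (φ := φt) hc hc']
    exact ⟨h.inj _ (rep_spec hc).1 _ (rep_spec hc').1, fun h1 => by rw [h1]⟩
  have hsub : ∀ s ∈ S, s ∈ W := fun s hs => h.subS hs
  -- a red edge between a part of `W` and a part of `D`
  have mixed : ∀ x y, RedAdj G (W ∪ A ∪ D.toFinset) Ψ x y → x ∉ D → y ∈ D →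
      ∃ s ∈ S, φ s = x ∧ (∃ c ∈ C, Ψ (ι c) = y ∧ RedAdj G W φt (φt s) (φt c)) ∧
        ∃ d ∈ D, G.Adj s d := by
    rintro x y ⟨hxy, ⟨a, ha, b, hb, rfl, rfl, hab⟩, ⟨a', ha', b', hb', haa', hbb', hab'⟩⟩ hx hy
    have haX := hmW a ha hx
    have ha'X := hmW a' ha' (haa' ▸ hx)
    obtain ⟨c, hc, rfl⟩ := hmD b hb hy
    obtain ⟨c', hc', rfl⟩ := hmD b' hb' (hbb' ▸ hy)
    obtain ⟨h1, h2, h3, h4⟩ := h.adj_of_mem st hg (h.maps c hc) haX hab (hdA _ (h.maps c hc)) ha'X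
      (by rw [← hΨ a haX, ← hΨ a' ha'X, haa']) (h.maps c' hc')
    refine ⟨a, h1, by rw [hΨ a haX, st.onW a (hsub a h1)], ⟨c, hc, rfl, ?_, ?_, ?_⟩, ι c,
      h.maps c hc, hab⟩
    · intro h5
      have h6 := (hg _ (h.maps c hc) a (hsub a h1) c (h.host c hc).1
        (hfin _ (hsub a h1) _ (h.host c hc).1 h5)).1 hab
      exact (h.host c hc).2 (h.mem_S (h.maps c hc) (h.host c hc).1 h6)
    · exact ⟨a, hsub a h1, c, (h.host c hc).1, rfl, rfl, ((h.adjS c hc a h1).1 hab.symm).symm⟩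
    · refine ⟨a, hsub a h1, c', (h.host c' hc').1, rfl, (hrep _ hc' _ hc).1 hbb', ?_, ?_⟩
      · rintro rfl
        exact (h.host _ hc').2 h1
      · intro h5
        exact hab'.2 (h4.1 ((h.adjS c' hc' a h1).2 h5.symm).symm)
  intro x
  refine ncard_split (· ∈ D) finite_redAdj ?_ ?_
  · by_cases hx : x ∈ D
    · rcases Set.eq_empty_or_nonempty {y ∈ {y | RedAdj G (W ∪ A ∪ D.toFinset) Ψ x y} | y ∉ D}
        with he | ⟨y, hy, -⟩
      · rw [he]; simp
      obtain ⟨v, hv, rfl⟩ := Finset.mem_image.1 hy.symm.mem_right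
      obtain ⟨c, hc, rfl⟩ := hmD v hv hx
      refine le_trans (ncard_le_of_rel finite_redAdj (fun y z => ∃ s ∈ S, φ s = y ∧ φt s = z)
        ?_ ?_) (hbt (φt c))
      · rintro y ⟨hy, hyD⟩
        obtain ⟨s, hs, rfl, ⟨c', hc', h1, h2⟩, -⟩ := mixed _ _ hy.symm hyD hx
        rw [hrep _ hc' _ hc] at h1
        exact ⟨φt s, by rw [← h1]; exact h2.symm, s, hs, rfl, rfl⟩
      · rintro y - y' - z ⟨s, hs, rfl, rfl⟩ ⟨s', hs', rfl, h1⟩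
        exact hfin _ (hsub s hs) _ (hsub s' hs') h1.symm
    · refine (Set.ncard_le_ncard ?_ finite_redAdj).trans (hb x)
      rintro y ⟨⟨h1, ⟨a, ha, b, hb, rfl, rfl, hab⟩, ⟨a', ha', b', hb', haa', hbb', hab'⟩⟩, hyD⟩
      refine hs.redAdj (Φ := Φ) ⟨h1, ⟨a, hmW a ha hx, b, hmW b hb hyD, ?_, ?_, hab⟩,
        ⟨a', hmW a' ha' (haa' ▸ hx), b', hmW b' hb' (hbb' ▸ hyD), ?_, ?_, hab'⟩⟩
      · rw [hΨ a (hmW a ha hx)]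
      · rw [hΨ b (hmW b hb hyD)]
      · rw [← hΨ a' (hmW a' ha' (haa' ▸ hx)), haa']
      · rw [← hΨ b' (hmW b' hb' (hbb' ▸ hyD)), hbb']
  · by_cases hx : x ∈ D
    · rcases Set.eq_empty_or_nonempty {y ∈ {y | RedAdj G (W ∪ A ∪ D.toFinset) Ψ x y} | y ∈ D}
        with he | ⟨y, hy, -⟩
      · rw [he]; simp
      obtain ⟨v, hv, rfl⟩ := Finset.mem_image.1 hy.symm.mem_right
      obtain ⟨c, hc, rfl⟩ := hmD v hv hx
      refine le_trans (ncard_le_of_rel finite_redAdj (fun y z => ∃ d ∈ C, Ψ (ι d) = y ∧ φt d = z)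
        ?_ ?_) (hbt (φt c))
      · rintro y ⟨⟨h1, ⟨a, ha, b, hb, haa, rfl, hab⟩, ⟨a', ha', b', hb', haa', hbb', hab'⟩⟩, hyD⟩
        obtain ⟨c₁, hc₁, rfl⟩ := hmD a ha (haa ▸ hx)
        obtain ⟨c₂, hc₂, rfl⟩ := hmD a' ha' (haa' ▸ hx)
        obtain ⟨d₁, hd₁, rfl⟩ := hmD b hb hyD
        obtain ⟨d₂, hd₂, rfl⟩ := hmD b' hb' (hbb' ▸ hyD)
        refine ⟨φt d₁, ⟨fun h2 => h1 ((hrep _ hc _ hd₁).2 h2), ?_, ?_⟩, d₁, hd₁, rfl, rfl⟩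
        · exact ⟨c₁, (h.host _ hc₁).1, d₁, (h.host _ hd₁).1, (hrep _ hc₁ _ hc).1 haa, rfl,
            (h.adj _ hc₁ _ hd₁).1 hab⟩
        · refine ⟨c₂, (h.host _ hc₂).1, d₂, (h.host _ hd₂).1, (hrep _ hc₂ _ hc).1 haa',
            (hrep _ hd₂ _ hd₁).1 hbb', ?_, fun h2 => hab'.2 ((h.adj _ hc₂ _ hd₂).2 h2)⟩
          rintro rfl
          exact hab'.ne rfl
      · rintro y - y' - z ⟨d, hd, rfl, rfl⟩ ⟨d', hd', rfl, h1⟩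
        exact (hrep _ hd _ hd').2 h1.symm
    · rcases Set.eq_empty_or_nonempty {y ∈ {y | RedAdj G (W ∪ A ∪ D.toFinset) Ψ x y} | y ∈ D}
        with he | ⟨y, hy, hyD⟩
      · rw [he]; simp
      -- the vertices of `S` in the part `x` have the same neighbours in `D`, so that one of them
      -- accounts for all red edges
      obtain ⟨s, hs, rfl, -, d, hd, hsd⟩ := mixed x y hy hx hyD
      refine le_trans (ncard_le_of_rel finite_redAdj (fun y z => ∃ d ∈ C, Ψ (ι d) = y ∧ φt d = z)
        ?_ ?_) (hbt (φt s))
      · rintro y ⟨⟨h1, ⟨a, ha, b, hb, haa, rfl, hab⟩, ⟨a', ha', b', hb', haa', hbb', hab'⟩⟩, hyD⟩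
        obtain ⟨d₁, hd₁, rfl⟩ := hmD b hb hyD
        obtain ⟨d₂, hd₂, rfl⟩ := hmD b' hb' (hbb' ▸ hyD)
        have haX := hmW a ha (haa ▸ hx)
        have ha'X := hmW a' ha' (haa' ▸ hx)
        have hsX : s ∈ W ∪ A := Finset.mem_union_left _ (hsub s hs)
        have e1 := h.adj_of_mem st hg hd hsX hsd (hdA _ hd) haX
          (by rw [← hΨ a haX, haa, st.onW s (hsub s hs)]) (h.maps _ hd₁)
        have e2 := h.adj_of_mem st hg hd hsX hsd (hdA _ hd) ha'X
          (by rw [← hΨ a' ha'X, haa', st.onW s (hsub s hs)]) (h.maps _ hd₂)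
        have hsd₁ := (h.adjS _ hd₁ s hs).1 (e1.2.2.2.2 hab).symm
        refine ⟨φt d₁, ⟨fun h2 => ?_, ?_, ?_⟩, d₁, hd₁, rfl, rfl⟩
        · have h6 := (hg _ (h.maps _ hd₁) s (hsub s hs) d₁ (h.host _ hd₁).1
            (hfin _ (hsub s hs) _ (h.host _ hd₁).1 h2)).1 (e1.2.2.2.2 hab)
          exact (h.host _ hd₁).2 (h.mem_S (h.maps _ hd₁) (h.host _ hd₁).1 h6)
        · exact ⟨s, hsub s hs, d₁, (h.host _ hd₁).1, rfl, rfl, hsd₁.symm⟩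
        · refine ⟨s, hsub s hs, d₂, (h.host _ hd₂).1, rfl, (hrep _ hd₂ _ hd₁).1 hbb', ?_, ?_⟩
          · rintro rfl
            exact (h.host _ hd₂).2 hs
          · intro h5
            exact hab'.2 (e2.2.2.2.1 ((h.adjS _ hd₂ s hs).2 h5.symm).symm)
      · rintro y - y' - z ⟨d, hd, rfl, rfl⟩ ⟨d', hd', rfl, h1⟩
        exact (hrep _ hd _ hd').2 h1.symm

/-- Every part that meets `C` also has vertices of `W` outside `C`. -/
def FullyMixed (W : Finset V) (C : List V) (φ : V → V) : Prop :=
  ∀ c ∈ C, ∃ b ∈ W, b ∉ C ∧ φ b = φ c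

/-- A fully mixed component can absorb its copies without new red edges: all edges of its parts to
other parts that are not uniform are red already. -/
theorem sameAdj_absorb (h : AbsorbSetting G U S W C D ι) (st : AbsorbState G U S W A φ Φ)
    (hs : SameAdj G W (W ∪ A) φ Φ) (hdA : ∀ d ∈ D, d ∉ A) (hg : Unsplit G W φ (· ∈ D))
    (hmix : FullyMixed W C φ) {Θ : V → V} (hΘ : ∀ v ∈ W ∪ A, Θ v = Φ v)
    (hΘD : ∀ c ∈ C, Θ (ι c) = φ c) : SameAdj G W (W ∪ A ∪ D.toFinset) φ Θ := by
  have hWX : W ⊆ W ∪ A ∪ D.toFinset := fun v hv => by simp [hv]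
  have hWA : ∀ v ∈ W, v ∈ W ∪ A := fun v hv => by simp [hv]
  have hφ : ∀ v ∈ W, Θ v = φ v := fun v hv => by rw [hΘ v (hWA v hv), st.onW v hv]
  -- a nonadjacent pair with one end in `D`
  have key : ∀ X Y, X ≠ Y → ∀ c ∈ C, φ c = X → ∀ q ∈ W ∪ A ∪ D.toFinset, Θ q = Y →
      ¬ G.Adj (ι c) q → HasPair Gᶜ.Adj W φ X Y := by
    rintro X Y hXY c hc rfl q hq rfl hcq
    by_contra hn
    have all : ∀ u ∈ W, φ u = φ c → ∀ v ∈ W, φ v = Θ q → G.Adj u v := fun u hu hu' v hv hv' => by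
      by_contra h1
      refine hn ⟨u, hu, v, hv, hu', hv', ?_, h1⟩
      rintro rfl
      exact hXY (hu'.symm.trans hv')
    obtain ⟨b, hbW, hbC, hbc⟩ := hmix c hc
    have K : ∀ d ∈ C, φ d ≠ Θ q := fun d hd hdq => by
      have h1 := all b hbW hbc d (h.host d hd).1 hdq
      rcases h.hostSep d hd b (h.sub hbW) h1.symm with h2 | h2
      · exact hbC h2
      · have h3 := (hg _ (h.maps d hd) b hbW c (h.host c hc).1 hbc).1
          ((h.adjS d hd b h2).2 h1.symm).symm
        exact (h.host c hc).2 (h.mem_S (h.maps d hd) (h.host c hc).1 h3)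
    have inW : ∀ v ∈ W, φ v = Θ q → v ∈ S ∧ G.Adj c v := fun v hv hvq => by
      have h1 := all c (h.host c hc).1 rfl v hv hvq
      rcases h.hostSep c hc v (h.sub hv) h1 with h2 | h2
      · exact absurd hvq (K v h2)
      · exact ⟨h2, h1⟩
    rcases Finset.mem_union.1 hq with hq | hq
    · rcases Finset.mem_union.1 hq with hqW | hqA
      · obtain ⟨h1, h2⟩ := inW q hqW (hφ q hqW).symm
        exact hcq ((h.adjS c hc q h1).2 h2)
      · obtain ⟨w, hw, hwS, h1⟩ := st.host q hqA
        exact hwS (inW w hw (by rw [hΘ q hq, h1])).1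
    · obtain ⟨d, hd, rfl⟩ := h.surj q (List.mem_toFinset.1 hq)
      exact K d hd (hΘD d hd).symm
  intro X Y hXY
  constructor
  · constructor
    · rintro ⟨p, hp, q, hq, hpX, hqY, hpq⟩
      rcases Finset.mem_union.1 hp with hp | hp <;> rcases Finset.mem_union.1 hq with hq | hq
      · exact (hs X Y hXY).1.1 ⟨p, hp, q, hq, by rw [← hΘ p hp, hpX], by rw [← hΘ q hq, hqY], hpq⟩
      · have hqD := List.mem_toFinset.1 hq
        obtain ⟨h1, -⟩ := h.adj_of_mem st hg hqD hp hpq (hdA q hqD) hp rfl hqD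
        obtain ⟨d, hd, rfl⟩ := h.surj q hqD
        exact ⟨p, h.subS h1, d, (h.host d hd).1, by rw [← hφ p (h.subS h1), hpX],
          by rw [← hΘD d hd, hqY], ((h.adjS d hd p h1).1 hpq.symm).symm⟩
      · have hpD := List.mem_toFinset.1 hp
        obtain ⟨h1, -⟩ := h.adj_of_mem st hg hpD hq hpq.symm (hdA p hpD) hq rfl hpD
        obtain ⟨c, hc, rfl⟩ := h.surj p hpD
        exact ⟨c, (h.host c hc).1, q, h.subS h1, by rw [← hΘD c hc, hpX],
          by rw [← hφ q (h.subS h1), hqY], (h.adjS c hc q h1).1 hpq⟩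
      · obtain ⟨c, hc, rfl⟩ := h.surj p (List.mem_toFinset.1 hp)
        obtain ⟨d, hd, rfl⟩ := h.surj q (List.mem_toFinset.1 hq)
        exact ⟨c, (h.host c hc).1, d, (h.host d hd).1, by rw [← hΘD c hc, hpX],
          by rw [← hΘD d hd, hqY], (h.adj c hc d hd).1 hpq⟩
    · intro hp
      exact HasPair.mono hWX ((HasPair.congr hφ).2 hp)
  · constructor
    · rintro ⟨p, hp, q, hq, hpX, hqY, hpq⟩
      by_cases hpD : p ∈ D
      · obtain ⟨c, hc, rfl⟩ := h.surj p hpD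
        exact key X Y hXY c hc (by rw [← hΘD c hc, hpX]) q hq hqY hpq.2
      by_cases hqD : q ∈ D
      · obtain ⟨d, hd, rfl⟩ := h.surj q hqD
        exact (key Y X hXY.symm d hd (by rw [← hΘD d hd, hqY]) p hp hpX
          fun h' => hpq.2 h'.symm).symm fun _ _ => Gᶜ.symm.symm _ _
      · have hp' := (Finset.mem_union.1 hp).resolve_right fun h' => hpD (List.mem_toFinset.1 h')
        have hq' := (Finset.mem_union.1 hq).resolve_right fun h' => hqD (List.mem_toFinset.1 h')
        exact (hs X Y hXY).2.1
          ⟨p, hp', q, hq', by rw [← hΘ p hp', hpX], by rw [← hΘ q hq', hqY], hpq⟩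
    · intro hp
      exact HasPair.mono hWX ((HasPair.congr hφ).2 hp)

/-- The red degrees while the parts of `D` are contracted with their counterparts. At most two
parts are mapped to the same part of `W` when the absorption is completed. -/
theorem redBound_merge (h : AbsorbSetting G U S W C D ι) (st : AbsorbState G U S W A φ Φ)
    (hs : SameAdj G W (W ∪ A) φ Φ) (hdA : ∀ d ∈ D, d ∉ A) (hg : Unsplit G W φ (· ∈ D))
    (hmix : FullyMixed W C φ) {k : ℕ} (hb : RedBound G W k φ) {M : V → Prop} {Ψ : V → V}
    (hΨ : ∀ v ∈ W ∪ A, Ψ v = Φ v) (hΨM : ∀ c ∈ C, M (rep C φ c) → Ψ (ι c) = φ c)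
    (hΨD : ∀ c ∈ C, ¬ M (rep C φ c) → Ψ (ι c) = ι (rep C φ c)) :
    RedBound G (W ∪ A ∪ D.toFinset) (k + k) Ψ := by
  classical
  -- the effect of completing the absorption on names
  have hπ : ∀ y, ∃ X, (y ∉ D → X = y) ∧ ∀ c ∈ C, ι c = y → X = φ c := fun y => by
    by_cases hy : y ∈ D
    · obtain ⟨c, hc, rfl⟩ := h.surj y hy
      exact ⟨φ c, fun h' => absurd hy h', fun d hd hdc => by rw [h.inj d hd c hc hdc]⟩
    · exact ⟨y, fun _ => rfl, fun c hc hcy => absurd (hcy ▸ h.maps c hc) hy⟩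
  choose π hπ1 hπ2 using hπ
  have hnW : ∀ v ∈ W ∪ A, Ψ v ∉ D := fun v hv h1 => by
    rw [hΨ v hv] at h1
    exact (h.extra _ h1).2 (name_mem st hv)
  have hφD : ∀ c ∈ C, φ c ∉ D := fun c hc h1 => (h.extra _ h1).2 (st.nameW c (h.host c hc).1)
  have hΘ : ∀ v ∈ W ∪ A, π (Ψ v) = Φ v := fun v hv => by rw [hπ1 _ (hnW v hv), hΨ v hv]
  have hΘD : ∀ c ∈ C, π (Ψ (ι c)) = φ c := fun c hc => by
    by_cases hM : M (rep C φ c)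
    · rw [hΨM c hc hM, hπ1 _ (hφD c hc)]
    · rw [hΨD c hc hM, hπ2 _ _ (rep_spec hc).1 rfl, (rep_spec (φ := φ) hc).2]
  have hsame := h.sameAdj_absorb st hs hdA hg hmix (Θ := fun v => π (Ψ v)) hΘ hΘD
  have hunm : ∀ v ∈ W ∪ A ∪ D.toFinset, Ψ v ∈ D →
      ∃ c ∈ C, ι c = v ∧ ¬ M (rep C φ c) ∧ Ψ v = ι (rep C φ c) := fun v hv hvD => by
    rcases Finset.mem_union.1 hv with h1 | h1
    · exact absurd hvD (hnW v h1)
    · obtain ⟨c, hc, rfl⟩ := h.surj v (List.mem_toFinset.1 h1)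
      by_cases hM : M (rep C φ c)
      · rw [hΨM c hc hM] at hvD
        exact absurd hvD (hφD c hc)
      · exact ⟨c, hc, rfl, hM, hΨD c hc hM⟩
  -- a part of `D` has no red edge to the part of its counterpart
  have hne : ∀ x y, RedAdj G (W ∪ A ∪ D.toFinset) Ψ x y → x ∈ D → π x ≠ π y := by
    rintro x y ⟨hxy, ⟨a, ha, b, hb, rfl, rfl, hab⟩, -⟩ hx hπ
    obtain ⟨c, hc, rfl, hM, hac⟩ := hunm a ha hx
    rw [hΘD c hc] at hπ
    by_cases hbD : b ∈ D
    · obtain ⟨d, hd, rfl⟩ := h.surj b hbD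
      rw [hΘD d hd] at hπ
      have h1 := rep_eq_rep hc hπ
      exact hxy (by rw [hac, hΨD d hd (h1 ▸ hM), h1])
    · have hb' := (Finset.mem_union.1 hb).resolve_right fun h' => hbD (List.mem_toFinset.1 h')
      rw [hΘ b hb'] at hπ
      have hcW := (h.host c hc).1
      obtain ⟨-, -, -, h1⟩ := h.adj_of_mem st hg (h.maps c hc) hb' hab.symm (hdA _ (h.maps c hc))
        (Finset.mem_union_left _ hcW) (by rw [st.onW c hcW, hπ]) (h.maps c hc)
      exact (h.host c hc).2 (h.mem_S (h.maps c hc) hcW (h1.1 hab.symm))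
  have hred : ∀ x y, RedAdj G (W ∪ A ∪ D.toFinset) Ψ x y → RedAdj G W φ (π x) (π y) := by
    intro x y hxy
    have h1 : π x ≠ π y := by
      by_cases hx : x ∈ D
      · exact hne x y hxy hx
      by_cases hy : y ∈ D
      · exact (hne y x hxy.symm hy).symm
      · rw [hπ1 x hx, hπ1 y hy]
        exact hxy.1
    exact hsame.redAdj ⟨h1, hasPair_comp.2 ⟨x, y, rfl, rfl, hxy.2.1⟩,
      hasPair_comp.2 ⟨x, y, rfl, rfl, hxy.2.2⟩⟩
  intro x
  refine ncard_split (· ∈ D) finite_redAdj ?_ ?_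
  · refine le_trans (ncard_le_of_rel finite_redAdj (fun y z => π y = z) ?_ ?_) (hb (π x))
    · rintro y ⟨hy, -⟩
      exact ⟨π y, hred x y hy, rfl⟩
    · rintro y ⟨-, hy⟩ y' ⟨-, hy'⟩ z rfl h1
      rw [hπ1 y hy, hπ1 y' hy'] at h1
      exact h1.symm
  · refine le_trans (ncard_le_of_rel finite_redAdj (fun y z => π y = z) ?_ ?_) (hb (π x))
    · rintro y ⟨hy, -⟩
      exact ⟨π y, hred x y hy, rfl⟩
    · rintro y ⟨hy, hyD⟩ y' ⟨hy', hyD'⟩ z rfl h1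
      obtain ⟨v, hv, rfl⟩ := Finset.mem_image.1 hy.mem_right
      obtain ⟨v', hv', rfl⟩ := Finset.mem_image.1 hy'.mem_right
      obtain ⟨c, hc, rfl, hM, hac⟩ := hunm v hv hyD
      obtain ⟨d, hd, rfl, hM', had⟩ := hunm v' hv' hyD'
      rw [hΘD c hc, hΘD d hd] at h1
      rw [hac, had, rep_eq_rep hc h1.symm]

end AbsorbSetting

end absorbing

/-! ### The contractions for absorbing a component -/

section absorbSteps

variable {V : Type*} [DecidableEq V] {G : SimpleGraph V} {U S W A : Finset V} {C D : List V}
  {Φ : V → V} {B : (V → V) → Prop} {L : List (V × V)}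

/-- The partitions that occur while `D` is absorbed by `C`: either the contractions of an initial
segment of `L` have been repeated in `D`, or all of them have, and some parts of `D` have been
contracted with the part of their counterpart. -/
theorem absorb_steps (h : AbsorbSetting G U S W C D (transport C D)) (hC : C.Nodup)
    (st : AbsorbState G U S W A (label L) Φ) (hdA : ∀ d ∈ D, d ∉ A) (hne : ∀ e ∈ L, e.1 ≠ e.2)
    (hB₁ : ∀ P, P <+: L → ∀ Ψ : V → V, (∀ v ∈ U, v ∉ D → Ψ v = Φ v) →
      (∀ c ∈ C, Ψ (transport C D c) = transport C D (rep C (label P) c)) → B Ψ)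
    (hB₂ : ∀ (M : V → Prop) (Ψ : V → V), (∀ v ∈ U, v ∉ D → Ψ v = Φ v) →
      (∀ c ∈ C, M (rep C (label L) c) → Ψ (transport C D c) = label L c) →
      (∀ c ∈ C, ¬ M (rep C (label L) c) → Ψ (transport C D c) =
        transport C D (rep C (label L) c)) → B Ψ) :
    Steps U B Φ (absorb C D L) ∧ (∀ v ∈ U, v ∉ D → label (absorb C D L) (Φ v) = Φ v) ∧
      ∀ c ∈ C, label (absorb C D L) (Φ (transport C D c)) = label L c := by
  set ι := transport C D with hι
  have hΦD : ∀ d ∈ D, Φ d = d := fun d hd => st.rest d (h.extra d hd).1 (h.extra d hd).2 (hdA d hd)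
  have hnD : ∀ v ∈ U, v ∉ D → Φ v ∉ D := fun v hv hvD h1 => by
    by_cases hvW : v ∈ W
    · rw [st.onW v hvW] at h1
      exact (h.extra _ h1).2 (st.nameW v hvW)
    by_cases hvA : v ∈ A
    · obtain ⟨w, hw, -, h2⟩ := st.host v hvA
      rw [h2] at h1
      exact (h.extra _ h1).2 (st.nameW w hw)
    · rw [st.rest v hv hvW hvA] at h1
      exact hvD h1
  have hιU : ∀ c ∈ C, ι c ∈ U := fun c hc => (h.extra _ (h.maps c hc)).1
  -- repeating the contractions inside `C`
  have part₁ : ∀ P, P <+: L →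
      Steps U B Φ ((restrictSeq C P).map fun e => (ι e.1, ι e.2)) ∧
      (∀ v ∈ U, v ∉ D → label ((restrictSeq C P).map fun e => (ι e.1, ι e.2)) (Φ v) = Φ v) ∧
      ∀ c ∈ C, label ((restrictSeq C P).map fun e => (ι e.1, ι e.2)) (Φ (ι c)) =
        ι (rep C (label P) c) := by
    intro P
    induction P using List.reverseRecOn with
    | nil =>
      intro hP
      have h1 : ∀ c ∈ C, Φ (ι c) = ι (rep C (label []) c) := fun c hc => by
        rw [rep_id (φ := label []) (fun x _ y _ h => h) hc, hΦD _ (h.maps c hc)]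
      exact ⟨hB₁ [] hP Φ (fun _ _ _ => rfl) h1, fun _ _ _ => rfl, h1⟩
    | append_singleton P e ih =>
      intro hP
      obtain ⟨ih1, ih2, ih3⟩ := ih ((List.prefix_append _ _).trans hP)
      have hPe := hne e (hP.subset (by simp))
      obtain ⟨h1, h2⟩ := restrictStep_spec C (label P) hPe
      have hlab (x : V) : label (P ++ [e]) x = relabel e (label P x) := label_append P [e] x
      have h2' (c) (hc : c ∈ C) : rep C (label (P ++ [e])) c =
          label (restrictStep C (label P) e) (rep C (label P) c) := by
        rw [← h2 c hc]
        exact rep_congr hc fun x _ => by rw [hlab, hlab]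
      rw [restrictSeq_append, List.map_append]
      have h3 : (∀ v ∈ U, v ∉ D → label ((restrictSeq C P).map (fun e => (ι e.1, ι e.2)) ++
          (restrictStep C (label P) e).map fun e => (ι e.1, ι e.2)) (Φ v) = Φ v) ∧
          ∀ c ∈ C, label ((restrictSeq C P).map (fun e => (ι e.1, ι e.2)) ++
            (restrictStep C (label P) e).map fun e => (ι e.1, ι e.2)) (Φ (ι c)) =
              ι (rep C (label (P ++ [e])) c) := by
        obtain h1 | ⟨m, o, h1, hm, ho, -⟩ := h1
        · refine ⟨fun v hv hvD => ?_, fun c hc => ?_⟩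
          · rw [h1, List.map_nil, List.append_nil, ih2 v hv hvD]
          · rw [h2' c hc, h1, List.map_nil, List.append_nil, ih3 c hc, label_nil]
        · refine ⟨fun v hv hvD => ?_, fun c hc => ?_⟩
          · rw [h1, label_append, ih2 v hv hvD]
            exact if_neg fun h4 : Φ v = ι o => hnD v hv hvD (h4 ▸ h.maps o ho)
          · rw [h2' c hc, h1, label_append, ih3 c hc]
            change relabel (ι m, ι o) _ = ι (relabel (m, o) _)
            by_cases h4 : rep C (label P) c = o
            · rw [h4, relabel, relabel, if_pos rfl, if_pos rfl]
            · rw [relabel, relabel, if_neg h4, if_neg]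
              exact fun h5 => h4 (h.inj _ (rep_spec hc).1 _ ho h5)
      refine ⟨steps_append.2 ⟨ih1, ?_⟩, h3⟩
      obtain h1 | ⟨m, o, h1, hm, ho, hmo, hrm, hro⟩ := h1
      · rw [h1]
        exact ih1.last
      · have h4 := hB₁ (P ++ [e]) hP _ h3.1 h3.2
        rw [h1] at h4 ⊢
        simp only [label_append] at h4
        refine ⟨ih1.last, Finset.mem_image.2 ⟨ι m, hιU m hm, ?_⟩,
          Finset.mem_image.2 ⟨ι o, hιU o ho, ?_⟩, fun h5 => hmo (h.inj m hm o ho h5), h4⟩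
        · rw [ih3 m hm, hrm]
        · rw [ih3 o ho, hro]
  obtain ⟨s1, s2, s3⟩ := part₁ L (List.prefix_refl L)
  set Ψ₀ : V → V := fun v => label ((restrictSeq C L).map fun e => (ι e.1, ι e.2)) (Φ v) with hΨ₀
  have hφD : ∀ c ∈ C, label L c ∉ D := fun c hc h1 =>
    (h.extra _ h1).2 (st.nameW c (h.host c hc).1)
  -- contracting the parts of `D` with their counterparts
  have part₂ : ∀ R : List V, R.Nodup → (∀ c ∈ R, c ∈ C ∧ rep C (label L) c = c) →
      Steps U B Ψ₀ (R.map fun c => (label L c, ι c)) ∧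
      (∀ v ∈ U, v ∉ D → label (R.map fun c => (label L c, ι c)) (Ψ₀ v) = Φ v) ∧
      (∀ c ∈ C, rep C (label L) c ∈ R →
        label (R.map fun c => (label L c, ι c)) (Ψ₀ (ι c)) = label L c) ∧
      ∀ c ∈ C, rep C (label L) c ∉ R →
        label (R.map fun c => (label L c, ι c)) (Ψ₀ (ι c)) = ι (rep C (label L) c) := by
    intro R
    induction R using List.reverseRecOn with
    | nil => exact fun _ _ => ⟨s1.last, s2, fun c _ hc => absurd hc (by simp),
        fun c hc _ => s3 c hc⟩
    | append_singleton R a ih =>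
      intro hnd hR
      rw [List.nodup_append] at hnd
      have haR : a ∉ R := fun h1 => hnd.2.2 a h1 a (by simp) rfl
      obtain ⟨i1, i2, i3, i4⟩ := ih hnd.1 fun c hc => hR c (by simp [hc])
      obtain ⟨haC, hra⟩ := hR a (by simp)
      have haD : a ∉ D := fun h1 => (h.extra a h1).2 (h.host a haC).1
      have haU : a ∈ U := h.sub (h.host a haC).1
      have hlab (x : V) : label ((R ++ [a]).map fun c => (label L c, ι c)) x =
          relabel (label L a, ι a) (label (R.map fun c => (label L c, ι c)) x) := by
        rw [List.map_append, label_append]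
        rfl
      have j1 : ∀ v ∈ U, v ∉ D →
          label ((R ++ [a]).map fun c => (label L c, ι c)) (Ψ₀ v) = Φ v := fun v hv hvD => by
        rw [hlab, i2 v hv hvD]
        exact if_neg fun h4 : Φ v = ι a => hnD v hv hvD (h4 ▸ h.maps a haC)
      have j2 : ∀ c ∈ C, rep C (label L) c ∈ R ++ [a] →
          label ((R ++ [a]).map fun c => (label L c, ι c)) (Ψ₀ (ι c)) = label L c := by
        intro c hc hcR
        rw [hlab]
        by_cases h1 : rep C (label L) c ∈ R
        · rw [i3 c hc h1]
          exact if_neg fun h4 : label L c = ι a => hφD c hc (h4 ▸ h.maps a haC)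
        · have h2 : rep C (label L) c = a := by simpa [h1] using hcR
          rw [i4 c hc h1, h2, relabel, if_pos rfl, ← h2]
          exact (rep_spec (φ := label L) hc).2
      have j3 : ∀ c ∈ C, rep C (label L) c ∉ R ++ [a] →
          label ((R ++ [a]).map fun c => (label L c, ι c)) (Ψ₀ (ι c)) =
            ι (rep C (label L) c) := by
        intro c hc hcR
        have h1 : rep C (label L) c ∉ R := fun h' => hcR (by simp [h'])
        rw [hlab, i4 c hc h1]
        refine if_neg fun h4 => hcR ?_
        rw [h.inj _ (rep_spec hc).1 _ haC h4]
        simp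
      refine ⟨?_, j1, j2, j3⟩
      have h4 := hB₂ (· ∈ R ++ [a]) _ j1 j2 j3
      rw [List.map_append, steps_append]
      refine ⟨i1, i1.last, Finset.mem_image.2 ⟨a, haU, ?_⟩,
        Finset.mem_image.2 ⟨ι a, hιU a haC, ?_⟩,
        fun h5 : label L a = ι a => hφD a haC (h5 ▸ h.maps a haC), ?_⟩
      · rw [i2 a haU haD, st.onW a (h.host a haC).1]
      · rw [i4 a haC (hra.symm ▸ haR), hra]
      · simp only [List.map_append, label_append] at h4
        exact h4
  obtain ⟨t1, t2, t3, -⟩ := part₂ (C.filter fun c => rep C (label L) c == c) (hC.filter _)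
    fun c hc => by simpa using hc
  refine ⟨steps_append.2 ⟨s1, t1⟩, fun v hv hvD => ?_, fun c hc => ?_⟩
  · rw [absorb, label_append]
    exact t2 v hv hvD
  · rw [absorb, label_append]
    refine t3 c hc (List.mem_filter.2 ⟨(rep_spec hc).1, ?_⟩)
    rw [rep_rep hc, beq_self_eq_true]

/-- After the absorption of `D`. -/
theorem AbsorbState.after_absorb (h : AbsorbSetting G U S W C D (transport C D))
    (st : AbsorbState G U S W A (label L) Φ) {Ψ : V → V}
    (h1 : ∀ v ∈ U, v ∉ D → Ψ v = Φ v) (h2 : ∀ c ∈ C, Ψ (transport C D c) = label L c)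
    (hdA : ∀ d ∈ D, d ∉ A) : AbsorbState G U S W (A ∪ D.toFinset) (label L) Ψ where
  onW v hv := by rw [h1 v (h.sub hv) fun h' => (h.extra v h').2 hv, st.onW v hv]
  nameW := st.nameW
  sub a ha := by
    rcases Finset.mem_union.1 ha with ha | ha
    · exact st.sub a ha
    · exact h.extra a (List.mem_toFinset.1 ha)
  host a ha := by
    rcases Finset.mem_union.1 ha with ha | ha
    · obtain ⟨w, hw, hwS, h3⟩ := st.host a ha
      exact ⟨w, hw, hwS, by rw [h1 a (st.sub a ha).1 fun h' => hdA a h' ha, h3]⟩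
    · obtain ⟨c, hc, rfl⟩ := h.surj a (List.mem_toFinset.1 ha)
      exact ⟨c, (h.host c hc).1, (h.host c hc).2, h2 c hc⟩
  rest v hv hvW hvA := by
    rw [Finset.mem_union, not_or, List.mem_toFinset] at hvA
    rw [h1 v hv hvA.2, st.rest v hv hvW hvA.1]
  sep a ha y hy hay := by
    simp only [Finset.mem_union, List.mem_toFinset] at ha ⊢
    rcases ha with ha | ha
    · rcases st.sep a ha y hy hay with h3 | h3
      · exact .inl (.inl h3)
      · exact .inr h3
    · rcases h.extraSep a ha y hy hay with h3 | h3
      · exact .inl (.inr h3)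
      · exact .inr h3

/-- After a contraction of two parts that meet the kernel. -/
theorem AbsorbState.after_contract {φ : V → V} (st : AbsorbState G U S W A φ Φ)
    {e : V × V} (he : e.1 ∈ W)
    (he' : e.2 ∈ W) :
    AbsorbState G U S W A (fun x => relabel e (φ x)) fun x => relabel e (Φ x) where
  onW v hv := by simp only [st.onW v hv]
  nameW v hv := by
    rw [relabel]
    split_ifs
    · exact he
    · exact st.nameW v hv
  sub := st.sub
  host a ha := by
    obtain ⟨w, hw, hwS, h3⟩ := st.host a ha
    exact ⟨w, hw, hwS, by simp only [h3]⟩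
  rest v hv hvW hvA := by
    rw [st.rest v hv hvW hvA]
    exact if_neg fun h' : v = e.2 => hvW (h' ▸ he')
  sep := st.sep

/-- While `D` is absorbed, the other uncontracted vertices have no red edges. -/
theorem AbsorbState.redAdj_of_absorbing {φ : V → V} (h : AbsorbSetting G U S W C D (transport C D))
    (st : AbsorbState G U S W A φ Φ) (hdA : ∀ d ∈ D, d ∉ A)
    (hu : Unsplit G W φ fun z => z ∈ U ∧ z ∉ W ∧ z ∉ A) {Ψ : V → V}
    (h1 : ∀ v ∈ U, v ∉ D → Ψ v = Φ v)
    (h2 : ∀ c ∈ C, Ψ (transport C D c) ∈ D ∨ Ψ (transport C D c) = φ c) {x y : V}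
    (hxy : RedAdj G U Ψ x y) : RedAdj G (W ∪ A ∪ D.toFinset) Ψ x y := by
  have hWA : ∀ v ∈ W ∪ A, v ∈ U ∧ v ∉ D := fun v hv => by
    rcases Finset.mem_union.1 hv with hv | hv
    · exact ⟨h.sub hv, fun h' => (h.extra v h').2 hv⟩
    · exact ⟨(st.sub v hv).1, fun h' => hdA v h' hv⟩
  rw [Finset.union_assoc]
  refine redAdj_of_unsplit h.toIsKernel st.nameW (Q := A ∪ D.toFinset) ?_ ?_ ?_ ?_ ?_ ?_ hxy
  · exact fun q hq => (Finset.mem_union.1 hq).elim (st.sub q)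
      fun hq => h.extra q (List.mem_toFinset.1 hq)
  · intro a ha y hy hay
    simp only [Finset.mem_union, List.mem_toFinset] at ha ⊢
    rcases ha with ha | ha
    · have := st.sep a ha y hy hay
      tauto
    · have := h.extraSep a ha y hy hay
      tauto
  · exact fun v hv => by
      obtain ⟨h3, h4⟩ := hWA v (Finset.mem_union_left _ hv)
      rw [h1 v h3 h4, st.onW v hv]
  · intro q hq
    rcases Finset.mem_union.1 hq with hq | hq
    · obtain ⟨w, hw, hwS, h5⟩ := st.host q hq
      obtain ⟨h3, h4⟩ := hWA q (Finset.mem_union_right _ hq)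
      exact .inr ⟨w, hw, hwS, by rw [h1 q h3 h4, h5]⟩
    · obtain ⟨c, hc, rfl⟩ := h.surj q (List.mem_toFinset.1 hq)
      rcases h2 c hc with h3 | h3
      · exact .inl (Finset.mem_union_right _ (List.mem_toFinset.2 h3))
      · exact .inr ⟨c, (h.host c hc).1, (h.host c hc).2, h3⟩
  · intro v hv hvW hvQ
    rw [Finset.mem_union, not_or, List.mem_toFinset] at hvQ
    rw [h1 v hv hvQ.2, st.rest v hv hvW hvQ.1]
  · intro d hd
    refine hu d ⟨hd.1, hd.2.1, fun h' => hd.2.2 (Finset.mem_union_left _ h')⟩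

/-- Absorbing a copy of a fully mixed component keeps the red degrees at most twice those of the
kernel. -/
theorem AbsorbState.absorb_redBound (h : AbsorbSetting G U S W C D (transport C D)) (hC : C.Nodup)
    (st : AbsorbState G U S W A (label L) Φ) (hs : SameAdj G W (W ∪ A) (label L) Φ)
    (hdA : ∀ d ∈ D, d ∉ A) {k : ℕ} (hL : Steps W (RedBound G W k) id L)
    (hu : Unsplit G W (label L) fun z => z ∈ U ∧ z ∉ W ∧ z ∉ A)
    (hmix : AbsorbSetting.FullyMixed W C (label L)) :
    Steps U (RedBound G U (k + k)) Φ (absorb C D L) ∧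
    AbsorbState G U S W (A ∪ D.toFinset) (label L) (fun v => label (absorb C D L) (Φ v)) ∧
    SameAdj G W (W ∪ (A ∪ D.toFinset)) (label L) fun v => label (absorb C D L) (Φ v) := by
  have hg : Unsplit G W (label L) (· ∈ D) := fun d hd => hu d
    ⟨(h.extra d hd).1, (h.extra d hd).2, hdA d hd⟩
  have hWA : ∀ v ∈ W ∪ A, v ∈ U ∧ v ∉ D := fun v hv => by
    rcases Finset.mem_union.1 hv with hv | hv
    · exact ⟨h.sub hv, fun h' => (h.extra v h').2 hv⟩
    · exact ⟨(st.sub v hv).1, fun h' => hdA v h' hv⟩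
  have drop (Ψ : V → V) (h1 : ∀ v ∈ U, v ∉ D → Ψ v = Φ v)
      (h2 : ∀ c ∈ C, Ψ (transport C D c) ∈ D ∨ Ψ (transport C D c) = label L c)
      (hb : RedBound G (W ∪ A ∪ D.toFinset) (k + k) Ψ) : RedBound G U (k + k) Ψ :=
    redBound_of_subset (fun _ _ => st.redAdj_of_absorbing h hdA hu h1 h2) hb
  have hpre : ∀ P, P <+: L → RedBound G W k (label P) ∧
      ∀ w ∈ W, ∀ w' ∈ W, label P w = label P w' → label L w = label L w' := by
    rintro P ⟨R, rfl⟩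
    refine ⟨(steps_append.1 hL).1.last, fun w _ w' _ h' => ?_⟩
    rw [label_append, label_append, h']
  obtain ⟨h1, h2, h3⟩ := absorb_steps (B := RedBound G U (k + k)) h hC st hdA hL.ne
    (fun P hP Ψ h1 h2 => drop Ψ h1
      (fun c hc => .inl (h2 c hc ▸ h.maps _ (rep_spec hc).1))
      (h.redBound_internal st hs hdA hg (hpre P hP).2 (hpre L (List.prefix_refl _)).1 (hpre P hP).1
        (fun v hv => h1 v (hWA v hv).1 (hWA v hv).2) h2))
    (fun M Ψ h1 h2 h3 => drop Ψ h1
      (fun c hc => by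
        by_cases hM : M (rep C (label L) c)
        · exact .inr (h2 c hc hM)
        · exact .inl (h3 c hc hM ▸ h.maps _ (rep_spec hc).1))
      (h.redBound_merge st hs hdA hg hmix (hpre L (List.prefix_refl _)).1
        (fun v hv => h1 v (hWA v hv).1 (hWA v hv).2) h2 h3))
  refine ⟨h1, st.after_absorb h h2 h3 hdA, ?_⟩
  rw [← Finset.union_assoc]
  exact h.sameAdj_absorb st hs hdA hg hmix (fun v hv => h2 v (hWA v hv).1 (hWA v hv).2) h3

/-- Absorbing several components one after another. -/
theorem steps_flatMap {Inv : Finset V → (V → V) → Prop} {cmp : V → List V} {M : V → List (V × V)}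
    (hB : ∀ A Φ, Inv A Φ → B Φ) (l : List V) : ∀ A Φ, Inv A Φ →
    l.Pairwise (fun r r' => ∀ d ∈ cmp r', d ∉ cmp r) → (∀ r ∈ l, ∀ d ∈ cmp r, d ∉ A) →
    (∀ r ∈ l, ∀ A Φ, Inv A Φ → (∀ d ∈ cmp r, d ∉ A) → Steps U B Φ (M r) ∧
      Inv (A ∪ (cmp r).toFinset) fun v => label (M r) (Φ v)) →
    Steps U B Φ (l.flatMap M) ∧
      Inv (A ∪ (l.flatMap cmp).toFinset) fun v => label (l.flatMap M) (Φ v) := by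
  induction l with
  | nil =>
    intro A Φ h _ _ _
    exact ⟨hB A Φ h, by simpa using h⟩
  | cons r l ih =>
    intro A Φ h hp hA hstep
    rw [List.pairwise_cons] at hp
    obtain ⟨h1, h2⟩ := hstep r (by simp) A Φ h (hA r (by simp))
    obtain ⟨h3, h4⟩ := ih _ _ h2 hp.2 (fun r' hr' d hd => by
      rw [Finset.mem_union, not_or, List.mem_toFinset]
      exact ⟨hA r' (by simp [hr']) d hd, hp.1 r' hr' d hd⟩)
      fun r' hr' => hstep r' (by simp [hr'])
    rw [List.flatMap_cons, List.flatMap_cons, List.toFinset_append, ← Finset.union_assoc]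
    simp only [label_append]
    exact ⟨steps_append.2 ⟨h1, h3⟩, h4⟩

end absorbSteps

/-! ### Similar components -/

section similar

variable {V : Type*}

/-- Two lists of vertices are joined in the same way inside and to `S`, position by position. -/
def SimilarLists (G : SimpleGraph V) (S : Finset V) (C D : List V) : Prop :=
  C.length = D.length ∧ ∀ i (hi : i < C.length) (hi' : i < D.length),
    (∀ j (hj : j < C.length) (hj' : j < D.length), G.Adj C[i] C[j] ↔ G.Adj D[i] D[j]) ∧
      ∀ s ∈ S, G.Adj C[i] s ↔ G.Adj D[i] s

variable {G : SimpleGraph V} {S : Finset V} {C D E : List V}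

theorem SimilarLists.symm (h : SimilarLists G S C D) : SimilarLists G S D C :=
  ⟨h.1.symm, fun i hi hi' => ⟨fun j hj hj' => ((h.2 i hi' hi).1 j hj' hj).symm,
    fun s hs => ((h.2 i hi' hi).2 s hs).symm⟩⟩

theorem SimilarLists.trans (h : SimilarLists G S C D) (h' : SimilarLists G S D E) :
    SimilarLists G S C E :=
  ⟨h.1.trans h'.1, fun i hi hi' => ⟨fun j hj hj' =>
    ((h.2 i hi (h.1 ▸ hi)).1 j hj (h.1 ▸ hj)).trans ((h'.2 i (h.1 ▸ hi) hi').1 j (h.1 ▸ hj) hj'),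
    fun s hs => ((h.2 i hi (h.1 ▸ hi)).2 s hs).trans ((h'.2 i (h.1 ▸ hi) hi').2 s hs)⟩⟩

variable [DecidableEq V]

theorem transport_getElem (hC : C.Nodup) {i : ℕ} (hi : i < C.length) (hi' : i < D.length) :
    transport C D C[i] = D[i] := by
  have h : ((List.range C.length).find? fun j => C.getD j C[i] == C[i]) = some i := by
    cases h : (List.range C.length).find? fun j => C.getD j C[i] == C[i] with
    | none =>
      exact absurd (List.find?_eq_none.1 h i (List.mem_range.2 hi)) (by simp [hi])
    | some j =>
      have h1 := List.find?_some h
      have hj := List.mem_range.1 (List.mem_of_find?_eq_some h)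
      rw [List.getD_eq_getElem _ _ hj, beq_iff_eq, hC.getElem_inj_iff] at h1
      rw [h1]
  rw [transport, h, Option.getD_some, List.getD_eq_getElem _ _ hi']

/-- The correspondence by position is a copy in the sense of adjacencies. -/
theorem SimilarLists.isCopy (h : SimilarLists G S C D) (hC : C.Nodup) (hD : D.Nodup) :
    IsCopy G S C D (transport C D) := by
  have key : ∀ c ∈ C, ∃ (i : ℕ) (hi : i < C.length) (hi' : i < D.length), C[i] = c ∧
      transport C D c = D[i] := by
    intro c hc
    obtain ⟨i, hi, rfl⟩ := List.mem_iff_getElem.1 hc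
    exact ⟨i, hi, h.1 ▸ hi, rfl, transport_getElem hC hi (h.1 ▸ hi)⟩
  refine ⟨fun c hc => ?_, fun c hc d hd hcd => ?_, fun x hx => ?_, fun c hc d hd => ?_,
    fun c hc s hs => ?_⟩
  · obtain ⟨i, hi, hi', -, h1⟩ := key c hc
    rw [h1]
    exact List.getElem_mem _
  · obtain ⟨i, hi, hi', rfl, h1⟩ := key c hc
    obtain ⟨j, hj, hj', rfl, h2⟩ := key d hd
    rw [h1, h2, hD.getElem_inj_iff] at hcd
    subst hcd
    rfl
  · obtain ⟨i, hi, rfl⟩ := List.mem_iff_getElem.1 hx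
    exact ⟨C[i]'(h.1 ▸ hi), List.getElem_mem _, transport_getElem hC _ hi⟩
  · obtain ⟨i, hi, hi', rfl, h1⟩ := key c hc
    obtain ⟨j, hj, hj', rfl, h2⟩ := key d hd
    rw [h1, h2]
    exact ((h.2 i hi hi').1 j hj hj').symm
  · obtain ⟨i, hi, hi', rfl, h1⟩ := key c hc
    rw [h1]
    exact ((h.2 i hi hi').2 s hs).symm

end similar

/-! ### Many similar components -/

section manyCopies

variable {V : Type*} [DecidableEq V] {G : SimpleGraph V} {U S W : Finset V}

/-- `cmp v` lists the vertices of the component of `v` after deletion of `S`. -/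
structure IsComponents (G : SimpleGraph V) (U S : Finset V) (cmp : V → List V) : Prop where
  self : ∀ v ∈ U, v ∉ S → v ∈ cmp v
  mem : ∀ v ∈ U, v ∉ S → ∀ x ∈ cmp v, x ∈ U ∧ x ∉ S ∧ cmp x = cmp v
  sep : ∀ v ∈ U, v ∉ S → IsSeparated G U S (· ∈ cmp v)
  nodup : ∀ v ∈ U, v ∉ S → (cmp v).Nodup
  conn : ∀ v ∈ U, v ∉ S → ∀ X : V → Prop, X v →
    (∀ x ∈ cmp v, X x → ∀ y ∈ cmp v, G.Adj x y → X y) → ∀ y ∈ cmp v, X y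

variable {cmp : V → List V}

/-- `R` is a set of vertices in different components of the kernel that are similar to the one of
`r` outside the kernel. -/
structure IsCopySet (G : SimpleGraph V) (S W : Finset V) (cmp : V → List V) (r : V)
    (R : Finset V) : Prop where
  mem : ∀ x ∈ R, x ∈ W ∧ x ∉ S ∧ ∀ y ∈ cmp x, y ∈ W
  copy : ∀ x ∈ R, IsCopy G S (cmp r) (cmp x) (transport (cmp r) (cmp x))
  ne : ∀ x ∈ R, ∀ x' ∈ R, x ≠ x' → cmp x ≠ cmp x'

theorem IsCopySet.transport_mem (hcmp : IsComponents G U S cmp) (hWU : W ⊆ U) {r : V} {R : Finset V}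
    (hR : IsCopySet G S W cmp r R) {x c : V} (hx : x ∈ R) (hc : c ∈ cmp r) :
    transport (cmp r) (cmp x) c ∈ cmp x ∧ transport (cmp r) (cmp x) c ∈ W ∧
      transport (cmp r) (cmp x) c ∉ S ∧
      ∀ x' ∈ R, x ≠ x' → transport (cmp r) (cmp x) c ∉ cmp x' := by
  have h1 := (hR.copy x hx).maps c hc
  have h2 := hcmp.mem x (hWU (hR.mem x hx).1) (hR.mem x hx).2.1 _ h1
  refine ⟨h1, (hR.mem x hx).2.2 _ h1, h2.2.1, fun x' hx' hne h3 => ?_⟩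
  have h4 := hcmp.mem x' (hWU (hR.mem x' hx').1) (hR.mem x' hx').2.1 _ h3
  exact hR.ne x hx x' hx' hne (h2.2.2.symm.trans h4.2.2)

/-- If corresponding vertices of many copies lie in the same part, then so do corresponding
neighbours of them for many copies, as there are few red edges at this part. Hence some copies
coincide completely. -/
theorem exists_fullyMixed_of_const (hcmp : IsComponents G U S cmp) (hWU : W ⊆ U) {r : V}
    (hr : r ∈ U) (hrS : r ∉ S) {R : Finset V} (hR : IsCopySet G S W cmp r R) {φ : V → V} {k : ℕ}
    (hb : RedBound G W k φ) (j : ℕ) : ∀ X : Finset V, X ⊆ (cmp r).toFinset → X.Nonempty →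
      ((cmp r).toFinset \ X).card = j → ∀ R₀ ⊆ R, 2 * (k + 1) ^ j ≤ R₀.card →
      (∀ c ∈ X, ∀ x ∈ R₀, ∀ x' ∈ R₀, φ (transport (cmp r) (cmp x) c) =
        φ (transport (cmp r) (cmp x') c)) →
      ∃ x ∈ R, AbsorbSetting.FullyMixed W (cmp x) φ := by
  induction j with
  | zero =>
    intro X hX _ hXj R₀ hR₀ hcard hconst
    rw [pow_zero] at hcard
    obtain ⟨x, hx, x', hx', hne⟩ := Finset.one_lt_card.1 (by omega : 1 < R₀.card)
    refine ⟨x, hR₀ hx, fun c' hc' => ?_⟩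
    obtain ⟨c, hc, rfl⟩ := (hR.copy x (hR₀ hx)).surj c' hc'
    have h1 := hR.transport_mem hcmp hWU (hR₀ hx') hc
    refine ⟨_, h1.2.1, h1.2.2.2 x (hR₀ hx) hne.symm, hconst c ?_ x' hx' x hx⟩
    by_contra hcX
    exact (Finset.card_pos.2 ⟨c, Finset.mem_sdiff.2 ⟨List.mem_toFinset.2 hc, hcX⟩⟩).ne' hXj
  | succ j ih =>
    intro X hX hXne hXj R₀ hR₀ hcard hconst
    have hpow := Nat.one_le_pow j (k + 1) (by omega)
    obtain ⟨c, hcX, hc, c', hc', hc'X, hadj⟩ : ∃ c ∈ X, c ∈ cmp r ∧ ∃ c' ∈ cmp r, c' ∉ X ∧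
        G.Adj c c' := by
      by_contra! hno
      obtain ⟨z, hz⟩ := hXne
      have hzr := List.mem_toFinset.1 (hX hz)
      obtain ⟨hzU, hzS, hzc⟩ := hcmp.mem r hr hrS z hzr
      have h1 := hcmp.conn z hzU hzS (· ∈ X) hz fun x hx hxX y hy hxy => by
        by_contra hyX
        rw [hzc] at hx hy
        exact hno x hxX hx y hy hyX hxy
      rw [hzc] at h1
      obtain ⟨y, hy⟩ := Finset.card_pos.1 (by omega : 0 < ((cmp r).toFinset \ X).card)
      rw [Finset.mem_sdiff, List.mem_toFinset] at hy
      exact hy.2 (h1 y hy.1)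
    have hR₀card : 1 < R₀.card := by
      refine lt_of_lt_of_le ?_ hcard
      have := Nat.one_le_pow (j + 1) (k + 1) (by omega)
      omega
    obtain ⟨x₀, hx₀⟩ := Finset.card_pos.1 (by omega : 0 < R₀.card)
    set y₀ := φ (transport (cmp r) (cmp x₀) c) with hy₀
    set T : Finset V := insert y₀ (finite_redAdj (G := G) (U := W) (φ := φ) (x := y₀)).toFinset
      with hT
    have hTcard : T.card ≤ k + 1 := by
      refine (Finset.card_insert_le _ _).trans (Nat.add_le_add_right ?_ 1)
      rw [← Set.ncard_eq_toFinset_card _ finite_redAdj]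
      exact hb y₀
    have hmap : ∀ x ∈ R₀, φ (transport (cmp r) (cmp x) c') ∈ T := by
      intro x hx
      rw [hT, Finset.mem_insert, Set.Finite.mem_toFinset]
      by_cases heq : φ (transport (cmp r) (cmp x) c') = y₀
      · exact .inl heq
      right
      obtain ⟨x₁, hx₁, hne⟩ := Finset.exists_mem_ne hR₀card x
      have m := hR.transport_mem hcmp hWU (hR₀ hx) hc
      have m' := hR.transport_mem hcmp hWU (hR₀ hx) hc'
      have m₁ := hR.transport_mem hcmp hWU (hR₀ hx₁) hc
      refine ⟨Ne.symm heq, ⟨_, m.2.1, _, m'.2.1, hconst c hcX x hx x₀ hx₀, rfl,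
        ((hR.copy x (hR₀ hx)).adj c hc c' hc').2 hadj⟩,
        _, m₁.2.1, _, m'.2.1, hconst c hcX x₁ hx₁ x₀ hx₀, rfl, ?_, ?_⟩
      · intro h
        exact m₁.2.2.2 x (hR₀ hx) hne (h ▸ m'.1)
      · intro h
        rcases hcmp.sep x (hWU (hR.mem x (hR₀ hx)).1) (hR.mem x (hR₀ hx)).2.1 _ m'.1 _
          (hWU m₁.2.1) h.symm with h1 | h1
        · exact m₁.2.2.2 x (hR₀ hx) hne h1
        · exact m₁.2.2.1 h1
    obtain ⟨y, hy, hcard'⟩ := Finset.exists_le_card_fiber_of_mul_le_card_of_maps_to hmap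
      ⟨y₀, Finset.mem_insert_self _ _⟩ (n := 2 * (k + 1) ^ j) (by
        refine (Nat.mul_le_mul_right _ hTcard).trans (le_trans (le_of_eq ?_) hcard)
        ring)
    refine ih (insert c' X) ?_ ⟨c', Finset.mem_insert_self _ _⟩ ?_ _
      ((Finset.filter_subset _ _).trans hR₀) hcard' ?_
    · exact Finset.insert_subset (List.mem_toFinset.2 hc') hX
    · rw [Finset.sdiff_insert, Finset.card_erase_of_mem, hXj, Nat.add_sub_cancel]
      exact Finset.mem_sdiff.2 ⟨List.mem_toFinset.2 hc', hc'X⟩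
    · intro d hd x hx x' hx'
      rw [Finset.mem_filter] at hx hx'
      rcases Finset.mem_insert.1 hd with rfl | hd
      · rw [hx.2, hx'.2]
      · exact hconst d hd x hx.1 x' hx'.1

/-- If a component outside the kernel begins to distinguish vertices in the same part, then most of
its copies have their corresponding vertices in few parts, and so one of them was fully mixed just
before. -/
theorem exists_fullyMixed_of_split (hcmp : IsComponents G U S cmp) (hK : IsKernel G U S W) {r : V}
    (hr : r ∈ U) (hrW : r ∉ W) {R : Finset V} (hR : IsCopySet G S W cmp r R) {φ : V → V} {k : ℕ}
    {e : V × V} (hb : RedBound G W k φ) (hb' : RedBound G W k fun x => relabel e (φ x))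
    (hcard : (k + 2) * (2 * (k + 1) ^ (cmp r).length) + 1 ≤ R.card) {z w w' : V} (hz : z ∈ cmp r)
    (hzW : z ∉ W) (hw : w ∈ W) (hw' : w' ∈ W) (hww' : relabel e (φ w) = relabel e (φ w'))
    (hwz : G.Adj w z) (hw'z : ¬ G.Adj w' z) :
    ∃ x ∈ R, AbsorbSetting.FullyMixed W (cmp x) φ := by
  classical
  have hrS : r ∉ S := fun h => hrW (hK.subS h)
  obtain ⟨hzU, hzS, hzc⟩ := hcmp.mem r hr hrS z hz
  have hwS : w ∈ S := by
    by_contra h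
    exact hzW (hK.sep w hw h z hzU hwz)
  set R' := R.filter fun x => w' ∉ cmp x with hR'
  have hR'card : (k + 2) * (2 * (k + 1) ^ (cmp r).length) ≤ R'.card := by
    have h1 : (R.filter fun x => ¬ w' ∉ cmp x).card ≤ 1 := by
      refine Finset.card_le_one.2 fun x hx x' hx' => ?_
      simp only [Finset.mem_filter, not_not] at hx hx'
      by_contra hne
      refine hR.ne x hx.1 x' hx'.1 hne ?_
      rw [← (hcmp.mem x (hK.sub (hR.mem x hx.1).1) (hR.mem x hx.1).2.1 _ hx.2).2.2,
        ← (hcmp.mem x' (hK.sub (hR.mem x' hx'.1).1) (hR.mem x' hx'.1).2.1 _ hx'.2).2.2]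
    have h2 := Finset.card_filter_add_card_filter_not (s := R) fun x => w' ∉ cmp x
    rw [← hR'] at h2
    omega
  set y₀ := relabel e (φ w) with hy₀
  set T : Finset V := insert e.2 (insert y₀ (finite_redAdj (G := G) (U := W)
    (φ := fun x => relabel e (φ x)) (x := y₀)).toFinset) with hT
  have hTcard : T.card ≤ k + 2 := by
    refine (Finset.card_insert_le _ _).trans (Nat.add_le_add_right ?_ 1)
    refine (Finset.card_insert_le _ _).trans (Nat.add_le_add_right ?_ 1)
    rw [← Set.ncard_eq_toFinset_card _ finite_redAdj]
    exact hb' y₀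
  have hmap : ∀ x ∈ R', φ (transport (cmp r) (cmp x) z) ∈ T := by
    intro x hx
    rw [hR', Finset.mem_filter] at hx
    have m := hR.transport_mem hcmp hK.sub hx.1 hz
    have hadjS := (hR.copy x hx.1).adjS z hz
    rw [hT, Finset.mem_insert, Finset.mem_insert, Set.Finite.mem_toFinset]
    by_cases h2 : φ (transport (cmp r) (cmp x) z) = e.2
    · exact .inl h2
    have h3 : relabel e (φ (transport (cmp r) (cmp x) z)) = φ (transport (cmp r) (cmp x) z) :=
      if_neg h2
    by_cases heq : φ (transport (cmp r) (cmp x) z) = y₀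
    · exact .inr (.inl heq)
    refine .inr (.inr ⟨Ne.symm heq, ⟨w, hw, _, m.2.1, rfl, h3, ((hadjS w hwS).2 hwz.symm).symm⟩,
      w', hw', _, m.2.1, hww'.symm, h3, ?_, ?_⟩)
    · rintro h4
      exact hx.2 (h4 ▸ m.1)
    · intro h4
      rcases hcmp.sep x (hK.sub (hR.mem x hx.1).1) (hR.mem x hx.1).2.1 _ m.1 _ (hK.sub hw')
        h4.symm with h5 | h5
      · exact hx.2 h5
      · exact hw'z ((hadjS w' h5).1 h4.symm).symm
  obtain ⟨y, hy, hcard'⟩ := Finset.exists_le_card_fiber_of_mul_le_card_of_maps_to hmap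
    ⟨e.2, Finset.mem_insert_self _ _⟩ (n := 2 * (k + 1) ^ (cmp r).length)
    ((Nat.mul_le_mul_right _ hTcard).trans hR'card)
  refine exists_fullyMixed_of_const hcmp hK.sub hr hrS hR hb _ {z}
    (Finset.singleton_subset_iff.2 (List.mem_toFinset.2 hz)) (Finset.singleton_nonempty z) rfl
    (R'.filter fun x => φ (transport (cmp r) (cmp x) z) = y)
    ((Finset.filter_subset _ _).trans (Finset.filter_subset _ _)) ?_ ?_
  · refine le_trans (Nat.mul_le_mul_left _ (Nat.pow_le_pow_right (by omega) ?_)) hcard'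
    exact (Finset.card_le_card Finset.sdiff_subset).trans (List.toFinset_card_le _)
  · intro c hc x hx x' hx'
    rw [Finset.mem_singleton] at hc
    subst hc
    rw [(Finset.mem_filter.1 hx).2, (Finset.mem_filter.1 hx').2]

end manyCopies

/-! ### The components computed by the algorithm -/

namespace Algorithm

/-- `g` is the adjacency matrix of the graph `G`, whose vertices are the numbers below `g.length`.
-/
structure IsMatrix (g : List (List Bool)) (G : SimpleGraph ℕ) : Prop where
  adj : ∀ i j, adj g i j = true ↔ G.Adj i j
  lt : ∀ i j, G.Adj i j → i < g.length

variable {g : List (List Bool)} {G : SimpleGraph ℕ} {S : List ℕ} {b : ℕ}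

@[simp] theorem mem_verts {v : ℕ} : v ∈ verts g ↔ v < g.length := List.mem_range

theorem mem_grow (hG : IsMatrix g G) {R : List ℕ} {x : ℕ} :
    x ∈ grow g S R ↔ x < g.length ∧ (x ∈ R ∨ x ∉ S ∧ ∃ y ∈ R, G.Adj y x) := by
  simp [grow, hG.adj]

/-- Adjacency after deletion of `S`. -/
def Joined (G : SimpleGraph ℕ) (S : List ℕ) (x y : ℕ) : Prop := x ∉ S ∧ y ∉ S ∧ G.Adj x y

theorem reaches_symm {x y : ℕ} (h : Relation.ReflTransGen (Joined G S) x y) :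
    Relation.ReflTransGen (Joined G S) y x := by
  induction h with
  | refl => exact .refl
  | tail _ h ih => exact .head ⟨h.2.1, h.1, h.2.2.symm⟩ ih

theorem not_mem_of_reaches {x y : ℕ} (h : Relation.ReflTransGen (Joined G S) x y) (hx : x ∉ S) :
    y ∉ S := by
  cases h with
  | refl => exact hx
  | tail _ h => exact h.2.1

theorem lt_of_reaches (hG : IsMatrix g G) {x y : ℕ} (h : Relation.ReflTransGen (Joined G S) x y)
    (hx : x < g.length) : y < g.length := by
  cases h with
  | refl => exact hx
  | tail _ h => exact hG.lt _ _ h.2.2.symm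

/-- Growing `[v]` stops at the component of `v` after at most as many rounds as there are
vertices. -/
theorem mem_component (hG : IsMatrix g G) {v : ℕ} (hv : v < g.length) (hvS : v ∉ S) {x : ℕ} :
    x ∈ component g S v ↔ Relation.ReflTransGen (Joined G S) v x := by
  have h1 : ∀ k, ∀ x ∈ (grow g S)^[k] [v], x < g.length ∧
      Relation.ReflTransGen (Joined G S) v x := by
    intro k
    induction k with
    | zero =>
      intro x hx
      rw [Function.iterate_zero, id, List.mem_singleton] at hx
      subst hx
      exact ⟨hv, .refl⟩
    | succ k ih =>
      intro x hx
      rw [Function.iterate_succ_apply', mem_grow hG] at hx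
      obtain ⟨hxg, hx | ⟨hxS, y, hy, hyx⟩⟩ := hx
      · exact ih x hx
      · have := (ih y hy).2
        exact ⟨hxg, this.tail ⟨not_mem_of_reaches this hvS, hxS, hyx⟩⟩
  have h2 : ∀ k, v ∈ (grow g S)^[k] [v] := by
    intro k
    induction k with
    | zero => simp
    | succ k ih =>
      rw [Function.iterate_succ_apply', mem_grow hG]
      exact ⟨hv, .inl ih⟩
  -- the iterates grow strictly until they are closed under `grow`
  have h3 : ∀ k, k + 1 ≤ ((grow g S)^[k] [v]).toFinset.card ∨
      ∀ x ∈ grow g S ((grow g S)^[k] [v]), x ∈ (grow g S)^[k] [v] := by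
    intro k
    induction k with
    | zero => simp
    | succ k ih =>
      by_cases hc : ∀ x ∈ grow g S ((grow g S)^[k] [v]), x ∈ (grow g S)^[k] [v]
      · right
        rw [Function.iterate_succ_apply']
        intro x hx
        rw [mem_grow hG] at hx ⊢
        refine ⟨hx.1, hx.2.imp (fun h => hc _ h) fun h => ⟨h.1, ?_⟩⟩
        obtain ⟨y, hy, h⟩ := h.2
        exact ⟨y, hc _ hy, h⟩
      · left
        have h4 := ih.resolve_right hc
        push Not at hc
        obtain ⟨x, hx, hx'⟩ := hc
        rw [Function.iterate_succ_apply']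
        refine Nat.succ_le_of_lt (lt_of_le_of_lt h4 (Finset.card_lt_card ?_))
        refine Finset.ssubset_iff_subset_ne.2 ⟨fun y hy => ?_, fun h5 => hx' ?_⟩
        · rw [List.mem_toFinset] at hy ⊢
          exact (mem_grow hG).2 ⟨(h1 k y hy).1, .inl hy⟩
        · rwa [← List.mem_toFinset, h5, List.mem_toFinset]
  have h4 : ∀ x ∈ grow g S (component g S v), x ∈ component g S v := by
    refine (h3 g.length).resolve_left fun h => ?_
    have h5 : ((grow g S)^[g.length] [v]).toFinset ⊆ Finset.range g.length := fun x hx =>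
      Finset.mem_range.2 (h1 _ x (List.mem_toFinset.1 hx)).1
    have := Finset.card_le_card h5
    rw [Finset.card_range] at this
    omega
  refine ⟨fun h => (h1 _ x h).2, fun h => ?_⟩
  induction h with
  | refl => exact h2 _
  | tail _ h ih => exact h4 _ ((mem_grow hG).2 ⟨hG.lt _ _ h.2.2.symm, .inr ⟨h.2.1, _, ih, h.2.2⟩⟩)

theorem component_eq_filter {v : ℕ} (hv : v < g.length) :
    component g S v = (verts g).filter fun x => decide (x ∈ component g S v) := by
  have h : ∃ p : ℕ → Bool, component g S v = (verts g).filter p := by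
    obtain ⟨m, hm⟩ := Nat.exists_eq_add_of_lt hv
    rw [component, hm, Function.iterate_succ_apply']
    exact ⟨_, rfl⟩
  obtain ⟨p, hp⟩ := h
  conv_lhs => rw [hp]
  refine List.filter_congr fun x hx => ?_
  rw [hp, Bool.eq_iff_iff, decide_eq_true_iff, List.mem_filter]
  exact ⟨fun h => ⟨hx, h⟩, fun h => h.2⟩

theorem component_eq_of_mem (hG : IsMatrix g G) {v x : ℕ} (hv : v < g.length) (hvS : v ∉ S)
    (hx : x ∈ component g S v) : component g S x = component g S v := by
  have h1 := (mem_component hG hv hvS).1 hx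
  have hx' := lt_of_reaches hG h1 hv
  rw [component_eq_filter hx', component_eq_filter hv]
  refine List.filter_congr fun y _ => ?_
  rw [decide_eq_decide, mem_component hG hx' (not_mem_of_reaches h1 hvS), mem_component hG hv hvS]
  exact ⟨fun h => h1.trans h, fun h => (reaches_symm h1).trans h⟩

theorem isComponents (hG : IsMatrix g G) :
    IsComponents G (Finset.range g.length) S.toFinset (component g S) where
  self v hv hvS := by
    rw [Finset.mem_range] at hv
    rw [List.mem_toFinset] at hvS
    exact (mem_component hG hv hvS).2 .refl
  mem v hv hvS x hx := by
    rw [Finset.mem_range] at hv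
    rw [List.mem_toFinset] at hvS
    have h1 := (mem_component hG hv hvS).1 hx
    exact ⟨Finset.mem_range.2 (lt_of_reaches hG h1 hv),
      fun h => not_mem_of_reaches h1 hvS (List.mem_toFinset.1 h), component_eq_of_mem hG hv hvS hx⟩
  sep v hv hvS x hx y _ hxy := by
    rw [Finset.mem_range] at hv
    rw [List.mem_toFinset] at hvS ⊢
    by_cases hyS : y ∈ S
    · exact .inr hyS
    have h1 := (mem_component hG hv hvS).1 hx
    exact .inl ((mem_component hG hv hvS).2 (h1.tail ⟨not_mem_of_reaches h1 hvS, hyS, hxy⟩))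
  nodup v hv _ := by
    rw [component_eq_filter (Finset.mem_range.1 hv)]
    exact List.nodup_range.filter _
  conn v hv hvS X hX hstep y hy := by
    rw [Finset.mem_range] at hv
    rw [List.mem_toFinset] at hvS
    rw [mem_component hG hv hvS] at hy
    induction hy with
    | refl => exact hX
    | tail h1 h2 ih =>
      exact hstep _ ((mem_component hG hv hvS).2 h1) ih _
        ((mem_component hG hv hvS).2 (h1.tail h2)) h2.2.2

theorem similar_iff (hG : IsMatrix g G) {C D : List ℕ} :
    similar g S C D = true ↔ SimilarLists G S.toFinset C D := by
  have hadj (a b c d : ℕ) : (adj g a b == adj g c d) = true ↔ (G.Adj a b ↔ G.Adj c d) := by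
    rw [beq_iff_eq, Bool.eq_iff_iff, hG.adj, hG.adj]
  simp only [similar, SimilarLists, Bool.and_eq_true, beq_iff_eq (α := ℕ), List.all_eq_true,
    List.mem_range, hadj, List.mem_toFinset]
  refine and_congr_right fun hlen => ⟨fun h i hi hi' => ⟨fun j hj hj' => ?_, fun s hs => ?_⟩,
    fun h i hi => ⟨fun j hj => ?_, fun s hs => ?_⟩⟩
  · have := (h i hi).1 j hj
    rwa [List.getD_eq_getElem _ _ hi, List.getD_eq_getElem _ _ hj, List.getD_eq_getElem _ _ hi',
      List.getD_eq_getElem _ _ hj'] at this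
  · have := (h i hi).2 s hs
    rwa [List.getD_eq_getElem _ _ hi, List.getD_eq_getElem _ _ hi'] at this
  · rw [List.getD_eq_getElem _ _ hi, List.getD_eq_getElem _ _ hj,
      List.getD_eq_getElem _ _ (hlen ▸ hi), List.getD_eq_getElem _ _ (hlen ▸ hj)]
    exact (h i hi (hlen ▸ hi)).1 j hj (hlen ▸ hj)
  · rw [List.getD_eq_getElem _ _ hi, List.getD_eq_getElem _ _ (hlen ▸ hi)]
    exact (h i hi (hlen ▸ hi)).2 s hs

theorem isRoot_iff {r : ℕ} : isRoot g S r = true ↔ r ∉ S ∧ ∀ x ∈ component g S r, r ≤ x := by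
  simp [isRoot]

theorem exists_root (hG : IsMatrix g G) {v : ℕ} (hv : v < g.length) (hvS : v ∉ S) :
    ∃ r < g.length, isRoot g S r = true ∧ r ∈ component g S v ∧
      component g S r = component g S v := by
  have hc := isComponents (S := S) hG
  have hvS' : v ∉ S.toFinset := by rwa [List.mem_toFinset]
  have hv' := Finset.mem_range.2 hv
  obtain ⟨r, hr, hmin⟩ := Finset.exists_min_image (component g S v).toFinset id
    ⟨v, List.mem_toFinset.2 (hc.self v hv' hvS')⟩
  rw [List.mem_toFinset] at hr
  obtain ⟨h1, h2, h3⟩ := hc.mem v hv' hvS' r hr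
  refine ⟨r, Finset.mem_range.1 h1, isRoot_iff.2 ⟨fun h => h2 (List.mem_toFinset.2 h), ?_⟩, hr, h3⟩
  rw [h3]
  exact fun x hx => hmin x (List.mem_toFinset.2 hx)

theorem root_unique (hG : IsMatrix g G) {r r' : ℕ} (hr : r < g.length) (hr' : r' < g.length)
    (h : isRoot g S r = true) (h' : isRoot g S r' = true)
    (heq : component g S r = component g S r') : r = r' := by
  have hc := isComponents (S := S) hG
  rw [isRoot_iff] at h h'
  have h1 := hc.self r (Finset.mem_range.2 hr) (by simpa using h.1)
  have h2 := hc.self r' (Finset.mem_range.2 hr') (by simpa using h'.1)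
  exact le_antisymm (h.2 r' (heq ▸ h2)) (h'.2 r (heq ▸ h1))

/-! ### The kernel -/

/-- The first vertices of the components before that of `C` that are similar to it. -/
def earlier (g : List (List Bool)) (S C : List ℕ) : Finset ℕ :=
  (Finset.range g.length).filter fun r => isRoot g S r = true ∧
    similar g S C (component g S r) = true ∧ ∀ x ∈ C, r < x

theorem rank_eq {C : List ℕ} : rank g S C = (earlier g S C).card := by
  rw [rank, verts, ← List.toFinset_card_of_nodup (List.nodup_range.filter _)]
  congr 1
  ext r
  simp [earlier, and_assoc]

theorem mem_kernel {v : ℕ} : v ∈ kernel g S b ↔ v < g.length ∧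
    (v ∈ S ∨ rank g S (component g S v) < b) := by
  simp [kernel]

theorem nodup_kernel : (kernel g S b).Nodup := List.nodup_range.filter _

theorem kernel_component (hG : IsMatrix g G) {v x : ℕ} (hv : v ∈ kernel g S b) (hvS : v ∉ S)
    (hx : x ∈ component g S v) : x ∈ kernel g S b := by
  rw [mem_kernel] at hv
  obtain ⟨h1, -, h3⟩ := (isComponents (S := S) hG).mem v (Finset.mem_range.2 hv.1)
    (by simpa using hvS) x hx
  rw [mem_kernel, h3]
  exact ⟨Finset.mem_range.1 h1, .inr (hv.2.resolve_left hvS)⟩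

theorem isKernel (hG : IsMatrix g G) (hS : ∀ s ∈ S, s < g.length) :
    IsKernel G (Finset.range g.length) S.toFinset (kernel g S b).toFinset where
  subS s hs := by
    rw [List.mem_toFinset] at hs ⊢
    exact mem_kernel.2 ⟨hS s hs, .inl hs⟩
  sub v hv := by
    rw [List.mem_toFinset] at hv
    exact Finset.mem_range.2 (mem_kernel.1 hv).1
  sep w hw hwS y hy hwy := by
    have hc := isComponents (S := S) hG
    rw [List.mem_toFinset] at hw ⊢
    have hw' := Finset.mem_range.2 (mem_kernel.1 hw).1
    rcases hc.sep w hw' hwS w (hc.self w hw' hwS) y hy hwy with h | h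
    · exact kernel_component hG hw (by simpa using hwS) h
    · rw [List.mem_toFinset] at h
      exact mem_kernel.2 ⟨hS y h, .inl h⟩

/-- If a component is deleted, then `b` components similar to it are kept: the least one of those
before it that are not kept would have rank less than `b`, if they were fewer. -/
theorem exists_isCopySet (hG : IsMatrix g G) {r : ℕ} (hr : r < g.length) (hrS : r ∉ S)
    (hrW : r ∉ kernel g S b) : ∃ R : Finset ℕ, b ≤ R.card ∧
      (∀ x ∈ R, isRoot g S x = true ∧
        SimilarLists G S.toFinset (component g S r) (component g S x)) ∧
      IsCopySet G S.toFinset (kernel g S b).toFinset (component g S) r R := by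
  have hc := isComponents (S := S) hG
  have hrk : b ≤ (earlier g S (component g S r)).card := by
    by_contra h
    exact hrW (mem_kernel.2 ⟨hr, .inr (by rw [rank_eq]; omega)⟩)
  set T := earlier g S (component g S r) with hT
  have hmemT : ∀ x ∈ T, x < g.length ∧ isRoot g S x = true ∧
      SimilarLists G S.toFinset (component g S r) (component g S x) ∧
        ∀ y ∈ component g S r, x < y := by
    intro x hx
    rw [hT, earlier, Finset.mem_filter, Finset.mem_range, similar_iff hG] at hx
    exact hx
  refine ⟨T.filter (· ∈ kernel g S b), ?_, ?_, ?_, ?_, ?_⟩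
  · by_contra! hlt
    obtain ⟨z, hz⟩ : (T.filter (· ∉ kernel g S b)).Nonempty := by
      rw [← Finset.card_pos]
      have := Finset.card_filter_add_card_filter_not (s := T) (· ∈ kernel g S b)
      omega
    -- all components similar to and before the least one that is not kept are kept
    obtain ⟨m, hm, hmin⟩ := Finset.exists_min_image _ id ⟨z, hz⟩
    rw [Finset.mem_filter] at hm
    obtain ⟨h1, h2, h3, h4⟩ := hmemT m hm.1
    refine hm.2 (mem_kernel.2 ⟨h1, .inr (lt_of_le_of_lt ?_ hlt)⟩)
    rw [rank_eq]
    refine Finset.card_le_card fun x hx => ?_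
    rw [earlier, Finset.mem_filter, Finset.mem_range, similar_iff hG] at hx
    obtain ⟨h5, h6, h7, h8⟩ := hx
    have hxm : x < m := h8 m (hc.self m (Finset.mem_range.2 h1)
      (by simpa using (isRoot_iff.1 h2).1))
    have hxT : x ∈ T := by
      rw [hT, earlier, Finset.mem_filter, Finset.mem_range, similar_iff hG]
      exact ⟨h5, h6, h3.trans h7, fun y hy => hxm.trans (h4 y hy)⟩
    refine Finset.mem_filter.2 ⟨hxT, ?_⟩
    by_contra h9
    have := hmin x (Finset.mem_filter.2 ⟨hxT, h9⟩)
    exact absurd hxm (not_lt.2 this)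
  · intro x hx
    have := hmemT x (Finset.mem_filter.1 hx).1
    exact ⟨this.2.1, this.2.2.1⟩
  · intro x hx
    rw [Finset.mem_filter] at hx
    have h1 := (isRoot_iff.1 (hmemT x hx.1).2.1).1
    refine ⟨List.mem_toFinset.2 hx.2, by simpa using h1, fun y hy => ?_⟩
    exact List.mem_toFinset.2 (kernel_component hG hx.2 h1 hy)
  · intro x hx
    obtain ⟨h1, h2, h3, -⟩ := hmemT x (Finset.mem_filter.1 hx).1
    exact h3.isCopy (hc.nodup r (Finset.mem_range.2 hr) (by simpa using hrS))
      (hc.nodup x (Finset.mem_range.2 h1) (by simpa using (isRoot_iff.1 h2).1))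
  · intro x hx x' hx' hne heq
    have h1 := hmemT x (Finset.mem_filter.1 hx).1
    have h2 := hmemT x' (Finset.mem_filter.1 hx').1
    exact hne (root_unique hG h1.1 h2.1 h1.2.1 h2.2.1 heq)

/-- The number of classes of similar components of at most `q` vertices. -/
def numClasses (s q : ℕ) : ℕ := (q + 1) * (2 ^ (q * q) * 2 ^ (q * s))

/-- The number of kept vertices is bounded in terms of `S`, the sizes of the components and `b`.
-/
theorem card_kernel_le (hG : IsMatrix g G) {q : ℕ}
    (hq : ∀ v < g.length, v ∉ S → (component g S v).length ≤ q) :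
    (kernel g S b).length ≤ S.length + b * numClasses S.length q * q := by
  classical
  have hc := isComponents (S := S) hG
  -- the code of a component determines its class
  let code (r : ℕ) : Fin (q + 1) × (Fin q × Fin q → Bool) × (Fin q × Fin S.length → Bool) :=
    (Fin.ofNat (q + 1) (component g S r).length,
      fun i => adj g ((component g S r).getD i.1 0) ((component g S r).getD i.2 0),
      fun i => adj g ((component g S r).getD i.1 0) S[i.2])
  have hcode : ∀ r < g.length, r ∉ S → ∀ r' < g.length, r' ∉ S → code r = code r' →
      SimilarLists G S.toFinset (component g S r) (component g S r') := by
    intro r hr hrS r' hr' hrS' h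
    have h1 : (component g S r).length = (component g S r').length := by
      have := congrArg (fun c => (c.1 : ℕ)) h
      simpa [code, Nat.mod_eq_of_lt (Nat.lt_succ_of_le (hq r hr hrS)),
        Nat.mod_eq_of_lt (Nat.lt_succ_of_le (hq r' hr' hrS'))] using this
    have hlt := hq r hr hrS
    rw [← similar_iff hG]
    simp only [similar, Bool.and_eq_true, beq_iff_eq, List.all_eq_true, List.mem_range]
    refine ⟨h1, fun i hi => ⟨fun j hj => ?_, fun s hs => ?_⟩⟩
    · exact congrFun (congrArg (fun c => c.2.1) h) (⟨i, by omega⟩, ⟨j, by omega⟩)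
    · obtain ⟨k, hk, rfl⟩ := List.mem_iff_getElem.1 hs
      exact congrFun (congrArg (fun c => c.2.2) h) (⟨i, by omega⟩, ⟨k, hk⟩)
  set K := (Finset.range g.length).filter fun r => isRoot g S r = true ∧ r ∈ kernel g S b with hK
  have hmemK : ∀ r ∈ K, r < g.length ∧ isRoot g S r = true ∧ r ∈ kernel g S b := by
    intro r hr
    rwa [hK, Finset.mem_filter, Finset.mem_range] at hr
  have hKcard : K.card ≤ b * numClasses S.length q := by
    refine (Finset.card_le_mul_card_image (f := code) K b ?_).trans (Nat.mul_le_mul_left _ ?_)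
    · intro c hc'
      -- the last of more than `b` kept components of one class would have the others before it
      by_contra! hlt
      obtain ⟨m, hm, hmax⟩ := Finset.exists_max_image (K.filter fun r => code r = c) id
        (Finset.card_pos.1 (by omega))
      rw [Finset.mem_filter] at hm
      obtain ⟨h1, h2, h3⟩ := hmemK m hm.1
      have hmS := (isRoot_iff.1 h2).1
      have h4 := ((mem_kernel.1 h3).2.resolve_left hmS)
      rw [rank_eq] at h4
      have h5 : (K.filter fun r => code r = c).erase m ⊆ earlier g S (component g S m) := by
        intro r hr
        rw [Finset.mem_erase, Finset.mem_filter] at hr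
        obtain ⟨h6, h7, h8⟩ := hmemK r hr.2.1
        rw [earlier, Finset.mem_filter, Finset.mem_range, similar_iff hG]
        refine ⟨h6, h7, hcode m h1 hmS r h6 (isRoot_iff.1 h7).1 (hm.2.trans hr.2.2.symm),
          fun x hx => lt_of_lt_of_le (lt_of_le_of_ne ?_ hr.1) ((isRoot_iff.1 h2).2 x hx)⟩
        exact hmax r (Finset.mem_filter.2 hr.2)
      have h6 := Finset.card_le_card h5
      rw [Finset.card_erase_of_mem (Finset.mem_filter.2 hm)] at h6
      omega
    · refine (Finset.card_le_univ _).trans (le_of_eq ?_)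
      simp [numClasses, Fintype.card_prod, Fintype.card_fin]
  rw [← List.toFinset_card_of_nodup nodup_kernel]
  have hsub : (kernel g S b).toFinset ⊆
      S.toFinset ∪ K.biUnion fun r => (component g S r).toFinset := by
    intro v hv
    rw [List.mem_toFinset] at hv
    rw [Finset.mem_union, Finset.mem_biUnion, List.mem_toFinset]
    by_cases hvS : v ∈ S
    · exact .inl hvS
    right
    have hv' := (mem_kernel.1 hv).1
    obtain ⟨r, h1, h2, h3, h4⟩ := exists_root hG hv' hvS
    refine ⟨r, ?_, List.mem_toFinset.2 ?_⟩
    · rw [hK, Finset.mem_filter, Finset.mem_range]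
      exact ⟨h1, h2, kernel_component hG hv hvS h3⟩
    · rw [h4]
      exact hc.self v (Finset.mem_range.2 hv') (by simpa using hvS)
  refine (Finset.card_le_card hsub).trans ((Finset.card_union_le _ _).trans ?_)
  refine Nat.add_le_add (List.toFinset_card_le _) ?_
  refine (Finset.card_biUnion_le_card_mul _ _ q fun r hr => ?_).trans
    (Nat.mul_le_mul_right _ hKcard)
  obtain ⟨h1, h2, -⟩ := hmemK r hr
  exact (List.toFinset_card_le _).trans (hq r h1 (isRoot_iff.1 h2).1)

theorem mem_extras (hG : IsMatrix g G) {W : List ℕ} {h r : ℕ} : r ∈ extras g S W h ↔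
    r < g.length ∧ r ∉ W ∧ isRoot g S r = true ∧
      SimilarLists G S.toFinset (component g S h) (component g S r) := by
  simp [extras, similar_iff hG, and_assoc]

theorem nodup_extras {W : List ℕ} {h : ℕ} : (extras g S W h).Nodup := List.nodup_range.filter _

/-! ### The contractions for a list of tokens -/

@[simp] theorem plain_append (E F : List (ℕ × ℕ)) : plain (E ++ F) = plain E ++ plain F :=
  List.filter_append ..

theorem plain_self (h : ℕ) : plain [(h, h)] = [] := by simp [plain]

theorem plain_of_ne {e : ℕ × ℕ} (h : e.1 ≠ e.2) : plain [e] = [e] := by simp [plain, h]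

theorem expand_append {W : List ℕ} (E : List (ℕ × ℕ)) (e : ℕ × ℕ) :
    expand g S W (E ++ [e]) = expand g S W E ++ expandToken g S W (plain E) e := by
  rw [expand, expand, List.length_append, List.length_singleton, List.range_succ,
    List.flatMap_append]
  congr 1
  · rw [List.flatMap_def, List.flatMap_def]
    congr 1
    refine List.map_congr_left fun i hi => ?_
    rw [List.mem_range] at hi
    rw [List.getElem?_append_left hi, List.take_append_of_le_length hi.le]
  · simp

theorem expandToken_self {W : List ℕ} {L : List (ℕ × ℕ)} {h : ℕ} :
    expandToken g S W L (h, h) =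
      (extras g S W h).flatMap fun r => absorb (component g S h) (component g S r) L := by
  simp [expandToken]

theorem expandToken_of_ne {W : List ℕ} {L : List (ℕ × ℕ)} {e : ℕ × ℕ} (h : e.1 ≠ e.2) :
    expandToken g S W L e = [e] := by
  rw [expandToken, beq_eq_false_iff_ne.2 h, cond_false]

/-! ### Checking contraction sequences -/

theorem mem_dedup (l : List ℕ) : (dedup l).Nodup ∧ ∀ x, x ∈ dedup l ↔ x ∈ l := by
  have h : ∀ l acc : List ℕ, acc.Nodup →
      (l.foldl (fun acc x => bif acc.contains x then acc else x :: acc) acc).Nodup ∧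
      ∀ x, x ∈ l.foldl (fun acc x => bif acc.contains x then acc else x :: acc) acc ↔
        x ∈ l ∨ x ∈ acc := by
    intro l
    induction l with
    | nil => simp
    | cons a l ih =>
      intro acc hacc
      rw [List.foldl_cons]
      by_cases ha : a ∈ acc
      · have : acc.contains a = true := by simpa using ha
        rw [this, cond_true]
        refine ⟨(ih acc hacc).1, fun x => ?_⟩
        rw [(ih acc hacc).2, List.mem_cons]
        constructor
        · tauto
        · rintro ((rfl | h) | h) <;> tauto
      · have : acc.contains a = false := by simpa using ha
        rw [this, cond_false]
        refine ⟨(ih _ (List.nodup_cons.2 ⟨ha, hacc⟩)).1, fun x => ?_⟩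
        rw [(ih _ (List.nodup_cons.2 ⟨ha, hacc⟩)).2, List.mem_cons, List.mem_cons]
        tauto
  have := h l [] List.nodup_nil
  exact ⟨this.1, fun x => by rw [dedup, this.2]; simp⟩

theorem red_iff (hG : IsMatrix g G) {U : List ℕ} {L : List (ℕ × ℕ)} {x y : ℕ} :
    red g U L x y = true ↔ RedAdj G U.toFinset (label L) x y := by
  simp only [red, RedAdj, HasPair, Bool.and_eq_true, Bool.not_eq_true',
    List.any_eq_true, beq_iff_eq, List.mem_toFinset, hG.adj, and_assoc, SimpleGraph.compl_adj,
    ← Bool.not_eq_true]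
  refine and_congr_right fun hxy => and_congr_right fun _ => ?_
  refine exists_congr fun a => and_congr_right fun _ => exists_congr fun b =>
    and_congr_right fun _ => and_congr_right fun h1 => and_congr_right fun h2 => ?_
  refine ⟨fun h => ⟨?_, h⟩, fun h => h.2⟩
  rintro rfl
  exact hxy (h1.symm.trans h2)

theorem bounded_iff (hG : IsMatrix g G) {U : List ℕ} {w : ℕ} {L : List (ℕ × ℕ)} :
    bounded g U w L = true ↔ RedBound G U.toFinset w (label L) := by
  have hset (x : ℕ) : {y | RedAdj G U.toFinset (label L) x y}.ncard =
      ((dedup (U.map fun b => label L b)).filter fun y => red g U L x y).length := by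
    rw [← List.toFinset_card_of_nodup ((mem_dedup _).1.filter _), ← Set.ncard_coe_finset]
    congr 1
    ext y
    simp only [Set.mem_ofPred_eq, List.coe_toFinset, List.mem_filter, (mem_dedup _).2, red_iff hG]
    refine ⟨fun h => ⟨?_, h⟩, fun h => h.2⟩
    simpa using h.mem_right
  simp only [bounded, List.all_eq_true, decide_eq_true_iff, ← hset]
  refine ⟨fun h x => ?_, fun h a _ => h _⟩
  rcases Set.eq_empty_or_nonempty {y | RedAdj G U.toFinset (label L) x y} with he | ⟨y, hy⟩
  · simp [he]
  · obtain ⟨a, ha, rfl⟩ := Finset.mem_image.1 hy.symm.mem_right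
    exact h a (List.mem_toFinset.1 ha)

theorem check_iff (hG : IsMatrix g G) {U : List ℕ} {w : ℕ} {L : List (ℕ × ℕ)} :
    check g U w L = true ↔ IsSeq G U.toFinset w L := by
  -- `check` looks at initial segments, `Steps` recurses at the front
  have hsteps : ∀ L : List (ℕ × ℕ), Steps U.toFinset (RedBound G U.toFinset w) id L ↔
      ∀ i < L.length + 1, RedBound G U.toFinset w (label (L.take i)) ∧ ∀ e ∈ L[i]?,
        (∃ a ∈ U, label (L.take i) a = e.1) ∧ (∃ a ∈ U, label (L.take i) a = e.2) ∧ e.1 ≠ e.2 := by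
    intro L
    induction L using List.reverseRecOn with
    | nil => simp [Steps]; rfl
    | append_singleton L e ih =>
      rw [steps_append, ih]
      have hlen : (L ++ [e]).length + 1 = L.length + 1 + 1 := by simp
      rw [hlen]
      constructor
      · rintro ⟨h1, h2⟩ i hi
        rcases Nat.lt_succ_iff_lt_or_eq.1 hi with hi | rfl
        · rcases Nat.lt_succ_iff_lt_or_eq.1 hi with hi' | rfl
          · rw [List.take_append_of_le_length hi'.le, List.getElem?_append_left hi']
            exact h1 i hi
          · refine ⟨?_, ?_⟩
            · rw [List.take_left]
              exact h2.1
            · simp only [List.getElem?_concat_length, Option.mem_some_iff, List.take_left]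
              rintro _ rfl
              have h3 := h2.2.1
              have h4 := h2.2.2.1
              simp only [Finset.mem_image, List.mem_toFinset, id] at h3 h4
              exact ⟨h3, h4, h2.2.2.2.1⟩
        · have h3 := h2.last
          refine ⟨?_, ?_⟩
          · rw [List.take_of_length_le (by simp)]
            exact RedBound.congr (fun a _ => (label_append L [e] a).symm) h3
          · rw [List.getElem?_eq_none (by simp)]
            simp
      · intro h
        have h1 := h L.length (by omega)
        rw [List.take_left, List.getElem?_concat_length] at h1
        have h2 := h (L.length + 1) (by omega)
        rw [List.take_of_length_le (by simp)] at h2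
        refine ⟨fun i hi => ?_, h1.1, ?_, ?_, (h1.2 e rfl).2.2, ?_⟩
        · rcases Nat.lt_succ_iff_lt_or_eq.1 hi with hi' | rfl
          · have := h i (by omega)
            rwa [List.take_append_of_le_length hi'.le, List.getElem?_append_left hi'] at this
          · refine ⟨by simpa using h1.1, ?_⟩
            rw [List.getElem?_eq_none le_rfl]
            simp
        · simpa using (h1.2 e rfl).1
        · simpa using (h1.2 e rfl).2.1
        · refine RedBound.congr (fun a _ => ?_) h2.1
          rw [label_append]
          rfl
  rw [IsSeq, hsteps, check, Bool.and_eq_true]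
  refine and_congr ?_ ?_
  · simp only [List.all_eq_true, List.mem_range, Bool.and_eq_true, bounded_iff hG,
      Option.mem_toList, List.any_eq_true, beq_iff_eq, Bool.not_eq_true', beq_eq_false_iff_ne,
      Option.mem_def, ne_eq]
  · simp only [List.any_eq_true, List.all_eq_true, beq_iff_eq]
    rw [Finset.card_eq_one]
    constructor
    · rintro ⟨a, ha, h⟩
      refine ⟨label L a, ?_⟩
      ext y
      simp only [Finset.mem_image, List.mem_toFinset, Finset.mem_singleton]
      exact ⟨by rintro ⟨b, hb, rfl⟩; exact h b hb, by rintro rfl; exact ⟨a, ha, rfl⟩⟩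
    · rintro ⟨y, hy⟩
      have h1 : ∀ b ∈ U, label L b = y := fun b hb => by
        have := Finset.mem_image_of_mem (label L) (List.mem_toFinset.2 hb)
        rwa [hy, Finset.mem_singleton] at this
      obtain ⟨a, ha, -⟩ := Finset.mem_image.1 (hy ▸ Finset.mem_singleton_self y)
      exact ⟨a, List.mem_toFinset.1 ha, fun b hb =>
        (h1 b hb).trans (h1 a (List.mem_toFinset.1 ha)).symm⟩

end Algorithm

/-! ### Extending a contraction sequence of the kernel -/

namespace Algorithm

variable {g : List (List Bool)} {G : SimpleGraph ℕ} {S : List ℕ} {b q : ℕ}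

/-- A separated set that avoids `S` contains a component or is disjoint from it. -/
theorem not_mem_of_root (hG : IsMatrix g G) {A : Finset ℕ}
    (hsep : IsSeparated G (Finset.range g.length) S.toFinset (· ∈ A)) {r : ℕ} (hr : r < g.length)
    (hrS : r ∉ S) (hrA : r ∉ A) : ∀ d ∈ component g S r, d ∉ A := by
  intro d hd hdA
  have hc := isComponents (S := S) hG
  have hrS' : r ∉ S.toFinset := by simpa using hrS
  obtain ⟨h1, h2, h3⟩ := hc.mem r (Finset.mem_range.2 hr) hrS' d hd
  refine hrA (hc.conn d h1 h2 (· ∈ A) hdA (fun x _ hxA y hy hxy => ?_) r ?_)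
  · have hy' := hc.mem d h1 h2 y hy
    exact (hsep x hxA y hy'.1 hxy).resolve_right hy'.2.1
  · rw [h3]
    exact hc.self r (Finset.mem_range.2 hr) hrS'

theorem component_disjoint (hG : IsMatrix g G) {r r' : ℕ} (hr : r < g.length) (hr' : r' < g.length)
    (h : isRoot g S r = true) (h' : isRoot g S r' = true) (hne : r ≠ r') :
    ∀ d ∈ component g S r', d ∉ component g S r := by
  intro d hd hd'
  refine hne (root_unique hG hr hr' h h' ?_)
  rw [← component_eq_of_mem hG hr' (isRoot_iff.1 h').1 hd,
    ← component_eq_of_mem hG hr (isRoot_iff.1 h).1 hd']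

theorem absorbSetting (hG : IsMatrix g G) (hS : ∀ s ∈ S, s < g.length) {x r : ℕ}
    (hx : x ∈ kernel g S b) (hxS : x ∉ S) (hr : r < g.length) (hrW : r ∉ kernel g S b)
    (hsim : SimilarLists G S.toFinset (component g S x) (component g S r)) :
    AbsorbSetting G (Finset.range g.length) S.toFinset (kernel g S b).toFinset (component g S x)
      (component g S r) (transport (component g S x) (component g S r)) := by
  have hc := isComponents (S := S) hG
  have hrS : r ∉ S := fun h => hrW (mem_kernel.2 ⟨hr, .inl h⟩)
  have hx' := Finset.mem_range.2 (mem_kernel.1 hx).1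
  have hxS' : x ∉ S.toFinset := by simpa using hxS
  have hr' := Finset.mem_range.2 hr
  have hrS' : r ∉ S.toFinset := by simpa using hrS
  refine { hsim.isCopy (hc.nodup x hx' hxS') (hc.nodup r hr' hrS'), isKernel hG hS with
    host := fun c hc' => ⟨List.mem_toFinset.2 (kernel_component hG hx hxS hc'),
      (hc.mem x hx' hxS' c hc').2.1⟩
    hostSep := hc.sep x hx' hxS'
    extra := fun d hd => ?_
    extraSep := hc.sep r hr' hrS' }
  obtain ⟨h1, h2, h3⟩ := hc.mem r hr' hrS' d hd
  refine ⟨h1, fun h4 => hrW ?_⟩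
  rw [List.mem_toFinset] at h4
  refine kernel_component hG h4 (by simpa using h2) ?_
  rw [h3]
  exact hc.self r hr' hrS'

theorem absorbState_empty :
    AbsorbState G (Finset.range g.length) S.toFinset (kernel g S b).toFinset ∅ (label []) (label [])
    where
  onW _ _ := rfl
  nameW _ h := h
  sub a ha := by simp at ha
  host a ha := by simp at ha
  rest _ _ _ _ := rfl
  sep a ha := by simp at ha

theorem unsplit_nil {W : Finset ℕ} {D : ℕ → Prop} : Unsplit G W (label []) D := by
  rintro d - w - w' - (rfl : w = w')
  rfl

/-- The twin-width is bounded in terms of the size of the kernel: at the beginning, no part contains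
vertices with different neighbours outside the kernel, so all components outside can be absorbed. -/
theorem exists_isSeq_kernel (hG : IsMatrix g G) (hS : ∀ s ∈ S, s < g.length)
    (hq : ∀ v < g.length, v ∉ S → (component g S v).length ≤ q) (hb : 0 < b) (hn : 0 < g.length) :
    ∃ L, IsSeq G (Finset.range g.length) ((kernel g S b).length + q) L := by
  have hc := isComponents (S := S) hG
  set U := Finset.range g.length with hU
  set W := (kernel g S b).toFinset with hW
  have hWcard : W.card ≤ (kernel g S b).length := List.toFinset_card_le _
  set l := (verts g).filter fun r => !(kernel g S b).contains r && isRoot g S r with hl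
  have hmem : ∀ r, r ∈ l ↔ r < g.length ∧ r ∉ kernel g S b ∧ isRoot g S r = true := by
    intro r
    simp [hl]
  have hhost : ∀ r, ∃ x, r ∈ l → x ∈ kernel g S b ∧ x ∉ S ∧
      SimilarLists G S.toFinset (component g S x) (component g S r) := by
    intro r
    by_cases hr : r ∈ l
    · obtain ⟨h1, h2, h3⟩ := (hmem r).1 hr
      obtain ⟨R, h4, h5, h6⟩ := exists_isCopySet hG h1 (isRoot_iff.1 h3).1 h2
      obtain ⟨x, hx⟩ := Finset.card_pos.1 (hb.trans_le h4)
      refine ⟨x, fun _ => ⟨by simpa using (h6.mem x hx).1, by simpa using (h6.mem x hx).2.1,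
        (h5 x hx).2.symm⟩⟩
    · exact ⟨0, fun h => absurd h hr⟩
  choose host hhost using hhost
  have hname : ∀ {A Φ}, AbsorbState G U S.toFinset W A (label []) Φ → ∀ v ∈ W ∪ A, Φ v ∈ W :=
    fun st v hv => AbsorbSetting.name_mem st hv
  obtain ⟨h1, h2⟩ := steps_flatMap (U := U) (B := RedBound G U ((kernel g S b).length + q))
    (Inv := fun A Φ => AbsorbState G U S.toFinset W A (label []) Φ) (cmp := component g S)
    (M := fun r => absorb (component g S (host r)) (component g S r) []) (fun A Φ st => by
      refine redBound_of_subset (fun _ _ h => redAdj_of_unsplit (isKernel hG hS) st.nameW st.sub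
        st.sep st.onW (fun a ha => .inr (st.host a ha)) st.rest unsplit_nil h) (redBound_card ?_)
      refine (Finset.card_le_card (t := W) ?_).trans (hWcard.trans (Nat.le_add_right _ _))
      exact Finset.image_subset_iff.2 (hname st)) l ∅ (label []) (absorbState_empty)
    ((List.nodup_range.filter _).imp_of_mem fun hr hr' hne =>
      component_disjoint hG ((hmem _).1 hr).1 ((hmem _).1 hr').1 ((hmem _).1 hr).2.2
        ((hmem _).1 hr').2.2 hne) (by simp) (by
      intro r hr A Φ st hdA
      obtain ⟨h1, h2, h3⟩ := (hmem r).1 hr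
      obtain ⟨h4, h5, h6⟩ := hhost r hr
      have h := absorbSetting hG hS h4 h5 h1 h2 h6
      have hcard : (component g S r).toFinset.card ≤ q :=
        (List.toFinset_card_le _).trans (hq r h1 (isRoot_iff.1 h3).1)
      have key (Ψ : ℕ → ℕ) (h7 : ∀ v ∈ U, v ∉ component g S r → Ψ v = Φ v)
          (h8 : ∀ c ∈ component g S (host r),
            Ψ (transport (component g S (host r)) (component g S r) c) ∈ component g S r ∨
            Ψ (transport (component g S (host r)) (component g S r) c) = label [] c) :
          RedBound G U ((kernel g S b).length + q) Ψ := by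
        refine redBound_of_subset
          (fun _ _ => st.redAdj_of_absorbing h hdA unsplit_nil h7 h8) (redBound_card ?_)
        refine (Finset.card_le_card (t := W ∪ (component g S r).toFinset) ?_).trans
          ((Finset.card_union_le _ _).trans (Nat.add_le_add hWcard hcard))
        refine Finset.image_subset_iff.2 fun v hv => ?_
        by_cases hvD : v ∈ component g S r
        · obtain ⟨c, hc', rfl⟩ := h.surj v hvD
          rcases h8 c hc' with h9 | h9
          · exact Finset.mem_union_right _ (List.mem_toFinset.2 h9)
          · rw [h9]
            exact Finset.mem_union_left _ (h.host c hc').1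
        · have hv' : v ∈ W ∪ A := (Finset.mem_union.1 hv).resolve_right fun h' =>
            hvD (List.mem_toFinset.1 h')
          have hvU : v ∈ U := (Finset.mem_union.1 hv').elim (fun h' => h.sub h')
            fun h' => (st.sub v h').1
          rw [h7 v hvU hvD]
          exact Finset.mem_union_left _ (hname st v hv')
      obtain ⟨k1, k2, k3⟩ := absorb_steps (B := RedBound G U ((kernel g S b).length + q)) h
        (hc.nodup _ (Finset.mem_range.2 (mem_kernel.1 h4).1) (by simpa using h5)) st hdA (by simp)
        (fun P hP Ψ h7 h8 => key Ψ h7 fun c hc' => .inl (h8 c hc' ▸ h.maps _ (rep_spec hc').1))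
        (fun N Ψ h7 h8 h9 => key Ψ h7 fun c hc' => by
          by_cases hN : N (rep (component g S (host r)) (label []) c)
          · exact .inr (h8 c hc' hN)
          · exact .inl (h9 c hc' hN ▸ h.maps _ (rep_spec hc').1))
      exact ⟨k1, st.after_absorb h k2 k3 hdA⟩)
  have hall : ∀ v ∈ U, v ∈ W ∪ (∅ ∪ (l.flatMap (component g S)).toFinset) := by
    intro v hv
    by_cases hvW : v ∈ kernel g S b
    · exact Finset.mem_union_left _ (List.mem_toFinset.2 hvW)
    have hvS : v ∉ S := fun h => hvW (mem_kernel.2 ⟨Finset.mem_range.1 hv, .inl h⟩)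
    obtain ⟨r, k1, k2, k3, k4⟩ := exists_root hG (Finset.mem_range.1 hv) hvS
    have hvr : v ∈ component g S r := k4 ▸ hc.self v hv (by simpa using hvS)
    simp only [Finset.mem_union, List.mem_toFinset, List.mem_flatMap]
    refine .inr (.inr ⟨r, (hmem r).2 ⟨k1, fun h => hvW ?_, k2⟩, hvr⟩)
    exact kernel_component hG h (isRoot_iff.1 k2).1 hvr
  obtain ⟨L, h3, h4⟩ := exists_steps_card (G := G) (U := U) (w := (kernel g S b).length + q)
    ⟨0, Finset.mem_range.2 hn⟩ ((Finset.card_le_card (t := W)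
      (Finset.image_subset_iff.2 fun v hv => hname h2 v (hall v hv))).trans
      (hWcard.trans (Nat.le_add_right _ _)))
  refine ⟨_, steps_append.2 ⟨h1, h3⟩, ?_⟩
  rw [funext (label_append _ L)]
  exact h4

open Classical in
/-- The vertices of the kernel whose component has similar components that are not yet absorbed. -/
noncomputable def pending (g : List (List Bool)) (G : SimpleGraph ℕ) (S W : List ℕ)
    (A : Finset ℕ) : Finset ℕ :=
  W.toFinset.filter fun x => x ∉ S ∧ ∃ r < g.length, r ∉ W ∧ r ∉ A ∧ isRoot g S r = true ∧
    SimilarLists G S.toFinset (component g S x) (component g S r)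

/-- The list `E` of tokens consists of the contractions `L` of the kernel `W` and requests that
absorb the vertices in `A`. The bound for its length holds since each request leaves fewer pending
vertices; `classes` says that similar components are absorbed together. -/
structure TokenState (g : List (List Bool)) (G : SimpleGraph ℕ) (S W : List ℕ) (k : ℕ)
    (L E : List (ℕ × ℕ)) (A : Finset ℕ) : Prop where
  plain : plain E = L
  mem : ∀ e ∈ E, e.1 ∈ W ∧ e.2 ∈ W
  length : E.length + (pending g G S W A).card ≤ L.length + W.length
  steps : Steps (Finset.range g.length) (RedBound G (Finset.range g.length) (k + k)) id
    (expand g S W E)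
  state : AbsorbState G (Finset.range g.length) S.toFinset W.toFinset A (label L)
    (label (expand g S W E))
  same : SameAdj G W.toFinset (W.toFinset ∪ A) (label L) (label (expand g S W E))
  unsplit : Unsplit G W.toFinset (label L) fun z =>
    z ∈ Finset.range g.length ∧ z ∉ W.toFinset ∧ z ∉ A
  classes : ∀ r < g.length, ∀ r' < g.length, r' ∉ W → isRoot g S r = true → isRoot g S r' = true →
    SimilarLists G S.toFinset (component g S r) (component g S r') → r ∈ A → r' ∈ A

open Classical in
theorem mem_pending {W : List ℕ} {A : Finset ℕ} {x : ℕ} : x ∈ pending g G S W A ↔ x ∈ W ∧ x ∉ S ∧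
    ∃ r < g.length, r ∉ W ∧ r ∉ A ∧ isRoot g S r = true ∧
      SimilarLists G S.toFinset (component g S x) (component g S r) := by
  rw [pending, Finset.mem_filter, List.mem_toFinset]

variable {k : ℕ} {L E : List (ℕ × ℕ)} {A : Finset ℕ}

open Classical in
theorem tokenState_nil (hG : IsMatrix g G) (hS : ∀ s ∈ S, s < g.length)
    (h0 : RedBound G (kernel g S b).toFinset k (label [])) :
    TokenState g G S (kernel g S b) k [] [] ∅ where
  plain := rfl
  mem e he := by simp at he
  length := by
    simp only [List.length_nil, zero_add]
    exact (Finset.card_filter_le _ _).trans (List.toFinset_card_le _)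
  steps := by
    have h := (absorbState_empty (b := b)).redBound (isKernel hG hS) (by
      rw [Finset.union_empty]; exact fun _ _ _ => ⟨Iff.rfl, Iff.rfl⟩) unsplit_nil h0
    exact h.mono (Nat.le_add_right _ _)
  state := absorbState_empty
  same := by rw [Finset.union_empty]; exact fun _ _ _ => ⟨Iff.rfl, Iff.rfl⟩
  unsplit := unsplit_nil
  classes := by simp

/-- A pending vertex whose component is fully mixed can absorb the similar components. -/
theorem TokenState.absorb (hG : IsMatrix g G) (hS : ∀ s ∈ S, s < g.length)
    (st : TokenState g G S (kernel g S b) k L E A)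
    (hL : Steps (kernel g S b).toFinset (RedBound G (kernel g S b).toFinset k) id L) {x : ℕ}
    (hx : x ∈ pending g G S (kernel g S b) A)
    (hmix : AbsorbSetting.FullyMixed (kernel g S b).toFinset (component g S x) (label L)) :
    ∃ E' A', TokenState g G S (kernel g S b) k L E' A' ∧
      (pending g G S (kernel g S b) A').card < (pending g G S (kernel g S b) A).card := by
  have hc := isComponents (S := S) hG
  set W := kernel g S b with hW
  obtain ⟨hxW, hxS, r₀, hr₀, hr₀W, hr₀A, hr₀r, hr₀s⟩ := mem_pending.1 hx
  have hmem := fun r => mem_extras (S := S) (W := W) (h := x) (r := r) hG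
  have hnotA : ∀ r ∈ extras g S W x, ∀ d ∈ component g S r, d ∉ A := by
    intro r hr
    obtain ⟨h1, h2, h3, h4⟩ := (hmem r).1 hr
    refine not_mem_of_root hG st.state.sep h1 (isRoot_iff.1 h3).1 fun hrA => hr₀A ?_
    exact st.classes r h1 r₀ hr₀ hr₀W h3 hr₀r (h4.symm.trans hr₀s) hrA
  obtain ⟨h1, ⟨h2, h3, h4⟩⟩ := steps_flatMap (U := Finset.range g.length)
    (B := RedBound G (Finset.range g.length) (k + k))
    (Inv := fun A Φ => AbsorbState G (Finset.range g.length) S.toFinset W.toFinset A (label L) Φ ∧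
      SameAdj G W.toFinset (W.toFinset ∪ A) (label L) Φ ∧
      Unsplit G W.toFinset (label L) fun z =>
        z ∈ Finset.range g.length ∧ z ∉ W.toFinset ∧ z ∉ A) (cmp := component g S)
    (M := fun r => _root_.absorb (component g S x) (component g S r) L)
    (fun A Φ h => (h.1.redBound (isKernel hG hS) h.2.1 h.2.2 hL.last).mono (Nat.le_add_right _ _))
    (extras g S W x) A (label (expand g S W E)) ⟨st.state, st.same, st.unsplit⟩
    (nodup_extras.imp_of_mem fun hr hr' hne => component_disjoint hG ((hmem _).1 hr).1
      ((hmem _).1 hr').1 ((hmem _).1 hr).2.2.1 ((hmem _).1 hr').2.2.1 hne) hnotA (by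
      intro r hr A Φ h hdA
      obtain ⟨h1, h2, h3, h4⟩ := (hmem r).1 hr
      obtain ⟨k1, k2, k3⟩ := h.1.absorb_redBound (absorbSetting hG hS hxW hxS h1 h2 h4)
        (hc.nodup _ (Finset.mem_range.2 (mem_kernel.1 hxW).1) (by simpa using hxS)) h.2.1 hdA hL
        h.2.2 hmix
      exact ⟨k1, k2, k3, fun d hd => h.2.2 d ⟨hd.1, hd.2.1, fun h' =>
        hd.2.2 (Finset.mem_union_left _ h')⟩⟩)
  set A' := A ∪ ((extras g S W x).flatMap (component g S)).toFinset with hA'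
  have hexp : expand g S W (E ++ [(x, x)]) = expand g S W E ++
      (extras g S W x).flatMap fun r => _root_.absorb (component g S x) (component g S r) L := by
    rw [expand_append, expandToken_self, st.plain]
  have hmemA' : ∀ r < g.length, isRoot g S r = true → (r ∈ A' ↔ r ∈ A ∨ r ∈ extras g S W x) := by
    intro r hr hroot
    simp only [hA', Finset.mem_union, List.mem_toFinset, List.mem_flatMap]
    refine or_congr_right ⟨?_, fun h => ⟨r, h, hc.self r (Finset.mem_range.2 hr)
      (by simpa using (isRoot_iff.1 hroot).1)⟩⟩
    rintro ⟨r', h1, h2⟩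
    obtain ⟨h3, h4, h5, h6⟩ := (hmem r').1 h1
    have h7 := component_eq_of_mem hG h3 (isRoot_iff.1 h5).1 h2
    rwa [root_unique hG hr h3 hroot h5 h7]
  have hsub : pending g G S W A' ⊆ (pending g G S W A).erase x := by
    intro y hy
    obtain ⟨k1, k2, r, k3, k4, k5, k6, k7⟩ := mem_pending.1 hy
    rw [hmemA' r k3 k6, not_or] at k5
    refine Finset.mem_erase.2 ⟨?_, mem_pending.2 ⟨k1, k2, r, k3, k4, k5.1, k6, k7⟩⟩
    rintro rfl
    exact k5.2 ((hmem r).2 ⟨k3, k4, k6, k7⟩)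
  have hlt : (pending g G S W A').card < (pending g G S W A).card := by
    refine lt_of_le_of_lt (Finset.card_le_card hsub) ?_
    exact Finset.card_erase_lt_of_mem hx
  refine ⟨E ++ [(x, x)], A', ⟨?_, ?_, ?_, ?_, ?_, ?_, h4, ?_⟩, hlt⟩
  · rw [plain_append, plain_self, List.append_nil, st.plain]
  · intro e he
    rcases List.mem_append.1 he with he | he
    · exact st.mem e he
    · rw [List.mem_singleton] at he
      subst he
      exact ⟨hxW, hxW⟩
  · have := st.length
    rw [List.length_append, List.length_singleton]
    omega
  · rw [hexp]
    exact steps_append.2 ⟨st.steps, h1⟩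
  · rw [hexp]
    simp only [← label_append] at h2
    exact h2
  · rw [hexp]
    simp only [← label_append] at h3
    exact h3
  · intro r hr r' hr' hr'W hroot hroot' hsim hrA
    rw [hmemA' r hr hroot] at hrA
    rw [hmemA' r' hr' hroot']
    refine hrA.imp (st.classes r hr r' hr' hr'W hroot hroot' hsim) fun h => ?_
    exact (hmem r').2 ⟨hr', hr'W, hroot', ((hmem r).1 h).2.2.2.trans hsim⟩

/-- No component with pending vertices is fully mixed. -/
def Saturated (g : List (List Bool)) (G : SimpleGraph ℕ) (S W : List ℕ) (L : List (ℕ × ℕ))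
    (A : Finset ℕ) : Prop :=
  ∀ x ∈ pending g G S W A, ¬ AbsorbSetting.FullyMixed W.toFinset (component g S x) (label L)

/-- Absorption for as long as possible. -/
theorem TokenState.exists_saturated (hG : IsMatrix g G) (hS : ∀ s ∈ S, s < g.length)
    (st : TokenState g G S (kernel g S b) k L E A)
    (hL : Steps (kernel g S b).toFinset (RedBound G (kernel g S b).toFinset k) id L) :
    ∃ E' A', TokenState g G S (kernel g S b) k L E' A' ∧ Saturated g G S (kernel g S b) L A' := by
  induction hm : (pending g G S (kernel g S b) A).card using Nat.strong_induction_on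
    generalizing E A with
  | _ m ih =>
    by_cases hs : Saturated g G S (kernel g S b) L A
    · exact ⟨E, A, st, hs⟩
    · rw [Saturated] at hs
      push Not at hs
      obtain ⟨x, hx, hmix⟩ := hs
      obtain ⟨E', A', st', hlt⟩ := st.absorb hG hS hL hx hmix
      exact ih _ (hm ▸ hlt) st' rfl

/-- Vertices outside the kernel that are not absorbed have pending copies. -/
theorem TokenState.exists_pending (hG : IsMatrix g G) (st : TokenState g G S (kernel g S b) k L E A)
    {z : ℕ} (hz : z < g.length) (hzW : z ∉ kernel g S b) (hzA : z ∉ A) :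
    ∃ r < g.length, r ∉ kernel g S b ∧ z ∈ component g S r ∧ r ∉ S ∧ ∃ R : Finset ℕ, b ≤ R.card ∧
      (∀ x ∈ R, x ∈ pending g G S (kernel g S b) A) ∧
      IsCopySet G S.toFinset (kernel g S b).toFinset (component g S) r R := by
  have hc := isComponents (S := S) hG
  have hzS : z ∉ S := fun h => hzW (mem_kernel.2 ⟨hz, .inl h⟩)
  obtain ⟨r, h1, h2, h3, h4⟩ := exists_root hG hz hzS
  have hrS := (isRoot_iff.1 h2).1
  have hzr : z ∈ component g S r := h4 ▸ hc.self z (Finset.mem_range.2 hz) (by simpa using hzS)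
  have hrW : r ∉ kernel g S b := fun h => hzW (kernel_component hG h hrS hzr)
  have hrA : r ∉ A := not_mem_of_root hG st.state.sep hz hzS hzA r h3
  obtain ⟨R, h5, h6, h7⟩ := exists_isCopySet hG h1 hrS hrW
  refine ⟨r, h1, hrW, hzr, hrS, R, h5, fun x hx => ?_, h7⟩
  have h8 := h7.mem x hx
  exact mem_pending.2 ⟨by simpa using h8.1, by simpa using h8.2.1, r, h1, hrW, hrA, h2,
    (h6 x hx).2.symm⟩

/-- When no pending component is fully mixed, the next contraction does not lead to red edges at
components that are not absorbed. -/
theorem TokenState.contract (hG : IsMatrix g G) (hS : ∀ s ∈ S, s < g.length)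
    (hq : ∀ v < g.length, v ∉ S → (component g S v).length ≤ q)
    (hb : (k + 2) * (2 * (k + 1) ^ q) + 1 ≤ b) (st : TokenState g G S (kernel g S b) k L E A)
    (hs : Saturated g G S (kernel g S b) L A) {e : ℕ × ℕ}
    (hL : Steps (kernel g S b).toFinset (RedBound G (kernel g S b).toFinset k) id (L ++ [e])) :
    TokenState g G S (kernel g S b) k (L ++ [e]) (E ++ [e]) A := by
  have hc := isComponents (S := S) hG
  have hK := isKernel (b := b) hG hS
  set W := kernel g S b with hW
  have heW := hL.mem e (by simp)
  rw [Finset.image_id, List.mem_toFinset, List.mem_toFinset] at heW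
  rw [steps_append] at hL
  obtain ⟨hL1, -, he1, he2, hne, hb'⟩ := hL
  have hlab (L : List (ℕ × ℕ)) : label (L ++ [e]) = fun x => relabel e (label L x) := by
    funext x
    rw [label_append]
    rfl
  have hexp : expand g S W (E ++ [e]) = expand g S W E ++ [e] := by
    rw [expand_append, expandToken_of_ne hne]
  have hstate := st.state.after_contract (List.mem_toFinset.2 heW.1) (List.mem_toFinset.2 heW.2)
  have hsame := st.same.comp (relabel e)
  have hunsplit : Unsplit G W.toFinset (fun x => relabel e (label L x)) fun z =>
      z ∈ Finset.range g.length ∧ z ∉ W.toFinset ∧ z ∉ A := by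
    have key : ∀ z ∈ Finset.range g.length, z ∉ W.toFinset → z ∉ A → ∀ w ∈ W.toFinset,
        ∀ w' ∈ W.toFinset, relabel e (label L w) = relabel e (label L w') → G.Adj w z →
        G.Adj w' z := by
      intro z hz hzW hzA w hw w' hw' hww' hwz
      by_contra hw'z
      obtain ⟨r, h1, h2, h3, h4, R, h5, h6, h7⟩ := st.exists_pending hG (Finset.mem_range.1 hz)
        (by simpa using hzW) hzA
      obtain ⟨x, hx, hmix⟩ := exists_fullyMixed_of_split hc hK (Finset.mem_range.2 h1)
        (by simpa using h2) h7 hL1.last hb' (le_trans (Nat.add_le_add_right (Nat.mul_le_mul_left _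
          (Nat.mul_le_mul_left _ (Nat.pow_le_pow_right (by omega) (hq r h1 h4)))) 1)
          (hb.trans h5)) h3 hzW hw hw' hww' hwz hw'z
      exact hs x (h6 x hx) hmix
    exact fun z hz w hw w' hw' h => ⟨key z hz.1 hz.2.1 hz.2.2 w hw w' hw' h,
      key z hz.1 hz.2.1 hz.2.2 w' hw' w hw h.symm⟩
  refine ⟨?_, ?_, ?_, ?_, ?_, ?_, ?_, st.classes⟩
  · rw [plain_append, plain_of_ne hne, st.plain]
  · intro e' he'
    rcases List.mem_append.1 he' with he' | he'
    · exact st.mem e' he'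
    · rw [List.mem_singleton] at he'
      subst he'
      exact heW
  · have := st.length
    simp only [List.length_append, List.length_singleton]
    omega
  · rw [hexp]
    have himg : ∀ y ∈ W.toFinset.image fun x => label L (id x),
        y ∈ (Finset.range g.length).image fun x => label (expand g S W E) (id x) := by
      intro y hy
      obtain ⟨v, hv, rfl⟩ := Finset.mem_image.1 hy
      exact Finset.mem_image.2 ⟨v, hK.sub hv, st.state.onW v hv⟩
    exact steps_append.2 ⟨st.steps, st.steps.last, himg _ he1, himg _ he2, hne,
      (hstate.redBound hK hsame hunsplit hb').mono (Nat.le_add_right _ _)⟩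
  · rw [hexp, hlab, hlab]
    exact hstate
  · rw [hexp, hlab, hlab]
    exact hsame
  · rw [hlab]
    exact hunsplit

/-- By induction along the contraction sequence of the kernel, absorbing whatever can be absorbed
after each contraction. -/
theorem exists_tokenState (hG : IsMatrix g G) (hS : ∀ s ∈ S, s < g.length)
    (hq : ∀ v < g.length, v ∉ S → (component g S v).length ≤ q)
    (hb : (k + 2) * (2 * (k + 1) ^ q) + 1 ≤ b)
    (hL : Steps (kernel g S b).toFinset (RedBound G (kernel g S b).toFinset k) id L) :
    ∃ E A, TokenState g G S (kernel g S b) k L E A ∧ Saturated g G S (kernel g S b) L A := by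
  induction L using List.reverseRecOn with
  | nil => exact (tokenState_nil hG hS hL).exists_saturated hG hS hL
  | append_singleton L e ih =>
    obtain ⟨E, A, st, hs⟩ := ih (steps_append.1 hL).1
    exact (st.contract hG hS hq hb hs hL).exists_saturated hG hS hL

/-- A contraction sequence of the kernel of width `k` extends to one of the graph of width `2 * k`.
-/
theorem exists_tokens (hG : IsMatrix g G) (hS : ∀ s ∈ S, s < g.length)
    (hq : ∀ v < g.length, v ∉ S → (component g S v).length ≤ q)
    (hb : (k + 2) * (2 * (k + 1) ^ q) + 1 ≤ b)
    (hL : IsSeq G (kernel g S b).toFinset k L) :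
    ∃ E, plain E = L ∧ (∀ e ∈ E, e.1 ∈ kernel g S b ∧ e.2 ∈ kernel g S b) ∧
      E.length ≤ (kernel g S b).length + (kernel g S b).length ∧
      IsSeq G (Finset.range g.length) (k + k) (expand g S (kernel g S b) E) := by
  obtain ⟨E, A, st, hs⟩ := exists_tokenState hG hS hq hb hL.1
  have hK := isKernel (b := b) hG hS
  obtain ⟨y, hy⟩ := Finset.card_eq_one.1 hL.2
  have hlab : ∀ w ∈ (kernel g S b).toFinset, label L w = y := fun w hw => by
    have := Finset.mem_image_of_mem (label L) hw
    rwa [hy, Finset.mem_singleton] at this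
  -- all parts are contracted to one, so any component is fully mixed
  have hall : ∀ z < g.length, z ∉ kernel g S b → z ∈ A := by
    intro z hz hzW
    by_contra hzA
    obtain ⟨r, -, -, -, -, R, h5, h6, h7⟩ := st.exists_pending hG hz hzW hzA
    have h1 : 1 < R.card := by
      have := Nat.one_le_pow q (k + 1) (by omega)
      nlinarith
    obtain ⟨x, hx, x', hx', hne⟩ := Finset.one_lt_card.1 h1
    refine hs x (h6 x hx) fun c hc => ⟨x', (h7.mem x' hx').1, fun h => ?_, ?_⟩
    · have h8 := (isComponents (S := S) hG).mem x (hK.sub (h7.mem x hx).1) (h7.mem x hx).2.1 x' h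
      exact h7.ne x hx x' hx' hne h8.2.2.symm
    · rw [hlab _ (h7.mem x' hx').1, hlab _ ((h7.mem x hx).2.2 c hc)]
  refine ⟨E, st.plain, st.mem, ?_, st.steps, ?_⟩
  · have h1 := st.length
    have h2 := hL.1.card_image
    have h3 := List.toFinset_card_le (kernel g S b)
    rw [Finset.image_id] at h2
    omega
  · obtain ⟨w, hw, hwy⟩ := Finset.mem_image.1 (hy ▸ Finset.mem_singleton_self y)
    refine Finset.card_eq_one.2 ⟨y, ?_⟩
    ext v
    rw [Finset.mem_image, Finset.mem_singleton]
    constructor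
    · rintro ⟨u, hu, rfl⟩
      by_cases huW : u ∈ (kernel g S b).toFinset
      · rw [st.state.onW u huW, hlab u huW]
      · obtain ⟨w', hw', -, h⟩ := st.state.host u (hall u (Finset.mem_range.1 hu)
          (by simpa using huW))
        rw [h, hlab w' hw']
    · rintro rfl
      exact ⟨w, hK.sub hw, by rw [st.state.onW w hw, hwy]⟩

end Algorithm

/-! ### Correctness of the algorithm -/

namespace Algorithm

variable {g : List (List Bool)} {G : SimpleGraph ℕ} {S : List ℕ} {b q u : ℕ}

/-- If there is a result at all, then it contains every list of length at most `k` over `A`. -/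
theorem mem_candidates {A : List (ℕ × ℕ)} {k : ℕ} (h : candidates u A k ≠ []) {s : List (ℕ × ℕ)}
    (hs : ∀ e ∈ s, e ∈ A) (hk : s.length ≤ k) : s ∈ candidates u A k := by
  induction k generalizing s with
  | zero =>
    obtain rfl := List.length_eq_zero_iff.1 (Nat.le_zero.1 hk)
    simp [candidates]
  | succ k ih =>
    rw [candidates, Function.iterate_succ_apply', ← candidates, extendCapped] at h ⊢
    cases hc : (candidates u A k).isEmpty || decide (u < (extendLists A (candidates u A k)).length)
    · rw [cond_false]
      rw [Bool.or_eq_false_iff, List.isEmpty_eq_false_iff] at hc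
      cases s with
      | nil => simp [extendLists]
      | cons a s =>
        simp only [extendLists, List.mem_cons, List.mem_flatMap, List.mem_map]
        refine .inr ⟨s, ih hc.1 (fun e he => hs e (List.mem_cons_of_mem _ he)) ?_, a,
          hs a List.mem_cons_self, rfl⟩
        simpa using hk
    · rw [hc, cond_true] at h
      exact absurd rfl h

/-- There is a result if `u` bounds the number of the lists. -/
theorem candidates_ne_nil {A : List (ℕ × ℕ)} {k : ℕ} (hu : (A.length + 1) ^ k ≤ u) :
    candidates u A k ≠ [] := by
  suffices h : candidates u A k ≠ [] ∧ (candidates u A k).length ≤ (A.length + 1) ^ k from h.1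
  induction k with
  | zero => simp [candidates]
  | succ k ih =>
    have hpow := Nat.one_le_pow k (A.length + 1) (by omega)
    obtain ⟨h1, h2⟩ := ih (le_trans (Nat.pow_le_pow_right (by omega) (by omega)) hu)
    have h3 : (extendLists A (candidates u A k)).length ≤ (A.length + 1) ^ (k + 1) := by
      have : (extendLists A (candidates u A k)).length =
          (candidates u A k).length * A.length + 1 := by
        simp [extendLists, List.length_flatMap]
      rw [this, pow_succ]
      nlinarith
    rw [candidates, Function.iterate_succ_apply', ← candidates, extendCapped]
    have h4 : ((candidates u A k).isEmpty ||
        decide (u < (extendLists A (candidates u A k)).length)) = false := by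
      rw [Bool.or_eq_false_iff, List.isEmpty_eq_false_iff, decide_eq_false_iff_not, not_lt]
      exact ⟨h1, h3.trans hu⟩
    rw [h4, cond_false]
    exact ⟨by simp [extendLists], h3⟩

theorem mem_tokenLists {W : List ℕ} (h : tokenLists u W ≠ []) {s : List (ℕ × ℕ)}
    (hs : ∀ e ∈ s, e.1 ∈ W ∧ e.2 ∈ W) (hk : s.length ≤ W.length + W.length) :
    s ∈ tokenLists u W := by
  refine mem_candidates h (fun e he => ?_) hk
  simp only [List.mem_flatMap, List.mem_map]
  exact ⟨e.1, (hs e he).1, e.2, (hs e he).2, rfl⟩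

theorem plain_eq_self {L : List (ℕ × ℕ)} (h : ∀ e ∈ L, e.1 ≠ e.2) : plain L = L := by
  rw [plain, List.filter_eq_self]
  intro e he
  simp [h e he]

/-- If there is a contraction sequence of width `w` of the subgraph induced by `W`, then the least
width that is found is at most `w`. -/
theorem exists_minWidth (hG : IsMatrix g G) {W : List ℕ} (hne : tokenLists u W ≠ []) {w : ℕ}
    (hw : w ≤ g.length) {L : List (ℕ × ℕ)} (hL : IsSeq G W.toFinset w L) :
    ∃ w' ≤ w, minWidth g W (tokenLists u W) = some w' := by
  have hmem : L ∈ tokenLists u W := by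
    refine mem_tokenLists hne (fun e he => ?_) ?_
    · simpa using hL.1.mem e he
    · have h2 := hL.1.card_image
      have h3 := List.toFinset_card_le W
      rw [Finset.image_id] at h2
      omega
  have hp : (tokenLists u W).any (fun E => check g W w (plain E)) = true := by
    rw [List.any_eq_true]
    exact ⟨L, hmem, by rw [plain_eq_self hL.1.ne, check_iff hG]; exact hL⟩
  cases h : minWidth g W (tokenLists u W) with
  | none =>
    rw [minWidth, List.find?_eq_none] at h
    exact absurd hp (h w (List.mem_range.2 (by omega)))
  | some w' =>
    refine ⟨w', ?_, rfl⟩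
    by_contra! hlt
    rw [minWidth, List.find?_range_eq_some] at h
    have := h.2.2 w hlt
    rw [hp] at this
    cases this

/-- Any output is a contraction sequence of at most twice the least width: an optimal contraction
sequence of the graph induces one of the kernel. -/
theorem solve_sound (hG : IsMatrix g G) {w : ℕ} (hw : w ≤ g.length) {M : List (ℕ × ℕ)}
    (hM : IsSeq G (Finset.range g.length) w M) {L : List (ℕ × ℕ)} (h : solve (g, u) = some L) :
    IsSeq G (Finset.range g.length) (w + w) L := by
  rw [solve, List.findSome?_eq_some_iff] at h
  obtain ⟨-, d, -, -, h, -⟩ := h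
  rw [List.findSome?_eq_some_iff] at h
  obtain ⟨-, b, -, -, h, -⟩ := h
  rw [attempt, bestExpansion] at h
  -- the kernel need not be the right one: its own least width is a lower bound for that of `G`, and
  -- the output has been checked against twice this value
  set S := big g d
  set W := kernel g S b with hW
  cases hmin : minWidth g W (tokenLists u W) with
  | none => simp [hmin] at h
  | some w' =>
    have hne : tokenLists u W ≠ [] := by
      intro h1
      simp [minWidth, h1] at hmin
    have hWne : W ≠ [] := by
      intro h1
      simp [minWidth, check, h1] at hmin
    have hWU : W.toFinset ⊆ Finset.range g.length := fun v hv =>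
      Finset.mem_range.2 (mem_kernel.1 (List.mem_toFinset.1 hv)).1
    obtain ⟨w'', h1, h2⟩ := exists_minWidth hG hne hw (hM.restrict hWU hWne)
    rw [hmin, Option.some_inj] at h2
    subst h2
    simp only [hmin, Option.toList_some, List.findSome?_cons, List.findSome?_nil] at h
    have h3 : check g (verts g) (w' + w') L = true := by
      refine List.find?_some (l := (tokenLists u W).map fun E => expand g S W E) ?_
      revert h
      cases List.find? (fun L => check g (verts g) (w' + w') L)
        ((tokenLists u W).map fun E => expand g S W E) <;> simp
    rw [check_iff hG, verts, List.toFinset_range] at h3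
    exact ⟨h3.1.mono fun φ hφ => hφ.mono (by omega), h3.2⟩

/-- An attempt succeeds if the components are small, sufficiently many of each class are kept, and
`u` bounds the number of token lists. -/
theorem attempt_isSome (hG : IsMatrix g G) (hS : ∀ s ∈ S, s < g.length)
    (hq : ∀ v < g.length, v ∉ S → (component g S v).length ≤ q) {w : ℕ} (hw : w ≤ g.length)
    {M : List (ℕ × ℕ)} (hM : IsSeq G (Finset.range g.length) w M)
    (hb : (w + 2) * (2 * (w + 1) ^ q) + 1 ≤ b)
    (hu : ((kernel g S b).length * (kernel g S b).length + 1) ^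
      ((kernel g S b).length + (kernel g S b).length) ≤ u) (hWne : kernel g S b ≠ []) :
    (attempt g u b S).isSome = true := by
  set W := kernel g S b with hW
  have hne : tokenLists u W ≠ [] := by
    refine candidates_ne_nil (le_trans (le_of_eq ?_) hu)
    simp [List.length_flatMap]
  have hWU : W.toFinset ⊆ Finset.range g.length := fun v hv =>
    Finset.mem_range.2 (mem_kernel.1 (List.mem_toFinset.1 hv)).1
  obtain ⟨w', h1, h2⟩ := exists_minWidth hG hne hw (hM.restrict hWU hWne)
  have h3 : (tokenLists u W).any (fun E => check g W w' (plain E)) = true := by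
    rw [minWidth] at h2
    exact List.find?_some (p := fun w => (tokenLists u W).any fun E => check g W w (plain E)) h2
  rw [List.any_eq_true] at h3
  obtain ⟨E₀, -, h4⟩ := h3
  rw [check_iff hG] at h4
  have hb' : (w' + 2) * (2 * (w' + 1) ^ q) + 1 ≤ b := by
    refine le_trans ?_ hb
    gcongr
  obtain ⟨E, -, h5, h6, h7⟩ := exists_tokens hG hS hq hb' h4
  have h8 := mem_tokenLists hne h5 h6
  rw [attempt, bestExpansion, ← hW, h2]
  simp only [Option.toList_some, List.findSome?_cons, List.findSome?_nil]
  have h9 : (List.find? (fun L => check g (verts g) (w' + w') L)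
      ((tokenLists u W).map fun E => expand g S W E)).isSome = true := by
    rw [List.find?_isSome]
    refine ⟨_, List.mem_map_of_mem h8, ?_⟩
    rw [check_iff hG, verts, List.toFinset_range]
    exact h7
  revert h9
  cases List.find? (fun L => check g (verts g) (w' + w') L)
    ((tokenLists u W).map fun E => expand g S W E) <;> simp

theorem solve_isSome {d : ℕ} (hd : d < u) (hb : b < u)
    (h : (attempt g u b (big g d)).isSome = true) : (solve (g, u)).isSome = true := by
  rw [solve, List.findSome?_isSome_iff]
  refine ⟨d, List.mem_range.2 hd, ?_⟩
  rw [List.findSome?_isSome_iff]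
  exact ⟨b, List.mem_range.2 hb, h⟩

end Algorithm

/-! ### Vertex integrity -/

section integrity

/-- A set that witnesses the vertex integrity, together with sets that contain it and a component of
the rest. -/
theorem exists_deletion {n : ℕ} (H : SimpleGraph (Fin n)) : ∃ S : Finset ℕ,
    S.card ≤ vertexIntegrity H ∧ ∀ v < n, v ∉ S → ∃ Y : Finset ℕ, Y.card ≤ vertexIntegrity H ∧
      v ∈ Y ∧ ∀ x ∈ Y, x ∉ S → ∀ y, (natGraph H).Adj x y → y ∈ Y := by
  classical
  have hne : {p : ℕ | ∃ S : Finset (Fin n), S.card ≤ p ∧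
      ∀ C : (H.induce ((S : Set (Fin n))ᶜ)).ConnectedComponent,
        ((Subtype.val '' C.supp) ∪ (S : Set (Fin n))).ncard ≤ p}.Nonempty :=
    ⟨n, Finset.univ, by simp, fun C => (Set.ncard_le_card _).trans (by simp)⟩
  obtain ⟨S, h1, h2⟩ := Nat.sInf_mem hne
  change S.card ≤ vertexIntegrity H at h1
  refine ⟨S.map Fin.valEmbedding, by rwa [Finset.card_map], fun v hv hvS => ?_⟩
  have hvS' : (⟨v, hv⟩ : Fin n) ∈ ((S : Set (Fin n))ᶜ : Set (Fin n)) := fun h =>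
    hvS (Finset.mem_map.2 ⟨_, h, rfl⟩)
  set C := (H.induce ((S : Set (Fin n))ᶜ)).connectedComponentMk ⟨⟨v, hv⟩, hvS'⟩ with hC
  set Y : Set (Fin n) := (Subtype.val '' C.supp) ∪ (S : Set (Fin n)) with hY
  refine ⟨(Set.toFinite Y).toFinset.map Fin.valEmbedding, ?_, ?_, ?_⟩
  · rw [Finset.card_map, ← Set.ncard_eq_toFinset_card]
    exact h2 C
  · refine Finset.mem_map.2 ⟨⟨v, hv⟩, ?_, rfl⟩
    rw [Set.Finite.mem_toFinset]
    exact .inl ⟨_, rfl, rfl⟩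
  · intro x hx hxS y hxy
    obtain ⟨x, hxY, rfl⟩ := Finset.mem_map.1 hx
    rw [Set.Finite.mem_toFinset] at hxY
    obtain ⟨-, x', y, hxy, hx', rfl⟩ := hxy
    obtain rfl : x' = x := Fin.ext hx'
    refine Finset.mem_map.2 ⟨y, ?_, rfl⟩
    rw [Set.Finite.mem_toFinset]
    by_cases hyS : y ∈ S
    · exact .inr hyS
    left
    clear hx
    obtain ⟨x, hx, rfl⟩ := hxY.resolve_right fun h => hxS (Finset.mem_map.2 ⟨_, h, rfl⟩)
    refine ⟨⟨y, hyS⟩, ?_, rfl⟩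
    rw [SimpleGraph.ConnectedComponent.mem_supp_iff] at hx ⊢
    rw [← hx, SimpleGraph.ConnectedComponent.eq]
    exact SimpleGraph.Adj.reachable (by exact hxy.symm)

end integrity

namespace Algorithm

variable {g : List (List Bool)} {G : SimpleGraph ℕ} {S : List ℕ} {p : ℕ}

theorem nodup_verts : (verts g).Nodup := List.nodup_range

theorem lt_of_mem_big {d s : ℕ} (h : s ∈ big g d) : s < g.length := by
  rw [big, List.mem_filter, mem_verts] at h
  exact h.1

/-- The vertices of degree at least `p` belong to any set that witnesses that the vertex integrity
is at most `p`, and their deletion leaves small components: those of the deletion of the witnessing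
set are connected by its other vertices, which have small degree. -/
theorem big_spec (hG : IsMatrix g G) {T : Finset ℕ} (hT : T.card ≤ p)
    (hY : ∀ v < g.length, v ∉ T → ∃ Y : Finset ℕ, Y.card ≤ p ∧ v ∈ Y ∧
      ∀ x ∈ Y, x ∉ T → ∀ y, G.Adj x y → y ∈ Y) :
    (big g p).length ≤ p ∧ ∀ v < g.length, v ∉ big g p →
      (component g (big g p) v).length ≤ p + p + p * (p * p) := by
  have hc := isComponents (S := big g p) hG
  choose! Y hY using hY
  have hsub : ∀ v ∈ big g p, v ∈ T := by
    intro v hv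
    by_contra hvT
    rw [big, List.mem_filter, mem_verts, decide_eq_true_iff] at hv
    obtain ⟨h1, h2, h3⟩ := hY v hv.1 hvT
    have h4 : ((verts g).filter fun j => adj g v j).length ≤ ((Y v).erase v).card := by
      rw [← List.toFinset_card_of_nodup (nodup_verts.filter _)]
      refine Finset.card_le_card fun y hy => ?_
      rw [List.mem_toFinset, List.mem_filter, hG.adj] at hy
      exact Finset.mem_erase.2 ⟨hy.2.ne.symm, h3 v h2 hvT y hy.2⟩
    have := Finset.card_pos.2 ⟨v, h2⟩
    rw [Finset.card_erase_of_mem h2] at h4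
    omega
  refine ⟨?_, fun v hv hvS => ?_⟩
  · rw [big, ← List.toFinset_card_of_nodup (nodup_verts.filter _)]
    exact (Finset.card_le_card fun v hv => hsub v (List.mem_toFinset.1 hv)).trans hT
  have hvS' : v ∉ (big g p).toFinset := by simpa using hvS
  have hv' := Finset.mem_range.2 hv
  -- the neighbours of a vertex of small degree
  let N (t : ℕ) : Finset ℕ := if p ≤ ((verts g).filter fun j => adj g t j).length then ∅ else
    ((verts g).filter fun j => adj g t j).toFinset
  have hN (t : ℕ) : (N t).card ≤ p := by
    simp only [N]
    split_ifs with h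
    · simp
    · exact (List.toFinset_card_le _).trans (by omega)
  -- `T`, the set around `v`, and the sets around the neighbours of vertices of `T` of small degree:
  -- this is closed under adjacency outside the vertices of degree at least `p`
  let X : Finset ℕ := (if v ∈ T then ∅ else Y v) ∪ T ∪
    T.biUnion fun t => (N t).biUnion fun y => if y < g.length ∧ y ∉ T then Y y else ∅
  have hXcard : X.card ≤ p + p + p * (p * p) := by
    refine (Finset.card_union_le _ _).trans (Nat.add_le_add ?_ ?_)
    · refine (Finset.card_union_le _ _).trans (Nat.add_le_add ?_ hT)
      split_ifs with h
      · simp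
      · exact (hY v hv h).1
    · refine (Finset.card_biUnion_le_card_mul _ _ (p * p) fun t _ => ?_).trans
        (Nat.mul_le_mul_right _ hT)
      refine (Finset.card_biUnion_le_card_mul _ _ p fun y _ => ?_).trans
        (Nat.mul_le_mul_right _ (hN t))
      split_ifs with h
      · exact (hY y h.1 h.2).1
      · simp
  have hsubX : (component g (big g p) v).toFinset ⊆ X := by
    intro z hz
    refine hc.conn v hv' hvS' (· ∈ X) ?_ ?_ z (List.mem_toFinset.1 hz)
    · by_cases h : v ∈ T
      · simp [X, h]
      · simp [X, h, (hY v hv h).2.1]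
    · intro x hx hxX y hy hxy
      obtain ⟨hxU, hxS, -⟩ := hc.mem v hv' hvS' x hx
      obtain ⟨hyU, hyS, -⟩ := hc.mem v hv' hvS' y hy
      rw [Finset.mem_range] at hxU hyU
      by_cases hyT : y ∈ T
      · simp [X, hyT]
      by_cases hxT : x ∈ T
      · refine Finset.mem_union_right _ (Finset.mem_biUnion.2 ⟨x, hxT,
          Finset.mem_biUnion.2 ⟨y, ?_, ?_⟩⟩)
        · have h1 : ¬ p ≤ ((verts g).filter fun j => adj g x j).length := fun h => hxS (by
            rw [List.mem_toFinset, big, List.mem_filter, mem_verts, decide_eq_true_iff]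
            exact ⟨hxU, h⟩)
          simp only [N]
          rw [if_neg h1, List.mem_toFinset, List.mem_filter, mem_verts, hG.adj]
          exact ⟨hyU, hxy⟩
        · rw [if_pos ⟨hyU, hyT⟩]
          exact (hY y hyU hyT).2.1
      simp only [X, Finset.mem_union, Finset.mem_biUnion] at hxX ⊢
      rcases hxX with (h | h) | ⟨t, ht, z, hz, h⟩
      · split_ifs at h with h1
        · simp at h
        · refine .inl (.inl ?_)
          rw [if_neg h1]
          exact (hY v hv h1).2.2 x h hxT y hxy
      · exact absurd h hxT
      · split_ifs at h with h1
        · refine .inr ⟨t, ht, z, hz, ?_⟩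
          rw [if_pos h1]
          exact (hY z h1.1 h1.2).2.2 x h hxT y hxy
        · simp at h
  rw [← List.toFinset_card_of_nodup (hc.nodup v hv' hvS')]
  exact (Finset.card_le_card hsubX).trans hXcard

end Algorithm

/-! ### Elementary functions -/

/-- Elementary functions of one variable. -/
def IsElementary (f : ℕ → ℕ) : Prop := Elementary fun v : Fin 1 → ℕ => f (v 0)

namespace IsElementary

variable {f h : ℕ → ℕ}

theorem id : IsElementary fun x => x := .proj 0

theorem binary {o : ℕ → ℕ → ℕ} (ho : Elementary fun v : Fin 2 → ℕ => o (v 0) (v 1))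
    (hf : IsElementary f) (hh : IsElementary h) : IsElementary fun x => o (f x) (h x) := by
  have : ∀ i : Fin 2, Elementary ((![fun v => f (v 0), fun v => h (v 0)] :
      Fin 2 → (Fin 1 → ℕ) → ℕ) i) := by
    intro i
    fin_cases i
    · exact hf
    · exact hh
  exact Elementary.comp ho this

theorem const (c : ℕ) : IsElementary fun _ => c := by
  induction c with
  | zero => exact .zero
  | succ c ih => exact Elementary.comp (g := fun _ _ => c) .succ fun _ => ih

theorem add (hf : IsElementary f) (hh : IsElementary h) : IsElementary fun x => f x + h x :=
  binary .add hf hh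

theorem mul (hf : IsElementary f) (hh : IsElementary h) : IsElementary fun x => f x * h x := by
  refine binary (o := fun a b => a * b) ?_ hf hh
  have h : (fun v : Fin 2 → ℕ => v 0 * v 1) = fun v => ∑ _z ∈ Finset.range (v 0), v 1 := by
    funext v
    simp
  rw [h]
  exact .boundedSum (.proj 1)

theorem pow (hf : IsElementary f) (hh : IsElementary h) : IsElementary fun x => f x ^ h x := by
  refine binary (o := fun a b => b ^ a) ?_ hh hf
  have h : (fun v : Fin 2 → ℕ => v 1 ^ v 0) = fun v => ∏ _z ∈ Finset.range (v 0), v 1 := by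
    funext v
    simp
  rw [h]
  exact .boundedProd (.proj 1)

end IsElementary

/-! ### The final bounds -/

namespace Algorithm

open Classical in
/-- The adjacency matrix of a graph. -/
noncomputable def matrix {n : ℕ} (H : SimpleGraph (Fin n)) : List (List Bool) :=
  List.ofFn fun i => List.ofFn fun j => decide (H.Adj i j)

@[simp] theorem length_matrix {n : ℕ} (H : SimpleGraph (Fin n)) : (matrix H).length = n := by
  simp [matrix]

theorem isMatrix {n : ℕ} (H : SimpleGraph (Fin n)) : IsMatrix (matrix H) (natGraph H) where
  adj i j := by
    simp only [adj, matrix, List.getD_eq_getElem?_getD, List.getElem?_ofFn]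
    constructor
    · intro h
      by_cases hi : i < n
      · by_cases hj : j < n
        · simp only [hi, hj, dif_pos, Option.getD_some, List.getElem?_ofFn, decide_eq_true_eq] at h
          exact natGraph_adj.2 h
        · simp [hi, hj] at h
      · simp [hi] at h
    · rintro ⟨-, i, j, h, rfl, rfl⟩
      simp [h]
  lt i j h := by
    obtain ⟨-, i, j, -, rfl, -⟩ := h
    simp

theorem enc_matrix {n : ℕ} (H : SimpleGraph (Fin n)) : enc (matrix H) = Data.ofGraph H := by
  simp only [enc, matrix, Data.ofGraph, List.map_ofFn, Function.comp_def]
  refine congrArg (fun f => Data.ofList (List.ofFn f)) (funext fun i =>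
    congrArg (fun f => Data.ofList (List.ofFn f)) (funext fun j => ?_))
  by_cases h : H.Adj i j <;> simp [h]

theorem enc_map_val {n : ℕ} (M : List (Fin n × Fin n)) :
    enc (M.map fun e => ((e.1 : ℕ), (e.2 : ℕ))) = Data.ofPairs M := by
  simp [enc, Data.ofPairs, List.map_map, Function.comp_def]

theorem treeSize_matrix {n : ℕ} (H : SimpleGraph (Fin n)) (hn : 0 < n) :
    treeSize (matrix H) ≤ 7 * n ^ 2 := by
  refine (treeSize_list_le (B := n * 4 + 1) (length_matrix H).le fun l hl => ?_).trans ?_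
  · obtain ⟨i, rfl⟩ := (List.mem_ofFn' _ _).1 hl
    exact treeSize_list_le (by simp) fun b _ => treeSize_bool b
  · nlinarith

/-- A bound for the sizes of the components after deletion of the vertices of degree at least `p`,
as in `big_spec`. -/
def componentBound (p : ℕ) : ℕ := p + p + p * (p * p)

/-- A bound for the twin-width of graphs of vertex integrity `p`, from `exists_isSeq_kernel` with
one kept component of each class. -/
def widthBound (p : ℕ) : ℕ :=
  p + 1 * numClasses p (componentBound p) * componentBound p + componentBound p

/-- The number of similar components to be kept, as required by `exists_tokens`. -/
def copyBound (p : ℕ) : ℕ :=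
  (widthBound p + 2) * (2 * (widthBound p + 1) ^ componentBound p) + 1

/-- A bound for the size of the kernel. -/
def kernelBound (p : ℕ) : ℕ :=
  p + copyBound p * numClasses p (componentBound p) * componentBound p

/-- A bound for the number of token lists and the parameters of the successful attempt. -/
def searchBound (p : ℕ) : ℕ :=
  (kernelBound p * kernelBound p + 1) ^ (kernelBound p + kernelBound p) + copyBound p + p + 1

theorem isElementary_searchBound : IsElementary searchBound := by
  have h1 : IsElementary componentBound := (IsElementary.id.add .id).add (.mul .id (.mul .id .id))
  have h2 : IsElementary fun p => numClasses p (componentBound p) :=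
    (h1.add (.const 1)).mul (((IsElementary.const 2).pow (h1.mul h1)).mul
      ((IsElementary.const 2).pow (h1.mul .id)))
  have h3 : IsElementary widthBound :=
    (IsElementary.id.add (((IsElementary.const 1).mul h2).mul h1)).add h1
  have h4 : IsElementary copyBound := ((h3.add (.const 2)).mul
    ((IsElementary.const 2).mul ((h3.add (.const 1)).pow h1))).add (.const 1)
  have h5 : IsElementary kernelBound := IsElementary.id.add ((h4.mul h2).mul h1)
  exact (((((h5.mul h5).add (.const 1)).pow (h5.add h5)).add h4).add .id).add (.const 1)

theorem numClasses_mono {s s' q : ℕ} (h : s ≤ s') : numClasses s q ≤ numClasses s' q := by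
  unfold numClasses
  gcongr
  omega

/-- Graphs of vertex integrity `p` are solved within the bound `searchBound p`. -/
theorem solve_searchBound {n : ℕ} (hn : 0 < n) (H : SimpleGraph (Fin n)) :
    (solve (matrix H, searchBound (vertexIntegrity H))).isSome = true := by
  set p := vertexIntegrity H with hp
  have hG := isMatrix H
  obtain ⟨T, hT, hY⟩ := exists_deletion H
  obtain ⟨h1, h2⟩ := big_spec hG hT (by simpa using hY)
  have hS : ∀ s ∈ big (matrix H) p, s < (matrix H).length := fun s hs => lt_of_mem_big hs
  have hclasses (b : ℕ) : (kernel (matrix H) (big (matrix H) p) b).length ≤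
      p + b * numClasses p (componentBound p) * componentBound p := by
    refine (card_kernel_le hG h2).trans (Nat.add_le_add h1 ?_)
    exact Nat.mul_le_mul_right _ (Nat.mul_le_mul_left _ (numClasses_mono h1))
  obtain ⟨L, hL⟩ := exists_isSeq_kernel hG hS h2 Nat.one_pos (by simpa using hn)
  rw [length_matrix] at hL
  have hwidth : twinWidth H ≤ widthBound p :=
    (twinWidth_le_iff hn).2 ⟨L, ⟨hL.1.mono fun φ hφ => hφ.mono
      (Nat.add_le_add_right (hclasses 1) _), hL.2⟩⟩
  obtain ⟨M, hM⟩ := (twinWidth_le_iff hn).1 le_rfl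
  have hle : twinWidth H ≤ n := by
    obtain ⟨L, hL⟩ := isSeq_id (G := natGraph H) (U := Finset.range n) ⟨0, by simpa using hn⟩
    rw [Finset.card_range] at hL
    exact (twinWidth_le_iff hn).2 ⟨L, hL⟩
  have hcopy : (twinWidth H + 2) * (2 * (twinWidth H + 1) ^ componentBound p) + 1 ≤
      copyBound p := by
    unfold copyBound
    gcongr
  have hker := hclasses (copyBound p)
  have hne : kernel (matrix H) (big (matrix H) p) (copyBound p) ≠ [] := by
    refine List.ne_nil_of_mem (a := 0) (mem_kernel.2 ⟨by simpa using hn, ?_⟩)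
    by_cases h0 : 0 ∈ big (matrix H) p
    · exact .inl h0
    right
    -- no vertex is smaller than `0`, so its component comes first
    have h3 : earlier (matrix H) (big (matrix H) p)
        (component (matrix H) (big (matrix H) p) 0) = ∅ := by
      refine Finset.filter_eq_empty_iff.2 fun r _ h => ?_
      exact absurd (h.2.2 0 ((isComponents hG).self 0 (by simpa using hn) (by simpa using h0)))
        (Nat.not_lt_zero r)
    rw [rank_eq, h3, Finset.card_empty, copyBound]
    omega
  have hpow := Nat.pow_le_pow_left (Nat.add_le_add_right (Nat.mul_le_mul hker hker) 1)
    ((kernel (matrix H) (big (matrix H) p) (copyBound p)).length +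
      (kernel (matrix H) (big (matrix H) p) (copyBound p)).length)
  refine solve_isSome (d := p) (b := copyBound p) (by rw [searchBound]; omega)
    (by rw [searchBound]; omega) (attempt_isSome hG hS h2 (by rw [length_matrix]; exact hle)
      (by rw [length_matrix]; exact hM) hcopy ?_ hne)
  refine (hpow.trans (Nat.pow_le_pow_right (Nat.succ_pos _) (Nat.add_le_add hker hker))).trans ?_
  exact (Nat.le_add_right _ _).trans ((Nat.le_add_right _ _).trans (Nat.le_add_right _ _))

end Algorithm

theorem Polynomial.exists_eval_le (q : ℕ[X]) : ∃ C D : ℕ, ∀ x, q.eval x ≤ C * (x + 1) ^ D := by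
  refine ⟨∑ i ∈ Finset.range (q.natDegree + 1), q.coeff i, q.natDegree, fun x => ?_⟩
  rw [Polynomial.eval_eq_sum_range, Finset.sum_mul]
  refine Finset.sum_le_sum fun i hi => Nat.mul_le_mul_left _ ?_
  exact (Nat.pow_le_pow_left (Nat.le_succ x) i).trans
    (Nat.pow_le_pow_right (Nat.succ_pos x) (Nat.lt_succ_iff.1 (Finset.mem_range.1 hi)))

theorem theorem5p4 :
    ∃ (P : While.Prog) (g : ℕ → ℕ) (c : ℕ), Elementary (fun v : Fin 1 → ℕ => g (v 0)) ∧
      ∀ (n : ℕ), 0 < n → ∀ G : SimpleGraph (Fin n),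
        ∃ (L : List (Fin n × Fin n)) (t : ℕ),
          P.Outputs (Data.ofGraph G) (Data.ofPairs L) t ∧
          t ≤ g (vertexIntegrity G) * n ^ c ∧
          (Trigraph.ofGraph G).IsContractionSeq L ∧
          (Trigraph.ofGraph G).width L ≤ 2 * twinWidth G := by
  obtain ⟨P, q, hP⟩ := PolyTime.solve.exists_search
  obtain ⟨C, D, hq⟩ := q.exists_eval_le
  refine ⟨P, fun p => C * (Algorithm.searchBound p + 8) ^ D, 2 * D,
    (IsElementary.const C).mul ((Algorithm.isElementary_searchBound.add (.const 8)).pow (.const D)),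
    fun n hn G => ?_⟩
  obtain ⟨u, L, t, h1, h2, h3⟩ := hP _ _ (Algorithm.solve_searchBound hn G)
  obtain ⟨M, hM⟩ := (twinWidth_le_iff hn).1 (le_refl (twinWidth G))
  have hle : twinWidth G ≤ n := by
    obtain ⟨L, hL⟩ := isSeq_id (G := natGraph G) (U := Finset.range n) ⟨0, by simpa using hn⟩
    rw [Finset.card_range] at hL
    exact (twinWidth_le_iff hn).2 ⟨L, hL⟩
  have hL := Algorithm.solve_sound (Algorithm.isMatrix G) (w := twinWidth G)
    (by rwa [Algorithm.length_matrix]) (by rwa [Algorithm.length_matrix]) h1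
  rw [Algorithm.length_matrix] at hL
  obtain ⟨N, rfl⟩ := hL.exists_fin
  obtain ⟨h4, h5⟩ := isSeq_map_iff.1 hL
  rw [Algorithm.enc_matrix, Algorithm.enc_map_val] at h2
  refine ⟨N, t, h2, ?_, h4, by rwa [two_mul]⟩
  have h6 := Algorithm.treeSize_matrix G hn
  have h7 : 1 ≤ n ^ 2 := Nat.one_le_pow 2 n hn
  calc
    t ≤ C * (treeSize (Algorithm.matrix G) + Algorithm.searchBound (vertexIntegrity G) + 1) ^ D :=
        h3.trans (hq _)
    _ ≤ C * ((Algorithm.searchBound (vertexIntegrity G) + 8) * n ^ 2) ^ D := by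
        gcongr
        nlinarith
    _ = C * (Algorithm.searchBound (vertexIntegrity G) + 8) ^ D * n ^ (2 * D) := by
        rw [mul_pow, ← pow_mul, mul_assoc]
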